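/- Let $(A,\mathfrak m)$ be a Noetherian local ring with $d=\dim A\ge 2$. Write $\mathrm H^i_{\mathfrak m}(A)$ for the $i$-th local cohomology module of $A$ with respect to $\mathfrak m$, $\ell_A$ for length, and put $\mathfrak c=(0):_A\mathrm H^1_{\mathfrak m}(A)$, the annihilator of $\mathrm H^1_{\mathfrak m}(A)$. Assume that $\mathrm H^i_{\mathfrak m}(A)=(0)$ for all $i\ne 1,d$, and that $\ell_A(\mathrm H^1_{\mathfrak m}(A))<\infty$. Suppose further that 1. $\operatorname{depth} A=1$; 2. the type $\mathrm r_A(A)=\ell_A\bigl(\operatorname{Ext}_A^{\operatorname{depth}A}(A/\mathfrak m,A)\bigr)$ equals $1$; 3. $\mathrm e_{\mathfrak c}(A)=2\,\ell_A(A/\mathfrak c)$, where $\mathrm e_{\mathfrak c}(A)=\lim_{n\to\infty} d!\,\ell_A(A/\mathfrak c^{n})/n^{d}$ is the multiplicity of the $\mathfrak m$-primary ideal $\mathfrak c$. Then the $(S_2)$-ification $\widetilde A$ of $A$ exists and is a Gorenstein ring. Here $\widetilde A$ is the smallest subring $B$ of the total ring of fractions $\mathrm Q(A)$ such that $A\subseteq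 B$, $B$ is a finitely generated $A$-module, and $B$ satisfies Serre's condition $(S_2)$ as an $A$-module, that is, $\operatorname{depth} B_{\mathfrak p}\ge\min\{2,\dim B_{\mathfrak p}\}$ for all $\mathfrak p\in\operatorname{Supp}_A B$. A commutative ring is Gorenstein if it is Noetherian and each of its localizations at prime ideals has finite injective dimension over itself. -/

import Mathlib

open Filter Topology

universe u

noncomputable section

/-- The depth of a module `M` over a local ring `R`: the supremum of the lengths of the
`M`-regular sequences contained in the maximal ideal of `R`. -/
def localDepth (R : Type*) [CommRing R] [IsLocalRing R] (M : Type*) [AddCommGroup M]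
    [Module R M] : ℕ∞ :=
  ⨆ rs : {rs : List R // (∀ r ∈ rs, r ∈ IsLocalRing.maximalIdeal R) ∧
    RingTheory.Sequence.IsRegular M rs}, (rs.1.length : ℕ∞)

/-- The `A`-module `H^i_m(A)`, where `m` is the maximal ideal of the local ring `A`. -/
abbrev localCohomologySelf (A : Type u) [CommRing A] [IsLocalRing A] (i : ℕ) : ModuleCat.{u} A :=
  (localCohomology (IsLocalRing.maximalIdeal A) i).obj (ModuleCat.of A A)

/-- The type of a module `M` over a local ring `(R, m)`, i.e. the length of `Ext^t_R(R/m, M)`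
where `t` is the depth of `M`. -/
def moduleType (R : Type u) [CommRing R] [IsLocalRing R] (M : Type u) [AddCommGroup M]
    [Module R M] : ℕ∞ :=
  Module.length R (CategoryTheory.Abelian.Ext.{u}
    (ModuleCat.of R (R ⧸ IsLocalRing.maximalIdeal R)) (ModuleCat.of R M) (localDepth R M).toNat)

/-- `HasMultiplicity I e` says that `e` is the (Hilbert-Samuel) multiplicity of the ideal `I`,
primary to the maximal ideal of the local ring `R`, i.e. with `d = dim R`,
`e = lim_{n → ∞} d! ℓ(R / I ^ n) / n ^ d`. -/
def HasMultiplicity {R : Type*} [CommRing R] (I : Ideal R) (e : ℝ) : Prop :=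
  ∃ d : ℕ, ringKrullDim R = d ∧
    Tendsto (fun n : ℕ => (d.factorial : ℝ) * ((Module.length R (R ⧸ I ^ n)).toNat : ℝ) /
      (n : ℝ) ^ d) atTop (𝓝 e)

/-- Serre's condition `(S_n)` for an `A`-module `N`: for all `p` in the support of `N`,
`depth N_p ≥ min {n, dim N_p}`. -/
def SatisfiesSerre (A : Type*) [CommRing A] (N : Type*) [AddCommGroup N] [Module A N]
    (n : ℕ) : Prop :=
  ∀ p ∈ Module.support A N,
    min (n : WithBot ℕ∞) (Module.supportDim (Localization.AtPrime p.asIdeal)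
        (LocalizedModule p.asIdeal.primeCompl N)) ≤
      (localDepth (Localization.AtPrime p.asIdeal)
        (LocalizedModule p.asIdeal.primeCompl N) : WithBot ℕ∞)

/-- `B` is the `(S_2)`-ification of `A`: the smallest module-finite birational extension of `A`
(i.e. subalgebra of the total ring of fractions of `A`, finite as an `A`-module) that satisfies
Serre's condition `(S_2)`. -/
def IsS2ification (A : Type u) [CommRing A] (B : Subalgebra A (FractionRing A)) : Prop :=
  IsLeast {C : Subalgebra A (FractionRing A) | Module.Finite A C ∧ SatisfiesSerre A C 2} B

/-- A commutative ring is Gorenstein if it is Noetherian and its localization at each prime ideal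
is a Gorenstein local ring, i.e. has finite injective dimension as a module over itself. -/
def IsGorensteinRing (R : Type u) [CommRing R] : Prop :=
  IsNoetherianRing R ∧ ∀ (p : Ideal R) [p.IsPrime], ∃ n : ℕ,
    CategoryTheory.HasInjectiveDimensionLE
      (ModuleCat.of (Localization.AtPrime p) (Localization.AtPrime p)) n

end

-- Let B be the set of q in Q(A) with m^n q ⊆ A for some n. A nonzerodivisor in m acts invertibly on
-- Q(A), so all Ext(A/m^n, Q(A)) vanish and the sequence A → Q(A) → Q(A)/A identifies B/A with
-- H^1_m(A). Hence B is finite over A, and the long exact sequence gives H^i_m(B) = 0 for i < d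
-- (`vanishes_idealTransform`): B is a maximal Cohen-Macaulay A-module. So B satisfies (S_2)
-- (`satisfiesSerre_two_of_depthGE`). Every (S_2) extension C contains B, because a C-regular pair
-- x, y in m forces each q with m^n q ⊆ A into C (`idealTransform_le_of_satisfiesSerre`).
--
-- For the Gorenstein property, the socle of B/A embeds into Ext^1(k, A), so it has length at most
-- one and ℓ(B/A) = ℓ(A/c). Since c is the conductor, c^n B = c^n for n > 0. This gives e_c(B) =
-- e_c(A) = 2ℓ(A/c), and also ℓ(B/cB) = ℓ(A/c) + ℓ(B/A) = 2ℓ(A/c). When the residue field is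
-- infinite, a superficial sequence in c of length d is B-regular and has colength at most e_c(B) =
-- ℓ(B/cB), so it generates cB. On the other hand the product pairing of B/cB with values in B/A is
-- nondegenerate, and a length count makes B/cB self-injective (`Module.baer_of_nondegenerate`). A
-- ring that is self-injective modulo a regular sequence in its radical has finite injective
-- dimension.
--
-- The infinite residue field is obtained from a flat extension A', so the last step is arranged as
-- a descent. Vanishing of Ext^(d+1)(B/J, B) is read off from the matrices of a free resolution.
-- Their exactness is passed to B/cB, dualized there, lifted over the regular sequence by Nakayama,
-- and brought back to B by faithful flatness (`Matrix.ExactOn.transpose_of_quotient`).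

universe v

noncomputable section

open CategoryTheory Limits Opposite

/-! ### Comparison of derived-functor Ext with Ext in the derived category. -/

namespace CategoryTheory.ProjectiveResolution

variable {R : Type*} [CommRing R] {C : Type*} [Category* C] [Abelian C] [Linear R C]

/-- The map of cochain complexes `Hom(K, Y) ⟶ Hom(K', Y)` induced by `K' ⟶ K`. -/
def linearYonedaMap (R : Type*) [CommRing R] [Linear R C] {K' K : ChainComplex C ℕ} (φ : K' ⟶ K) (Y : C) :
    K.linearYonedaObj R Y ⟶ K'.linearYonedaObj R Y :=
  (HomologicalComplex.unopFunctor (ModuleCat R) (ComplexShape.down ℕ)).map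
    ((((linearYoneda R C).obj Y).rightOp.mapHomologicalComplex (ComplexShape.down ℕ)).map φ).op

-- Pastes two commuting squares, the second one inverted. `isoExt` is such a composite, so its
-- naturality follows by unification.
omit [Abelian C] in
lemma comp_inv_naturality {X₁ X₂ Y₁ Y₂ Z₁ Z₂ : C} (a : X₁ ⟶ X₂) (p₁ : X₁ ⟶ Y₁) (p₂ : X₂ ⟶ Y₂)
    (b : Y₁ ⟶ Y₂) (e₁ : Z₁ ≅ Y₁) (e₂ : Z₂ ≅ Y₂) (c : Z₁ ⟶ Z₂) (h : a ≫ p₂ = p₁ ≫ b)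
    (h' : e₁.hom ≫ b = c ≫ e₂.hom) : a ≫ (p₂ ≫ e₂.inv) = (p₁ ≫ e₁.inv) ≫ c := by
  have hb : b = e₁.inv ≫ c ≫ e₂.hom := by rw [← h']; simp
  rw [← Category.assoc, h, hb]
  simp

variable [EnoughProjectives C]

lemma isoExt_hom_naturality {X X' : C} (P : ProjectiveResolution X) (P' : ProjectiveResolution X')
    (g : X' ⟶ X) (φ : P'.complex ⟶ P.complex) (comm : φ.f 0 ≫ P.π.f 0 = P'.π.f 0 ≫ g)
    (n : ℕ) (Y : C) :
    (((Ext R C n).map g.op).app Y) ≫ (P'.isoExt n Y).hom =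
      (P.isoExt n Y).hom ≫ HomologicalComplex.homologyMap (linearYonedaMap R φ Y) n := by
  have h := ProjectiveResolution.isoLeftDerivedObj_inv_naturality g P' P φ comm
    ((linearYoneda R C).obj Y).rightOp n
  have h' : ((Ext R C n).map g.op).app Y ≫
      (P'.isoLeftDerivedObj ((linearYoneda R C).obj Y).rightOp n).inv.unop =
      (P.isoLeftDerivedObj ((linearYoneda R C).obj Y).rightOp n).inv.unop ≫
      ((((linearYoneda R C).obj Y).rightOp.mapHomologicalComplex (ComplexShape.down ℕ) ⋙
        HomologicalComplex.homologyFunctor (ModuleCat R)ᵒᵖ (ComplexShape.down ℕ) n).map φ).unop :=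
    congrArg Quiver.Hom.unop h
  have h3 : ((P.complex.linearYonedaObj R Y).homologyOp n).unop.hom ≫
      ((((linearYoneda R C).obj Y).rightOp.mapHomologicalComplex (ComplexShape.down ℕ) ⋙
        HomologicalComplex.homologyFunctor (ModuleCat R)ᵒᵖ (ComplexShape.down ℕ) n).map φ).unop =
      HomologicalComplex.homologyMap (linearYonedaMap R φ Y) n ≫
        ((P'.complex.linearYonedaObj R Y).homologyOp n).unop.hom :=
    congrArg Quiver.Hom.unop
      (HomologicalComplex.homologyOp_hom_naturality (linearYonedaMap R φ Y) n)
  exact comp_inv_naturality _ _ _ _ ((P.complex.linearYonedaObj R Y).homologyOp n).unop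
    ((P'.complex.linearYonedaObj R Y).homologyOp n).unop _ h' h3

end CategoryTheory.ProjectiveResolution

namespace ModuleCat

variable {A : Type u} [CommRing A]

open Abelian

variable {X Y : ModuleCat.{u} A} (P : ProjectiveResolution X)

lemma smul_extMk (n : ℕ) (a : A) (f : P.complex.X n ⟶ Y) (hf : P.complex.d (n + 1) n ≫ f = 0) :
    P.extMk (a • f) (n + 1) rfl (by simp [hf]) = a • P.extMk f (n + 1) rfl hf := by
  have := P.extMk_comp_mk₀ f (n + 1) rfl hf (a • 𝟙 Y)
  rw [Abelian.Ext.smul_eq_comp_mk₀, this]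
  simp

/-- The map sending a cocycle to its class in `Ext`. -/
def cocyclesToExt (Y : ModuleCat.{u} A) (n : ℕ) :
    LinearMap.ker (ModuleCat.Hom.hom ((P.complex.linearYonedaObj A Y).d n (n + 1))) →ₗ[A]
      Abelian.Ext.{u} X Y n where
  toFun z := P.extMk z.1 (n + 1) rfl z.2
  map_add' x y := (P.add_extMk (n := n) x.1 y.1 (n + 1) rfl x.2 y.2).symm
  map_smul' a x := smul_extMk P n a x.1 x.2

/-- The map from cycles of the `Hom` complex to `Ext`. -/
def cyclesToExt (Y : ModuleCat.{u} A) (n : ℕ) :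
    (P.complex.linearYonedaObj A Y).cycles n ⟶ ModuleCat.of A (Abelian.Ext.{u} X Y n) :=
  ModuleCat.ofHom (cocyclesToExt P Y n ∘ₗ
    LinearMap.codRestrict _ ((P.complex.linearYonedaObj A Y).iCycles n).hom (fun z =>
      LinearMap.mem_ker.2 (congrArg (fun f => ModuleCat.Hom.hom f z) ((P.complex.linearYonedaObj A Y).iCycles_d n (n + 1)))))

lemma toCycles_cyclesToExt (n : ℕ) (i : ℕ) :
    (P.complex.linearYonedaObj A Y).toCycles i n ≫ cyclesToExt P Y n = 0 := by
  by_cases hi : i + 1 = n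
  · ext f
    have h : (P.complex.linearYonedaObj A Y).iCycles n
        ((P.complex.linearYonedaObj A Y).toCycles i n f) = P.complex.d n i ≫ f :=
      congrArg (fun g => g.hom f) ((P.complex.linearYonedaObj A Y).toCycles_i i n)
    have hf' (f : P.complex.X i ⟶ Y) : P.complex.d (n + 1) n ≫ P.complex.d n i ≫ f = 0 := by
      rw [← Category.assoc, HomologicalComplex.d_comp_d, zero_comp]
    have hf := hf' f
    exact (congrArg (cocyclesToExt P Y n) (Subtype.ext h :
      _ = (⟨P.complex.d n i ≫ f, hf⟩ : LinearMap.ker (ModuleCat.Hom.hom _)))).trans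
      ((P.extMk_eq_zero_iff _ (n + 1) rfl hf i hi).2 ⟨f, rfl⟩)
  · rw [HomologicalComplex.toCycles_eq_zero _ (by simpa using hi), zero_comp]

/-- The map from the cohomology of the `Hom` complex to `Ext`. -/
def homologyToExt (Y : ModuleCat.{u} A) (n : ℕ) :
    (P.complex.linearYonedaObj A Y).homology n ⟶ ModuleCat.of A (Abelian.Ext.{u} X Y n) :=
  ShortComplex.descHomology _ (cyclesToExt P Y n) (toCycles_cyclesToExt P n _)

lemma π_homologyToExt (Y : ModuleCat.{u} A) (n : ℕ) :
    (P.complex.linearYonedaObj A Y).homologyπ n ≫ homologyToExt P Y n = cyclesToExt P Y n :=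
  ShortComplex.π_descHomology _ _ _

/-- The object of cycles is an abstract kernel, so an element of it is obtained by lifting the map
from `A` that sends 1 to `f`. -/
lemma exists_cycle (Y : ModuleCat.{u} A) (n : ℕ) (f : P.complex.X n ⟶ Y)
    (hf : P.complex.d (n + 1) n ≫ f = 0) :
    ∃ z : (P.complex.linearYonedaObj A Y).cycles n,
      (P.complex.linearYonedaObj A Y).iCycles n z = f := by
  let k : ModuleCat.of A A ⟶ (P.complex.linearYonedaObj A Y).X n :=
    ModuleCat.ofHom (LinearMap.toSpanSingleton A (P.complex.X n ⟶ Y) f)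
  have hk : k ≫ (P.complex.linearYonedaObj A Y).d n (n + 1) = 0 := by
    ext
    exact (congrArg (fun g => P.complex.d (n + 1) n ≫ g) (one_smul A f)).trans hf
  refine ⟨(P.complex.linearYonedaObj A Y).liftCycles k (n + 1) (by simp) hk (1 : A), ?_⟩
  have := congrArg (fun g => ModuleCat.Hom.hom g (1 : A))
    ((P.complex.linearYonedaObj A Y).liftCycles_i k (n + 1) (by simp) hk)
  exact this.trans (one_smul A f)

/-- Injectivity rests on a cocycle being zero in Ext exactly when it factors through the preceding
differential. That criterion needs a preceding degree, hence `n + 1`. -/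
lemma homologyToExt_bijective (Y : ModuleCat.{u} A) (n : ℕ) :
    Function.Bijective (homologyToExt P Y (n + 1)).hom := by
  set K := P.complex.linearYonedaObj A Y with hK
  have hπ (z : K.cycles (n + 1)) : homologyToExt P Y (n + 1) (K.homologyπ (n + 1) z) =
      cyclesToExt P Y (n + 1) z :=
    congrArg (fun g => ModuleCat.Hom.hom g z) (π_homologyToExt P Y (n + 1))
  constructor
  · rw [injective_iff_map_eq_zero]
    intro x hx
    obtain ⟨z, rfl⟩ := (ModuleCat.epi_iff_surjective (K.homologyπ (n + 1))).1 inferInstance x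
    have hf : P.complex.d (n + 1 + 1) (n + 1) ≫ K.iCycles (n + 1) z = 0 :=
      congrArg (fun f => ModuleCat.Hom.hom f z) (K.iCycles_d (n + 1) (n + 1 + 1))
    obtain ⟨g, hg⟩ := (P.extMk_eq_zero_iff _ (n + 1 + 1) rfl hf n rfl).1 ((hπ z).symm.trans hx)
    have hz : K.toCycles n (n + 1) g = z := by
      apply (ModuleCat.mono_iff_injective (K.iCycles (n + 1))).1 inferInstance
      exact (congrArg (fun f => ModuleCat.Hom.hom f g) (K.toCycles_i n (n + 1))).trans hg
    rw [← hz]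
    exact congrArg (fun f => ModuleCat.Hom.hom f g) (K.toCycles_comp_homologyπ n (n + 1))
  · intro e
    obtain ⟨f, hf, rfl⟩ := P.extMk_surjective e (n + 1 + 1) rfl
    obtain ⟨z, hz⟩ := exists_cycle P Y (n + 1) f hf
    refine ⟨K.homologyπ (n + 1) z, (hπ z).trans ?_⟩
    subst hz
    rfl

/-- The comparison between `Ext` as a derived functor and `Ext` in the derived category. -/
def extEquiv (X Y : ModuleCat.{u} A) (n : ℕ) :
    ((Ext A (ModuleCat.{u} A) (n + 1)).obj (op X)).obj Y ≃ₗ[A] Abelian.Ext.{u} X Y (n + 1) :=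
  ((CategoryTheory.projectiveResolution X).isoExt (R := A) (n + 1) Y).toLinearEquiv.trans
    (LinearEquiv.ofBijective (homologyToExt (CategoryTheory.projectiveResolution X) Y (n + 1)).hom
      (homologyToExt_bijective (CategoryTheory.projectiveResolution X) Y n))

lemma cocyclesToExt_naturality {X' : ModuleCat.{u} A} (P' : ProjectiveResolution X')
    {g : X' ⟶ X} (φ : ProjectiveResolution.Hom P' P g) (n : ℕ) (Y : ModuleCat.{u} A)
    (f : P.complex.X n ⟶ Y) (hf : P.complex.d (n + 1) n ≫ f = 0) (w : _)
    (hw : w.1 = φ.hom.f n ≫ f) :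
    cocyclesToExt P' Y n w =
      (Abelian.Ext.mk₀ g).comp (cocyclesToExt P Y n ⟨f, hf⟩) (zero_add n) := by
  have hz' : P'.complex.d (n + 1) n ≫ φ.hom.f n ≫ f = 0 := by
    rw [← φ.hom.comm_assoc, hf, comp_zero]
  obtain rfl : w = ⟨φ.hom.f n ≫ f, hz'⟩ := Subtype.ext hw
  exact (ProjectiveResolution.mk₀_comp_extMk f (n + 1) rfl hf φ).symm

lemma homologyMap_homologyToExt {X' : ModuleCat.{u} A} (P' : ProjectiveResolution X')
    {g : X' ⟶ X} (φ : ProjectiveResolution.Hom P' P g) (n : ℕ) (Y : ModuleCat.{u} A)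
    (x : (P.complex.linearYonedaObj A Y).homology n) :
    homologyToExt P' Y n
      (HomologicalComplex.homologyMap (ProjectiveResolution.linearYonedaMap A φ.hom Y) n x) =
    (Abelian.Ext.mk₀ g).comp (homologyToExt P Y n x) (zero_add n) := by
  obtain ⟨z, rfl⟩ := (ModuleCat.epi_iff_surjective
    ((P.complex.linearYonedaObj A Y).homologyπ n)).1 inferInstance x
  have hπ := congrArg (fun g => ModuleCat.Hom.hom g z) (π_homologyToExt P Y n)
  have hπ' := congrArg (fun g => ModuleCat.Hom.hom g (HomologicalComplex.cyclesMap
    (ProjectiveResolution.linearYonedaMap A φ.hom Y) n z)) (π_homologyToExt P' Y n)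
  have h1 := congrArg (fun f => ModuleCat.Hom.hom f z) (HomologicalComplex.homologyπ_naturality
    (ProjectiveResolution.linearYonedaMap A φ.hom Y) n)
  have h2 := congrArg (fun f => ModuleCat.Hom.hom f z) (HomologicalComplex.cyclesMap_i
    (ProjectiveResolution.linearYonedaMap A φ.hom Y) n)
  refine (congrArg (homologyToExt P' Y n).hom h1).trans (hπ'.trans ?_)
  refine Eq.trans ?_ (congrArg (fun e => (Abelian.Ext.mk₀ g).comp e (zero_add n)) hπ.symm)
  exact cocyclesToExt_naturality P P' φ n Y _ _ _ h2

/-- Carries the transition maps of the colimit defining local cohomology over to precomposition with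
the projections `A / J ^ m ⟶ A / J ^ n`. -/
lemma extEquiv_naturality {X X' : ModuleCat.{u} A} (g : X' ⟶ X) (Y : ModuleCat.{u} A) (n : ℕ)
    (x : ((Ext A (ModuleCat.{u} A) (n + 1)).obj (op X)).obj Y) :
    extEquiv X' Y n ((((Ext A (ModuleCat.{u} A) (n + 1)).map g.op).app Y) x) =
      (Abelian.Ext.mk₀ g).comp (extEquiv X Y n x) (zero_add (n + 1)) := by
  obtain ⟨φ⟩ : Nonempty (ProjectiveResolution.Hom (CategoryTheory.projectiveResolution X')
      (CategoryTheory.projectiveResolution X) g) :=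
    ⟨⟨ProjectiveResolution.lift g _ _, by
      simpa using ProjectiveResolution.lift_commutes_zero g _ _⟩⟩
  have h := congrArg (fun f => ModuleCat.Hom.hom f x)
    (ProjectiveResolution.isoExt_hom_naturality (R := A) (CategoryTheory.projectiveResolution X)
      (CategoryTheory.projectiveResolution X') g φ.hom
      (φ.hom_f_zero_comp_π_f_zero.trans rfl) (n + 1) Y)
  exact (congrArg (homologyToExt _ Y (n + 1)) h).trans (homologyMap_homologyToExt _ _ φ (n + 1) Y _)

end ModuleCat

/-! ### Local cohomology as the colimit of the Ext(A / J ^ n, M). -/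

namespace localCohomology
variable {A : Type u} [CommRing A]

/-- The projection `A / J ^ m ⟶ A / J ^ n` for `n ≤ m`. -/
def quotPowMap (J : Ideal A) {n m : ℕ} (h : n ≤ m) :
    ModuleCat.of A (A ⧸ J ^ m) ⟶ ModuleCat.of A (A ⧸ J ^ n) :=
  ModuleCat.ofHom (Submodule.mapQ _ _ LinearMap.id (Ideal.pow_le_pow_right h))

lemma quotPowMap_comp (J : Ideal A) {n m l : ℕ} (h : n ≤ m) (h' : m ≤ l) :
    quotPowMap J h' ≫ quotPowMap J h = quotPowMap J (h.trans h') := by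
  ext
  rfl

/-- This is the only description of local cohomology used later. The colimit lives in a functor
category; evaluation at `M` preserves it, and being filtered it is computed on underlying sets. -/
theorem exists_maps (J : Ideal A) (i : ℕ) (M : ModuleCat.{u} A) :
    ∃ ι : ∀ n, Abelian.Ext.{u} (ModuleCat.of A (A ⧸ J ^ n)) M (i + 1) →ₗ[A]
        (localCohomology J (i + 1)).obj M,
      (∀ x, ∃ n e, ι n e = x) ∧
      (∀ n e, ι n e = 0 ↔ ∃ (m : ℕ) (h : n ≤ m),
        (Abelian.Ext.mk₀ (quotPowMap J h)).comp e (zero_add (i + 1)) = 0) ∧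
      (∀ n m (h : n ≤ m) e,
        ι m ((Abelian.Ext.mk₀ (quotPowMap J h)).comp e (zero_add (i + 1))) = ι n e) := by
  have : HasColimit (diagram (idealPowersDiagram J) (i + 1)) := hasColimitDiagram.{u, 0} _ _
  let F := diagram (idealPowersDiagram J) (i + 1) ⋙ (evaluation _ _).obj M
  let c : Cocone F := ((evaluation _ _).obj M).mapCocone
    (colimit.cocone (diagram (idealPowersDiagram J) (i + 1)))
  have hc : IsColimit c := isColimitOfPreserves ((evaluation _ _).obj M) (colimit.isColimit _)
  have : PreservesFilteredColimitsOfSize.{0, 0} (forget (ModuleCat.{u} A)) :=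
    preservesSmallestFilteredColimits_of_preservesFilteredColimits _
  have : IsFiltered ℕᵒᵖᵒᵖ := inferInstance
  have : PreservesColimit F (forget (ModuleCat.{u} A)) :=
    (PreservesFilteredColimitsOfSize.preserves_filtered_colimits ℕᵒᵖᵒᵖ).preservesColimit
  let E (n : ℕ) := (ModuleCat.extEquiv (ModuleCat.of A (A ⧸ J ^ n)) M i)
  let ι (n : ℕ) : Abelian.Ext.{u} (ModuleCat.of A (A ⧸ J ^ n)) M (i + 1) →ₗ[A]
        (localCohomology J (i + 1)).obj M :=
    (c.ι.app (op (op n))).hom ∘ₗ (E n).symm.toLinearMap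
  have hmap (n m : ℕ) (h : n ≤ m) (e : F.obj (op (op n))) :
      E m (F.map (homOfLE h).op.op e) =
        (Abelian.Ext.mk₀ (quotPowMap J h)).comp (E n e) (zero_add (i + 1)) :=
    ModuleCat.extEquiv_naturality (quotPowMap J h) M i e
  have hw (n m : ℕ) (h : n ≤ m) (e : F.obj (op (op n))) :
      c.ι.app (op (op m)) (F.map (homOfLE h).op.op e) = c.ι.app (op (op n)) e :=
    congrArg (fun f => ModuleCat.Hom.hom f e) (c.w (homOfLE h).op.op)
  refine ⟨ι, fun x => ?_, fun n e => ?_, fun n m h e => ?_⟩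
  · obtain ⟨⟨⟨n⟩⟩, e, he⟩ := Concrete.isColimit_exists_rep F hc x
    refine ⟨n, E n e, ?_⟩
    exact (congrArg (c.ι.app (op (op n))).hom ((E n).symm_apply_apply e)).trans he
  · constructor
    · intro h
      have h0 : c.ι.app (op (op n)) ((E n).symm e) = c.ι.app (op (op n)) 0 := h.trans (map_zero _).symm
      obtain ⟨⟨⟨m⟩⟩, f, g, hfg⟩ := Concrete.isColimit_exists_of_rep_eq F hc _ _ h0
      have hnm : n ≤ m := leOfHom f.unop.unop
      refine ⟨m, hnm, ?_⟩
      have hf : f = (homOfLE hnm).op.op := Subsingleton.elim _ _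
      have := hmap n m hnm ((E n).symm e)
      rw [LinearEquiv.apply_symm_apply] at this
      rw [← this, ← hf]
      have h2 : F.map f ((E n).symm e) = 0 := hfg.trans (map_zero _)
      rw [h2]
      exact map_zero _
    · rintro ⟨m, h, he⟩
      have := hmap n m h ((E n).symm e)
      rw [LinearEquiv.apply_symm_apply, he] at this
      have h2 : F.map (homOfLE h).op.op ((E n).symm e) = 0 := (E m).map_eq_zero_iff.1 this
      have h3 := hw n m h ((E n).symm e)
      rw [h2] at h3
      exact h3.symm.trans (map_zero _)
  · have := hmap n m h ((E n).symm e)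
    rw [LinearEquiv.apply_symm_apply] at this
    rw [← this]
    exact (congrArg (c.ι.app (op (op m))).hom ((E m).symm_apply_apply _)).trans (hw n m h _)

end localCohomology

/-! ### Power torsion of injective modules. -/

/-- The submodule of elements killed by a power of the ideal `J`. -/
def powTorsion {A : Type*} [CommRing A] (J : Ideal A) (E : Type*) [AddCommGroup E] [Module A E] :
    Submodule A E where
  carrier := {x | ∃ n : ℕ, ∀ a ∈ J ^ n, a • x = 0}
  add_mem' := by
    rintro x y ⟨n, hn⟩ ⟨m, hm⟩
    exact ⟨n + m, fun a ha => by
      rw [smul_add, hn a (Ideal.pow_le_pow_right (by lia) ha),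
        hm a (Ideal.pow_le_pow_right (by lia) ha), add_zero]⟩
  zero_mem' := ⟨0, fun a _ => smul_zero a⟩
  smul_mem' := by
    rintro b x ⟨n, hn⟩
    exact ⟨n, fun a ha => by rw [smul_comm, hn a ha, smul_zero]⟩

lemma mem_powTorsion {A : Type*} [CommRing A] {J : Ideal A} {E : Type*} [AddCommGroup E]
    [Module A E] {x : E} : x ∈ powTorsion J E ↔ ∃ n : ℕ, ∀ a ∈ J ^ n, a • x = 0 := Iff.rfl

/-- Baer's criterion and Artin-Rees: a map from an ideal `I` to the torsion factors through the
image of `I` in some `A / J ^ r`. It extends from there to `A / J ^ r` with values in `E`, and these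
values are automatically torsion. -/
theorem injective_powTorsion {A : Type u} [CommRing A] [IsNoetherianRing A] (J : Ideal A)
    (E : Type u) [AddCommGroup E] [Module A E] [hE : Module.Injective A E] :
    Module.Injective A (powTorsion J E) := by
  apply Module.Baer.injective
  intro I f
  -- a power of `J` kills the range of `f`
  obtain ⟨k, hk⟩ : ∃ k : ℕ, ∀ a ∈ J ^ k, ∀ x : I, a • f x = 0 := by
    obtain ⟨s, hs⟩ := (IsNoetherian.noetherian (⊤ : Submodule A I))
    have : ∀ x : I, ∃ n : ℕ, ∀ a ∈ J ^ n, a • f x = 0 := fun x => by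
      obtain ⟨n, hn⟩ := (f x).2
      exact ⟨n, fun a ha => Subtype.ext (hn a ha)⟩
    choose n hn using this
    refine ⟨s.sup n, fun a ha x => ?_⟩
    have hx : x ∈ Submodule.span A (s : Set I) := hs ▸ Submodule.mem_top
    induction hx using Submodule.span_induction with
    | mem x hx => exact hn x a (Ideal.pow_le_pow_right (Finset.le_sup hx) ha)
    | zero => simp
    | add x y _ _ h1 h2 => rw [map_add, smul_add, h1, h2, add_zero]
    | smul b x _ h => rw [map_smul, smul_comm, h, smul_zero]
  obtain ⟨k0, hk0⟩ := J.exists_pow_inf_eq_pow_smul (M := A) I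
  have hr := hk0 (k0 + k) (by lia)
  rw [Nat.add_sub_cancel_left] at hr
  -- By Artin-Rees the elements of `I` in `J ^ (k0 + k)` lie in `J ^ k • I`, which `f` kills.
  have hker : ∀ x : I, (x : A) ∈ J ^ (k0 + k) → f x = 0 := by
    intro x hx
    have hx' : (x : A) ∈ J ^ k • (J ^ k0 • ⊤ ⊓ I : Submodule A A) := by
      rw [← hr]; exact ⟨by simpa using hx, x.2⟩
    have : ∀ y ∈ J ^ k • (J ^ k0 • ⊤ ⊓ I : Submodule A A), ∃ h : y ∈ I, f ⟨y, h⟩ = 0 := by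
      intro y hy
      refine Submodule.smul_induction_on hy (fun a ha z hz => ?_) (fun y z hy hz => ?_)
      · refine ⟨I.smul_mem a hz.2, ?_⟩
        have := hk a ha ⟨z, hz.2⟩
        rwa [← map_smul] at this
      · obtain ⟨h1, h1'⟩ := hy
        obtain ⟨h2, h2'⟩ := hz
        refine ⟨I.add_mem h1 h2, ?_⟩
        have := map_add f ⟨y, h1⟩ ⟨z, h2⟩
        rw [h1', h2', add_zero] at this
        exact this
    exact (this _ hx').2
  -- extend from `I ⊔ J ^ r`
  let r := k0 + k
  let q : I →ₗ[A] A ⧸ J ^ r := (J ^ r).mkQ ∘ₗ I.subtype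
  have hq : LinearMap.ker q ≤ LinearMap.ker f := fun x hx => by
    apply hker
    exact Ideal.Quotient.eq_zero_iff_mem.1 hx
  let f' : LinearMap.range q →ₗ[A] E := (powTorsion J E).subtype ∘ₗ
    ((LinearMap.ker q).liftQ f hq) ∘ₗ q.quotKerEquivRange.symm.toLinearMap
  obtain ⟨g, hg⟩ := hE.out (LinearMap.range q).subtype (Submodule.injective_subtype _) f'
  have hgt : ∀ x, g ((J ^ r).mkQ x) ∈ powTorsion J E := fun x => ⟨r, fun a ha => by
    rw [← map_smul, ← map_smul]
    have : (J ^ r).mkQ (a • x) = 0 := by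
      exact Ideal.Quotient.eq_zero_iff_mem.2 (Ideal.mul_mem_right x _ ha)
    rw [this, map_zero]⟩
  refine ⟨LinearMap.codRestrict _ (g ∘ₗ (J ^ r).mkQ) hgt, fun x hx => Subtype.ext ?_⟩
  have := hg (q.rangeRestrict ⟨x, hx⟩)
  have h2 : q.quotKerEquivRange.symm (q.rangeRestrict ⟨x, hx⟩) = Submodule.Quotient.mk ⟨x, hx⟩ := by
    rw [LinearEquiv.symm_apply_eq]; rfl
  simp only [f', LinearMap.comp_apply, LinearEquiv.coe_coe, h2] at this
  exact this

/-! ### Long exact sequences for local cohomology and vanishing on torsion modules. -/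

namespace localCohomology

open Abelian

variable {A : Type u} [CommRing A] (J : Ideal A)

/-- The class `e` dies in the colimit of the `Ext(A / J ^ n, M)`. -/
def Dies {n i : ℕ} {M : ModuleCat.{u} A} (e : Abelian.Ext.{u} (ModuleCat.of A (A ⧸ J ^ n)) M i) : Prop :=
  ∃ (m : ℕ) (h : n ≤ m), (Ext.mk₀ (quotPowMap J h)).comp e (zero_add i) = 0

/-- The colimit of the `Ext^i(A / J ^ n, M)` vanishes. -/
def Vanishes (i : ℕ) (M : ModuleCat.{u} A) : Prop :=
  ∀ n (e : Abelian.Ext.{u} (ModuleCat.of A (A ⧸ J ^ n)) M i), Dies J e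

variable {J}

lemma vanishes_of_subsingleton {i : ℕ} {M : ModuleCat.{u} A}
    [h : Subsingleton ((localCohomology J (i + 1)).obj M)] : Vanishes J (i + 1) M := by
  obtain ⟨ι, -, h0, -⟩ := exists_maps J i M
  exact fun n e => (h0 n e).1 (Subsingleton.elim _ _)

lemma Dies.of_restrict {n m i : ℕ} {M : ModuleCat.{u} A}
    {e : Abelian.Ext.{u} (ModuleCat.of A (A ⧸ J ^ n)) M i} (h : n ≤ m)
    (he : Dies J ((Ext.mk₀ (quotPowMap J h)).comp e (zero_add i))) : Dies J e := by
  obtain ⟨l, hl, he⟩ := he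
  refine ⟨l, h.trans hl, ?_⟩
  rwa [Ext.mk₀_comp_mk₀_assoc, quotPowMap_comp] at he

lemma Dies.comp {n i j k : ℕ} {M N : ModuleCat.{u} A}
    {e : Abelian.Ext.{u} (ModuleCat.of A (A ⧸ J ^ n)) M i} (he : Dies J e)
    (b : Abelian.Ext.{u} M N j) (hk : i + j = k) : Dies J (e.comp b hk) := by
  obtain ⟨l, hl, he⟩ := he
  refine ⟨l, hl, ?_⟩
  rw [← Ext.comp_assoc _ _ _ (zero_add i) hk (by lia), he, Ext.zero_comp]

lemma restrict_comp {n m i j k : ℕ} {M N : ModuleCat.{u} A}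
    (h : n ≤ m) (e : Abelian.Ext.{u} (ModuleCat.of A (A ⧸ J ^ n)) M i)
    (b : Abelian.Ext.{u} M N j) (hk : i + j = k) :
    (Ext.mk₀ (quotPowMap J h)).comp (e.comp b hk) (zero_add k) =
      ((Ext.mk₀ (quotPowMap J h)).comp e (zero_add i)).comp b hk := by
  rw [← Ext.comp_assoc _ _ _ (zero_add i) hk (by lia)]

variable {S : ShortComplex (ModuleCat.{u} A)} (hS : S.ShortExact)

-- The long exact sequence in the colimit, one class at a time: after restriction to a larger power
-- of `J` the image in `S.X₃` is zero, so the class lifts to `S.X₁`, where it dies.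
include hS in
lemma Vanishes.middle {i : ℕ} (h1 : Vanishes J i S.X₁) (h3 : Vanishes J i S.X₃) :
    Vanishes J i S.X₂ := by
  intro n e
  obtain ⟨m, h, he⟩ := h3 n (e.comp (Ext.mk₀ S.g) (add_zero i))
  rw [restrict_comp] at he
  obtain ⟨e', he'⟩ := Ext.covariant_sequence_exact₂ _ hS _ he
  refine Dies.of_restrict h ?_
  rw [← he']
  exact (h1 m e').comp _ _

include hS in
lemma Vanishes.right {i : ℕ} (h2 : Vanishes J i S.X₂) (h1 : Vanishes J (i + 1) S.X₁) :
    Vanishes J i S.X₃ := by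
  intro n e
  obtain ⟨m, h, he⟩ := h1 n (e.comp hS.extClass rfl)
  rw [restrict_comp] at he
  obtain ⟨e', he'⟩ := Ext.covariant_sequence_exact₃ _ hS _ rfl he
  refine Dies.of_restrict h ?_
  rw [← he']
  exact (h2 m e').comp _ _

lemma exists_hom_quotPow {M : ModuleCat.{u} A} (n : ℕ) (x : M) (hx : ∀ a ∈ J ^ n, a • x = 0) :
    ∃ f : ModuleCat.of A (A ⧸ J ^ n) ⟶ M, f (Ideal.Quotient.mk _ 1) = x := by
  refine ⟨ModuleCat.ofHom ((J ^ n).liftQ (LinearMap.toSpanSingleton A M x) fun a ha => ?_), ?_⟩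
  · exact LinearMap.mem_ker.2 (hx a ha)
  · exact one_smul A x

/-- The middle term is the power torsion of an injective module containing `T`, injective by
`injective_powTorsion`. It is the device for dimension shifting inside torsion modules. -/
lemma exists_shortExact_injective [IsNoetherianRing A] (T : ModuleCat.{u} A)
    (hT : powTorsion J T = ⊤) :
    ∃ S : ShortComplex (ModuleCat.{u} A), S.ShortExact ∧ S.X₁ = T ∧ Injective S.X₂ ∧
      powTorsion J S.X₂ = ⊤ := by
  obtain ⟨E, ι, hι, hEi⟩ : ∃ (E : ModuleCat.{u} A) (ι : T ⟶ E), Mono ι ∧ Injective E :=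
    ⟨Injective.under T, Injective.ι T, inferInstance, inferInstance⟩
  have hE : Module.Injective A E :=
    Module.injective_module_of_injective_object _ _ 
  let j : T →ₗ[A] powTorsion J E :=
    LinearMap.codRestrict _ ι.hom (fun x => by
      obtain ⟨n, hn⟩ := mem_powTorsion.1 (hT ▸ Submodule.mem_top : x ∈ powTorsion J T)
      exact ⟨n, fun a ha => by rw [← map_smul, hn a ha, map_zero]⟩)
  have hj : Function.Injective j := fun x y hxy =>
    (ModuleCat.mono_iff_injective ι).1 inferInstance (congrArg Subtype.val hxy)
  refine ⟨ModuleCat.shortComplexOfCompEqZero j (LinearMap.range j).mkQ (by ext; simp),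
    ModuleCat.shortComplex_shortExact _ ?_ hj (Submodule.mkQ_surjective _), rfl, ?_, ?_⟩
  · intro x
    simp
  · have := injective_powTorsion J E
    exact Module.injective_object_of_injective_module A (powTorsion J E)
  · rw [eq_top_iff]
    rintro ⟨x, n, hn⟩ -
    exact ⟨n, fun a ha => Subtype.ext (hn a ha)⟩

/-- A module all of whose elements are killed by powers of `J` has no higher local cohomology. -/
theorem vanishes_of_torsion [IsNoetherianRing A] (i : ℕ) (T : ModuleCat.{u} A)
    (hT : powTorsion J T = ⊤) : Vanishes J (i + 1) T := by
  induction i generalizing T with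
  | zero =>
    obtain ⟨S, hS, rfl, hinj, htor⟩ := exists_shortExact_injective T hT
    intro n e
    obtain ⟨x, rfl⟩ := Ext.covariant_sequence_exact₁ _ hS e (Ext.eq_zero_of_injective _) rfl
    obtain ⟨f, rfl⟩ := (Ext.mk₀_bijective _ _).2 x
    obtain ⟨g, hg⟩ := hS.moduleCat_surjective_g (f (Ideal.Quotient.mk _ 1))
    obtain ⟨m, hm⟩ := mem_powTorsion.1 (htor ▸ Submodule.mem_top : g ∈ powTorsion J S.X₂)
    obtain ⟨g', hg'⟩ := exists_hom_quotPow (n + m) g (fun a ha =>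
      hm a (Ideal.pow_le_pow_right (by lia) ha))
    have h : n ≤ n + m := by lia
    refine ⟨n + m, h, ?_⟩
    -- The element `f 1` lifts to a torsion element of `S.X₂`, so over a larger power of `J` the map
    -- `f` factors through `S.g`, and the connecting class dies.
    have key : quotPowMap J h ≫ f = g' ≫ S.g := by
      ext
      change f (Ideal.Quotient.mk _ 1) = S.g (g' (Ideal.Quotient.mk _ 1))
      rw [hg', hg]
    rw [restrict_comp, Ext.mk₀_comp_mk₀, key, ← Ext.mk₀_comp_mk₀, Ext.comp_assoc_of_second_deg_zero,
      hS.comp_extClass, Ext.comp_zero]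
  | succ i ih =>
    obtain ⟨S, hS, rfl, hinj, htor⟩ := exists_shortExact_injective T hT
    intro n e
    -- Dimension shift: the class is the connecting image of a class in the quotient, which is again
    -- torsion.
    obtain ⟨x, rfl⟩ := Ext.covariant_sequence_exact₁ _ hS e (Ext.eq_zero_of_injective _) rfl
    refine (ih S.X₃ ?_ n x).comp _ _
    rw [eq_top_iff]
    intro y _
    obtain ⟨g, rfl⟩ := hS.moduleCat_surjective_g y
    obtain ⟨m, hm⟩ := mem_powTorsion.1 (htor ▸ Submodule.mem_top : g ∈ powTorsion J S.X₂)
    exact ⟨m, fun a ha => by rw [← map_smul, hm a ha, map_zero]⟩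

end localCohomology

/-! ### First local cohomology as torsion of a cokernel. -/

namespace localCohomology

open Abelian

variable {A : Type u} [CommRing A] {J : Ideal A}

lemma smul_eq_zero_of_smul_id_eq_zero {X Y : ModuleCat.{u} A} {i : ℕ} (e : Abelian.Ext.{u} X Y i)
    (r : A) (hr : ∀ x : X, r • x = 0) : r • e = 0 := by
  have h : r • 𝟙 X = 0 := by ext x; exact hr x
  rw [← Ext.mk₀_id_comp e, ← Ext.smul_comp, ← Ext.mk₀_smul, h, Ext.mk₀_zero, Ext.zero_comp]

/-- The scalar `r` acts on Ext as zero through `X` and invertibly through `Y`. -/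
lemma ext_eq_zero_of_bijective {X Y : ModuleCat.{u} A} {i : ℕ} (e : Abelian.Ext.{u} X Y i)
    (r : A) (hr : ∀ x : X, r • x = 0) (hb : Function.Bijective (fun y : Y => r • y)) : e = 0 := by
  let u := LinearEquiv.ofBijective (LinearMap.lsmul A Y r) hb
  have h : r • ModuleCat.ofHom u.symm.toLinearMap = 𝟙 Y := by
    ext y
    exact u.apply_symm_apply y
  rw [← Ext.comp_mk₀_id e, ← h, Ext.mk₀_smul, Ext.comp_smul]
  exact smul_eq_zero_of_smul_id_eq_zero _ r hr

lemma quotPow_smul_eq_zero (n : ℕ) {a : A} (ha : a ∈ J ^ n) (x : ModuleCat.of A (A ⧸ J ^ n)) :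
    a • x = 0 := by
  obtain ⟨x, rfl⟩ := Ideal.Quotient.mk_surjective x
  exact Ideal.Quotient.eq_zero_iff_mem.2 (Ideal.mul_mem_right x _ ha)

variable (J) in
/-- The map `A / J ^ n ⟶ M` given by an element killed by `J ^ n`. -/
def homOfTorsion {M : ModuleCat.{u} A} (n : ℕ) (x : M) (hx : ∀ a ∈ J ^ n, a • x = 0) :
    ModuleCat.of A (A ⧸ J ^ n) ⟶ M :=
  ModuleCat.ofHom ((J ^ n).liftQ (LinearMap.toSpanSingleton A M x) fun a ha =>
    LinearMap.mem_ker.2 (hx a ha))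

lemma homOfTorsion_one {M : ModuleCat.{u} A} (n : ℕ) (x : M) (hx : ∀ a ∈ J ^ n, a • x = 0) :
    homOfTorsion J n x hx (Ideal.Quotient.mk _ 1) = x := one_smul A x

lemma hom_quot_ext {M : ModuleCat.{u} A} {I : Ideal A} {f g : ModuleCat.of A (A ⧸ I) ⟶ M}
    (h : f (Ideal.Quotient.mk _ 1) = g (Ideal.Quotient.mk _ 1)) : f = g := by
  ext
  exact h

variable {S : ShortComplex (ModuleCat.{u} A)} (hS : S.ShortExact) {r : A} (hrJ : r ∈ J)
  (hr : Function.Bijective (fun y : S.X₂ => r • y))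

include hr in
lemma bijective_pow_smul (n : ℕ) : Function.Bijective (fun y : S.X₂ => r ^ n • y) := by
  induction n with
  | zero =>
    simp only [pow_zero, one_smul]
    exact Function.bijective_id
  | succ n ih =>
    have := hr.comp ih
    convert this using 2 with y
    simp [pow_succ', mul_smul]

include hrJ hr hS in
/-- If some element of `J` acts bijectively on the middle term of a short exact sequence, then
the first local cohomology of the left term is the `J`-power torsion of the right term. -/
theorem exists_linearEquiv_powTorsion :
    Nonempty (powTorsion J S.X₃ ≃ₗ[A] (localCohomology J 1).obj S.X₁) := by
  obtain ⟨ι, hι, h0, hcomp⟩ := exists_maps J 0 S.X₁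
  -- The connecting class of the map `A / J ^ n ⟶ S.X₃` given by `t`. A power of `r` kills `A / J ^
  -- n` and is invertible on `S.X₂`, so the neighbouring Ext groups vanish and nothing is lost or
  -- missed.
  let δ (n : ℕ) (t : S.X₃) (ht : ∀ a ∈ J ^ n, a • t = 0) : Abelian.Ext.{u} _ S.X₁ 1 :=
    (Ext.mk₀ (homOfTorsion J n t ht)).comp hS.extClass (zero_add 1)
  have hδ (n m : ℕ) (h : n ≤ m) (t : S.X₃) (ht : ∀ a ∈ J ^ n, a • t = 0)
      (ht' : ∀ a ∈ J ^ m, a • t = 0) : ι n (δ n t ht) = ι m (δ m t ht') := by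
    rw [← hcomp n m h]
    congr 1
    simp only [δ]
    rw [restrict_comp, Ext.mk₀_comp_mk₀]
    have : quotPowMap J h ≫ homOfTorsion J n t ht = homOfTorsion J m t ht' := hom_quot_ext rfl
    rw [this]
  have hex (t : powTorsion J S.X₃) : ∃ n : ℕ, ∀ a ∈ J ^ n, a • (t : S.X₃) = 0 := t.2
  choose N hN using hex
  let θ (t : powTorsion J S.X₃) : (localCohomology J 1).obj S.X₁ := ι (N t) (δ (N t) t (hN t))
  have hθ (t : powTorsion J S.X₃) (n : ℕ) (ht : ∀ a ∈ J ^ n, a • (t : S.X₃) = 0) :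
      θ t = ι n (δ n t ht) := by
    have ht' : ∀ a ∈ J ^ (n + N t), a • (t : S.X₃) = 0 := fun a ha =>
      ht a (Ideal.pow_le_pow_right (by lia) ha)
    rw [hδ n (n + N t) (by lia) t ht ht']
    exact hδ _ _ (by lia) _ _ _
  let Θ : powTorsion J S.X₃ →ₗ[A] (localCohomology J 1).obj S.X₁ :=
    { toFun := θ
      map_add' := fun x y => by
        have hx : ∀ a ∈ J ^ (N x + N y), a • (x : S.X₃) = 0 := fun a ha =>
          hN x a (Ideal.pow_le_pow_right (by lia) ha)
        have hy : ∀ a ∈ J ^ (N x + N y), a • (y : S.X₃) = 0 := fun a ha =>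
          hN y a (Ideal.pow_le_pow_right (by lia) ha)
        have hxy : ∀ a ∈ J ^ (N x + N y), a • ((x + y : powTorsion J S.X₃) : S.X₃) = 0 :=
          fun a ha => by rw [Submodule.coe_add, smul_add, hx a ha, hy a ha, add_zero]
        rw [hθ x _ hx, hθ y _ hy, hθ _ _ hxy, ← map_add]
        simp only [δ]
        rw [← Ext.add_comp, ← Ext.mk₀_add]
        congr 3
        refine hom_quot_ext ((homOfTorsion_one _ _ hxy).trans ?_)
        change _ = homOfTorsion J _ _ hx (Ideal.Quotient.mk _ 1) +
          homOfTorsion J _ _ hy (Ideal.Quotient.mk _ 1)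
        rw [homOfTorsion_one, homOfTorsion_one]
        rfl
      map_smul' := fun b x => by
        have hbx : ∀ a ∈ J ^ N x, a • ((b • x : powTorsion J S.X₃) : S.X₃) = 0 := fun a ha => by
          rw [Submodule.coe_smul, smul_comm, hN x a ha, smul_zero]
        rw [hθ _ _ hbx, RingHom.id_apply, ← map_smul]
        simp only [δ]
        rw [← Ext.smul_comp, ← Ext.mk₀_smul]
        congr 3
        refine hom_quot_ext ((homOfTorsion_one _ _ hbx).trans ?_)
        change _ = b • homOfTorsion J _ _ (hN x) (Ideal.Quotient.mk _ 1)
        rw [homOfTorsion_one]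
        rfl }
  refine ⟨LinearEquiv.ofBijective Θ ⟨?_, ?_⟩⟩
  · rw [injective_iff_map_eq_zero]
    intro t ht
    obtain ⟨m, hm, he⟩ := (h0 _ _).1 ht
    simp only [δ] at he
    rw [restrict_comp] at he
    obtain ⟨g, hg⟩ := Ext.covariant_sequence_exact₃ _ hS _ rfl he
    rw [ext_eq_zero_of_bijective g (r ^ m) (quotPow_smul_eq_zero m (Ideal.pow_mem_pow hrJ m))
      (bijective_pow_smul hr m), Ext.zero_comp, Ext.mk₀_comp_mk₀, eq_comm, Ext.mk₀_eq_zero_iff] at hg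
    have := congrArg (fun f => ModuleCat.Hom.hom f (Ideal.Quotient.mk _ 1)) hg
    exact Subtype.ext ((homOfTorsion_one (J := J) _ _ (hN t)).symm.trans this)
  · intro y
    obtain ⟨n, e, rfl⟩ := hι y
    obtain ⟨x, rfl⟩ := Ext.covariant_sequence_exact₁ _ hS e
      (ext_eq_zero_of_bijective _ (r ^ n) (quotPow_smul_eq_zero n (Ideal.pow_mem_pow hrJ n))
      (bijective_pow_smul hr n)) rfl
    obtain ⟨f, rfl⟩ := (Ext.mk₀_bijective _ _).2 x
    have ht : ∀ a ∈ J ^ n, a • f (Ideal.Quotient.mk _ 1) = 0 := fun a ha => by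
      rw [← map_smul, quotPow_smul_eq_zero n ha, map_zero]
    refine ⟨⟨f (Ideal.Quotient.mk _ 1), n, ht⟩, ?_⟩
    refine (hθ _ n ht).trans ?_
    simp only [δ]
    congr 3
    exact hom_quot_ext (homOfTorsion_one _ _ ht)

include hrJ hr hS in
theorem vanishes_one_of_powTorsion_eq_bot (h : powTorsion J S.X₃ = ⊥) : Vanishes J 1 S.X₁ := by
  obtain ⟨e⟩ := exists_linearEquiv_powTorsion hS hrJ hr
  have : Subsingleton (powTorsion J S.X₃) := by rw [h]; infer_instance
  have : Subsingleton ((localCohomology J (0 + 1)).obj S.X₁) := e.symm.toEquiv.subsingleton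
  exact vanishes_of_subsingleton (i := 0)

lemma vanishes_zero_of_powTorsion_eq_bot {M : ModuleCat.{u} A} (h : powTorsion J M = ⊥) :
    Vanishes J 0 M := by
  intro n e
  obtain ⟨f, rfl⟩ := (Ext.mk₀_bijective _ _).2 e
  have hf : f = 0 := hom_quot_ext (by
    have : f (Ideal.Quotient.mk _ 1) ∈ powTorsion J M := ⟨n, fun a ha => by
      rw [← map_smul, quotPow_smul_eq_zero n ha, map_zero]⟩
    rw [h] at this
    exact this)
  exact ⟨n, le_rfl, by rw [hf, Ext.mk₀_zero, Ext.comp_zero]⟩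

end localCohomology

/-! ### Depth through Ext, regular sequences and associated primes. -/

namespace IsLocalRing

open Abelian RingTheory.Sequence Pointwise

variable {A : Type u} [CommRing A] [IsLocalRing A]

/-- The homological form of `t ≤ depth M`: the modules `Ext^i(k, M)` vanish for `i < t`, where `k`
is the residue field. -/
def DepthGE (t : ℕ) (M : ModuleCat.{u} A) : Prop :=
  ∀ i < t, Subsingleton (Abelian.Ext.{u} (ModuleCat.of A (A ⧸ maximalIdeal A)) M i)

lemma DepthGE.quotSMulTop {t : ℕ} {M : ModuleCat.{u} A} (h : DepthGE (t + 1) M) {x : A}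
    (hx : IsSMulRegular M x) : DepthGE t (ModuleCat.of A (QuotSMulTop x M)) := by
  intro i hi
  refine subsingleton_of_forall_eq 0 fun e => ?_
  have : Subsingleton (Abelian.Ext.{u} _ (M.smulShortComplex x).X₁ (i + 1)) := h (i + 1) (by lia)
  have : Subsingleton (Abelian.Ext.{u} _ (M.smulShortComplex x).X₂ i) := h i (by lia)
  obtain ⟨e', rfl⟩ := Ext.covariant_sequence_exact₃ _ hx.smulShortComplex_shortExact e rfl
    (Subsingleton.elim _ _)
  rw [Subsingleton.elim e' 0]
  exact Ext.zero_comp (C := ModuleCat.{u} A) _ _ _ _ _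

lemma DepthGE.exists_isSMulRegular [IsNoetherianRing A] {t : ℕ} {M : ModuleCat.{u} A}
    [Module.Finite A M] (h : DepthGE (t + 1) M) : ∃ x ∈ maximalIdeal A, IsSMulRegular M x := by
  have := h 0 (by lia)
  have : Subsingleton (ModuleCat.of A (A ⧸ maximalIdeal A) ⟶ M) :=
    Ext.addEquiv₀.symm.toEquiv.subsingleton
  have : Subsingleton ((A ⧸ maximalIdeal A) →ₗ[A] M) :=
    (ModuleCat.homAddEquiv (M := ModuleCat.of A (A ⧸ maximalIdeal A))).symm.subsingleton
  obtain ⟨x, hx, hxr⟩ := IsSMulRegular.subsingleton_linearMap_iff.1 this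
  exact ⟨x, by rwa [Ideal.annihilator_quotient] at hx, hxr⟩

lemma maximalIdeal_smul_top_lt (M : Type*) [AddCommGroup M] [Module A M] [Module.Finite A M]
    [Nontrivial M] : maximalIdeal A • (⊤ : Submodule A M) < ⊤ :=
  (Submodule.top_ne_ideal_smul_of_le_jacobson_annihilator
    (maximalIdeal_le_jacobson _)).symm.lt_top

lemma depthGE_of_isWeaklyRegular [IsNoetherianRing A] {M : ModuleCat.{u} A} [Module.Finite A M]
    {rs : List A} (hm : ∀ r ∈ rs, r ∈ maximalIdeal A) (hr : IsWeaklyRegular M rs) :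
    DepthGE rs.length M := by
  intro i hi
  rcases subsingleton_or_nontrivial M with h | h
  · refine subsingleton_of_forall_eq 0 fun e => ?_
    rw [← Ext.comp_mk₀_id e, show 𝟙 M = 0 from by ext x; exact Subsingleton.elim _ _,
      Ext.mk₀_zero, Ext.comp_zero]
  · refine ModuleCat.subsingleton_ext_of_exists_isRegular (maximalIdeal A) _ ?_ M
      (maximalIdeal_smul_top_lt M) rs hm (.of_isWeaklyRegular_of_mem_maximalIdeal M hm hr) i hi
    change Module.support A (A ⧸ maximalIdeal A) ⊆ _
    rw [Module.support_eq_zeroLocus, Ideal.annihilator_quotient]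

lemma DepthGE.exists_isRegular [IsNoetherianRing A] {t : ℕ} {M : ModuleCat.{u} A}
    [Module.Finite A M] [Nontrivial M] (h : DepthGE t M) :
    ∃ rs : List A, rs.length = t ∧ (∀ r ∈ rs, r ∈ maximalIdeal A) ∧ IsRegular M rs := by
  refine ModuleCat.exists_isRegular_of_exists_subsingleton_ext (maximalIdeal A) t M
    (maximalIdeal_smul_top_lt M) (ModuleCat.of A (A ⧸ maximalIdeal A)) ?_ h
  change Module.support A (A ⧸ maximalIdeal A) = _
  rw [Module.support_eq_zeroLocus, Ideal.annihilator_quotient]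

lemma DepthGE.le_localDepth [IsNoetherianRing A] {t : ℕ} {M : ModuleCat.{u} A}
    [Module.Finite A M] [Nontrivial M] (h : DepthGE t M) : (t : ℕ∞) ≤ localDepth A M := by
  obtain ⟨rs, rfl, hm, hr⟩ := h.exists_isRegular
  exact le_iSup (fun rs : {rs : List A // (∀ r ∈ rs, r ∈ maximalIdeal A) ∧ IsRegular M rs} =>
    (rs.1.length : ℕ∞)) ⟨rs, hm, hr⟩

lemma exists_isRegular_of_le_localDepth {R : Type*} [CommRing R] [IsLocalRing R] {M : Type*}
    [AddCommGroup M] [Module R M] {t : ℕ} (h : ((t + 1 : ℕ) : ℕ∞) ≤ localDepth R M) :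
    ∃ rs : List R, t + 1 ≤ rs.length ∧ (∀ r ∈ rs, r ∈ maximalIdeal R) ∧ IsRegular M rs := by
  have : (t : ℕ∞) < localDepth R M := lt_of_lt_of_le (by exact_mod_cast Nat.lt_succ_self t) h
  obtain ⟨⟨rs, hm, hr⟩, h⟩ := lt_iSup_iff.1 this
  exact ⟨rs, by exact_mod_cast h, hm, hr⟩

/-- Let `N` be the submodule killed by `p`. By Nakayama some `z` in `N` is outside `xN`, and it
survives in `M / xM` because regularity of `x` gives `N ∩ xM = xN`. An associated prime above the
annihilator of its image contains `p` and `x`, while `x ∉ p`. -/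
lemma exists_lt_associatedPrimes_quotSMulTop [IsNoetherianRing A] {M : Type*} [AddCommGroup M]
    [Module A M] [Module.Finite A M] {x : A} (hxm : x ∈ maximalIdeal A) (hx : IsSMulRegular M x)
    {p : Ideal A} (hp : p ∈ associatedPrimes A M) :
    ∃ q ∈ associatedPrimes A (QuotSMulTop x M), p < q := by
  let N : Submodule A M := Submodule.torsionBySet A M p
  have hN : Nontrivial N := by
    obtain ⟨hpp, z, hz⟩ := isAssociatedPrime_iff.1 (AssociatedPrimes.mem_iff.1 hp)
    refine ⟨⟨⟨z, ?_⟩, 0, ?_⟩⟩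
    · rw [Submodule.mem_torsionBySet_iff]
      rintro ⟨a, ha⟩
      rw [hz] at ha
      exact Submodule.mem_colon_singleton.1 ha
    · intro h
      have hz0 : z = 0 := congrArg Subtype.val h
      rw [hz0] at hz
      exact hpp.ne_top (by rw [hz]; simp [Ideal.eq_top_iff_one])
  obtain ⟨z, hz⟩ : ∃ z : N, z ∉ x • (⊤ : Submodule A N) := by
    by_contra! h
    exact Submodule.top_ne_pointwise_smul_of_mem_jacobson_annihilator
      (maximalIdeal_le_jacobson _ hxm) (eq_top_iff.2 fun z _ => h z).symm
  have hz' : (z : M) ∉ x • (⊤ : Submodule A M) := by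
    intro h
    obtain ⟨w, -, hw⟩ := (Submodule.mem_smul_pointwise_iff_exists _ _ _).1 h
    refine hz ((Submodule.mem_smul_pointwise_iff_exists _ _ _).2 ⟨⟨w, ?_⟩, trivial, Subtype.ext hw⟩)
    rw [Submodule.mem_torsionBySet_iff]
    rintro ⟨a, ha⟩
    refine hx ?_
    change x • a • w = x • 0
    rw [smul_comm, hw, smul_zero]
    exact (Submodule.mem_torsionBySet_iff _ _).1 z.2 ⟨a, ha⟩
  obtain ⟨q, hq, hzq⟩ := exists_le_isAssociatedPrime_of_isNoetherianRing A
    (Submodule.Quotient.mk (z : M) : QuotSMulTop x M)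
    (by rwa [Ne, Submodule.Quotient.mk_eq_zero])
  have hxq : x ∈ q := hzq (by
    rw [Submodule.mem_colon_singleton, Submodule.mem_bot, ← Submodule.Quotient.mk_smul,
      Submodule.Quotient.mk_eq_zero]
    exact Submodule.smul_mem_pointwise_smul _ _ _ trivial)
  have hpq : p ≤ q := fun a ha => hzq (by
    rw [Submodule.mem_colon_singleton, Submodule.mem_bot, ← Submodule.Quotient.mk_smul,
      (Submodule.mem_torsionBySet_iff _ _).1 z.2 ⟨a, ha⟩, Submodule.Quotient.mk_zero])
  refine ⟨q, hq, lt_of_le_of_ne hpq ?_⟩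
  rintro rfl
  have : x ∈ ⋃ p ∈ associatedPrimes A M, (p : Set A) := Set.mem_biUnion hp hxq
  rw [biUnion_associatedPrimes_eq_compl_regular] at this
  exact this hx

/-- The classical bound of depth by dim A/p: each regular element lengthens a chain of primes above
`p` by one. -/
lemma DepthGE.le_coheight [IsNoetherianRing A] {t : ℕ} {M : ModuleCat.{u} A}
    [Module.Finite A M] (h : DepthGE t M) (p : PrimeSpectrum A)
    (hp : p.asIdeal ∈ associatedPrimes A M) : (t : ℕ∞) ≤ Order.coheight p := by
  induction t generalizing M p with
  | zero => simp
  | succ t ih =>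
    obtain ⟨x, hxm, hx⟩ := h.exists_isSMulRegular
    obtain ⟨q, hq, hpq⟩ := exists_lt_associatedPrimes_quotSMulTop hxm hx hp
    have h1 := ih (M := ModuleCat.of A (QuotSMulTop x M)) (h.quotSMulTop hx) ⟨q, hq.isPrime⟩ hq
    have h2 : Order.coheight (⟨q, hq.isPrime⟩ : PrimeSpectrum A) + 1 ≤ Order.coheight p :=
      Order.coheight_add_one_le hpq
    push_cast
    exact (by gcongr : (t : ℕ∞) + 1 ≤ _).trans h2

-- Vanishing in degree 0 gives Hom(A/m, M) = 0, hence an `M`-regular `x` in m; the long exact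
-- sequence then leaves a range shorter by one for `M / xM`.
open localCohomology in
lemma exists_isWeaklyRegular_of_vanishes [IsNoetherianRing A] {t : ℕ} {M : ModuleCat.{u} A}
    [Module.Finite A M] (h : ∀ i < t, Vanishes (maximalIdeal A) i M) :
    ∃ rs : List A, rs.length = t ∧ (∀ r ∈ rs, r ∈ maximalIdeal A) ∧ IsWeaklyRegular M rs := by
  induction t generalizing M with
  | zero => exact ⟨[], rfl, by simp, .nil _ _⟩
  | succ t ih =>
    have h0 : Subsingleton ((A ⧸ maximalIdeal A ^ 1) →ₗ[A] M) := by
      refine subsingleton_of_forall_eq 0 fun f => ?_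
      obtain ⟨m, hm, he⟩ := h 0 (by lia) 1 (Ext.mk₀ (ModuleCat.ofHom f))
      rw [Ext.mk₀_comp_mk₀, Ext.mk₀_eq_zero_iff] at he
      ext
      exact congrArg (fun f => ModuleCat.Hom.hom f (Ideal.Quotient.mk _ 1)) he
    obtain ⟨x, hxm, hx⟩ := IsSMulRegular.subsingleton_linearMap_iff.1 h0
    rw [Ideal.annihilator_quotient, pow_one] at hxm
    obtain ⟨rs, rfl, hm, hr⟩ := ih (M := ModuleCat.of A (QuotSMulTop x M)) fun i hi =>
      Vanishes.right hx.smulShortComplex_shortExact (h i (by lia)) (h (i + 1) (by lia))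
    exact ⟨x :: rs, rfl, by simpa only [List.mem_cons, forall_eq_or_imp] using ⟨hxm, hm⟩, .cons hx hr⟩

end IsLocalRing

/-! ### Avoidance over an infinite residue field, and superficial elements. -/

namespace IsLocalRing

/-- Over a local ring with infinite residue field, finitely many proper submodules do not cover a
module. -/
theorem exists_forall_notMem_of_ne_top {A E : Type*} [CommRing A] [IsLocalRing A]
    [Infinite (A ⧸ maximalIdeal A)] [AddCommGroup E] [Module A E] (s : Finset (Submodule A E))
    (hs : ∀ p ∈ s, p ≠ ⊤) : ∃ x : E, ∀ p ∈ s, x ∉ p := by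
  by_contra! h
  have hcov : ⋃ p ∈ s, ((id p : Submodule A E) : Set E) = Set.univ :=
    Set.eq_univ_of_forall fun x => by simpa using h x
  -- Neumann's lemma: some member of a finite cover has finite index. A nonzero cyclic submodule of
  -- the finite quotient then maps onto the residue field, which would be finite.
  obtain ⟨p, hp, hfi⟩ := Submodule.exists_finiteIndex_of_cover hcov
  have : p.toAddSubgroup.FiniteIndex := hfi
  have : Finite (E ⧸ p) := AddSubgroup.finite_quotient_of_finiteIndex
  have : Nontrivial (E ⧸ p) := Submodule.Quotient.nontrivial_iff.mpr (hs p hp)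
  obtain ⟨v, hv⟩ := exists_ne (0 : E ⧸ p)
  let g := LinearMap.toSpanSingleton A (E ⧸ p) v
  have hker : LinearMap.ker g ≤ maximalIdeal A := le_maximalIdeal fun h => hv (by
    have : (1 : A) ∈ LinearMap.ker g := h ▸ trivial
    simpa [g] using this)
  have : Finite (A ⧸ LinearMap.ker g) :=
    Finite.of_injective _ (LinearMap.ker_eq_bot.1 (Submodule.ker_liftQ_eq_bot _ g le_rfl le_rfl))
  have := Finite.of_surjective _ (Ideal.Quotient.factor_surjective hker)
  exact not_finite (A ⧸ maximalIdeal A)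

end IsLocalRing

/-- If every associated prime of `(F + F₁) / F₁` containing `y` contains `I`, then a power of `I`
kills the kernel of the multiplication by `y` on it. -/
lemma Submodule.exists_pow_smul_mem_of_associatedPrimes {R N : Type*} [CommRing R]
    [IsNoetherianRing R] [AddCommGroup N] [Module R N] (F F₁ : Submodule R N) (hF : F.FG) (y : R)
    (I : Ideal R) (h : ∀ P ∈ associatedPrimes R (F.map F₁.mkQ), y ∈ P → I ≤ P) :
    ∃ s : ℕ, ∀ r ∈ I ^ s, ∀ g ∈ F, y • g ∈ F₁ → r • g ∈ F₁ := by
  let G := F.map F₁.mkQ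
  let K : Submodule R (N ⧸ F₁) := G ⊓ Submodule.torsionBy R _ y
  have hG : IsNoetherian R G := isNoetherian_of_fg_of_noetherian _ (hF.map _)
  have hK : IsNoetherian R K := isNoetherian_of_le (inf_le_left : K ≤ G)
  obtain ⟨s, hs⟩ : ∃ s, I ^ s ≤ Module.annihilator R K := by
    apply Ideal.exists_pow_le_of_le_radical_of_fg _ (IsNoetherian.noetherian _)
    rw [← Ideal.sInf_minimalPrimes]
    -- A minimal prime over the annihilator of `K` is associated to `K`, hence to `G`, and it
    -- contains `y` because `y` kills `K`.
    refine le_sInf fun P hP => ?_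
    have hPK := Module.associatedPrimes.minimalPrimes_annihilator_subset_associatedPrimes R K hP
    refine h P (associatedPrimes.subset_of_injective
      (Submodule.inclusion_injective (inf_le_left : K ≤ G)) hPK) (hP.1.2 ?_)
    rw [Module.mem_annihilator]
    exact fun k => Subtype.ext ((Submodule.mem_torsionBy_iff _ _).1 k.2.2)
  refine ⟨s, fun r hr g hg hy => ?_⟩
  have hw : F₁.mkQ g ∈ K := by
    refine ⟨⟨g, hg, rfl⟩, (Submodule.mem_torsionBy_iff _ _).2 ?_⟩
    rw [← map_smul]
    exact (Submodule.Quotient.mk_eq_zero _).2 hy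
  have h1 := congrArg Subtype.val (Module.mem_annihilator.1 (hs hr) ⟨_, hw⟩)
  exact (Submodule.Quotient.mk_eq_zero _).1 h1

namespace Ideal

open IsLocalRing Polynomial

variable {A : Type*} [CommRing A] (c : Ideal A) (M : Type*) [AddCommGroup M] [Module A M]

/-- The degree one part of the Rees algebra. -/
def reesAlgebraOne : c →ₗ[A] reesAlgebra c where
  toFun a := ⟨monomial 1 (a : A), reesAlgebra.monomial_mem.2 (by simp)⟩
  map_add' a b := Subtype.ext (by simp)
  map_smul' r a := Subtype.ext (by simp [smul_monomial])

lemma monomial_mem_pow_span_range (n : ℕ) {a : A} (ha : a ∈ c ^ n) :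
    (⟨monomial n a, reesAlgebra.monomial_mem.2 ha⟩ : reesAlgebra c) ∈
      span (Set.range (reesAlgebraOne c)) ^ n := by
  induction n generalizing a with
  | zero => simp
  | succ n ih =>
    have key : ∀ a ∈ c ^ n * c, ∃ h : monomial (n + 1) a ∈ reesAlgebra c,
        (⟨monomial (n + 1) a, h⟩ : reesAlgebra c) ∈ span (Set.range (reesAlgebraOne c)) ^ (n + 1) := by
      intro a ha
      induction ha using Submodule.mul_induction_on' with
      | mem_mul_mem x hx y hy =>
        have hm : monomial (n + 1) (x * y) ∈ reesAlgebra c :=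
          reesAlgebra.monomial_mem.2 (by rw [pow_succ]; exact mul_mem_mul hx hy)
        refine ⟨hm, ?_⟩
        have : (⟨monomial (n + 1) (x * y), hm⟩ : reesAlgebra c) =
            ⟨monomial n x, reesAlgebra.monomial_mem.2 hx⟩ * reesAlgebraOne c ⟨y, hy⟩ :=
          Subtype.ext (monomial_mul_monomial _ _ _ _).symm
        rw [this, pow_succ]
        exact mul_mem_mul (ih hx) (subset_span ⟨_, rfl⟩)
      | add x _ y _ hx hy =>
        obtain ⟨hx, hx'⟩ := hx
        obtain ⟨hy, hy'⟩ := hy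
        have hm : monomial (n + 1) (x + y) ∈ reesAlgebra c := by
          rw [map_add]; exact add_mem hx hy
        refine ⟨hm, ?_⟩
        convert add_mem hx' hy' using 1
        exact Subtype.ext (map_add _ _ _)
    exact (key a (by rwa [pow_succ] at ha)).2

/-- The filtration `c ^ (n + 1) M`. -/
def shiftFiltration : c.Filtration M where
  N n := c ^ (n + 1) • ⊤
  mono n := Submodule.smul_mono_left (pow_le_pow_right (by lia))
  smul_le n := by rw [smul_smul, ← pow_succ']

/-- The filtration of the elements of `c ^ n M` that `x` multiplies into `c ^ (n + 2) M`. -/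
def superficialFiltration (x : A) : c.Filtration M where
  N n := c ^ n • ⊤ ⊓ (c ^ (n + 2) • (⊤ : Submodule A M)).comap (LinearMap.lsmul A M x)
  mono n := inf_le_inf (Submodule.smul_mono_left (pow_le_pow_right (by lia)))
    (Submodule.comap_mono (Submodule.smul_mono_left (pow_le_pow_right (by lia))))
  smul_le n := by
    rw [Submodule.smul_le]
    rintro r hr z ⟨hz, hxz⟩
    refine ⟨?_, ?_⟩
    · rw [pow_succ', mul_smul]
      exact Submodule.smul_mem_smul hr hz
    · change x • r • z ∈ c ^ (n + 1 + 2) • (⊤ : Submodule A M)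
      rw [smul_comm, show n + 1 + 2 = (n + 2) + 1 by lia, pow_succ', mul_smul]
      exact Submodule.smul_mem_smul hr hxz

variable {M}

/-- Over the Rees algebra consider ⊕ c^n M / c^(n+1) M. The hypothesis says that every associated
prime containing `x` in degree one contains all of degree one, so the kernel of `x` is killed by a
power of the irrelevant ideal. Stability of `superficialFiltration`, a subfiltration of a stable
one, makes this kernel vanish in large degrees. -/
lemma exists_superficialFiltration_le [IsNoetherianRing A] [Module.Finite A M]
    (x : c) (hx : ∀ P ∈ associatedPrimes (reesAlgebra c) 
      ((c.stableFiltration ⊤).submodule.map (c.shiftFiltration M).submodule.mkQ),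
      reesAlgebraOne c x ∈ P → ∀ y, reesAlgebraOne c y ∈ P) :
    ∃ n₀, ∀ n ≥ n₀, (c.superficialFiltration M (x : A)).N n ≤ c ^ (n + 1) • ⊤ := by
  set F := c.stableFiltration (⊤ : Submodule A M)
  set F' := c.superficialFiltration M (x : A)
  set F₁ := c.shiftFiltration M
  have hfg : F.submodule.FG := (Filtration.submodule_fg_iff_stable F
    fun i => IsNoetherian.noetherian _).2 (stableFiltration_stable _ _)
  have hst : F'.Stable := (stableFiltration_stable c ⊤).of_le (fun n => inf_le_left)
  obtain ⟨n₁, hn₁⟩ := hst.exists_pow_smul_eq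
  obtain ⟨s, hs⟩ := F.submodule.exists_pow_smul_mem_of_associatedPrimes F₁.submodule hfg
    (reesAlgebraOne c x) (span (Set.range (reesAlgebraOne c))) fun P hP hxP => by
      rw [span_le]
      rintro _ ⟨y, rfl⟩
      exact hx P hP hxP y
  have hle : c ^ s • F'.N n₁ ≤ c ^ (n₁ + s + 1) • ⊤ := by
    rw [Submodule.smul_le]
    rintro a ha z ⟨hz, hxz⟩
    have h2 : (monomial s a • PolynomialModule.single A n₁ z).coeff (s + n₁) ∈ F₁.N (s + n₁) := by
      refine hs _ (monomial_mem_pow_span_range c s ha) (PolynomialModule.single A n₁ z)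
        (fun i => ?_) (fun i => ?_) (s + n₁)
      · rw [PolynomialModule.coeff_single, Finsupp.single_apply]
        split_ifs with h
        · exact h ▸ hz
        · exact zero_mem _
      · change (monomial 1 (x : A) • PolynomialModule.single A n₁ z).coeff i ∈ F₁.N i
        rw [PolynomialModule.monomial_smul_single, PolynomialModule.coeff_single,
          Finsupp.single_apply]
        split_ifs with h
        · subst h
          rw [show F₁.N (1 + n₁) = c ^ (n₁ + 2) • ⊤ by rw [add_comm]; rfl]
          exact hxz
        · exact zero_mem _
    rw [PolynomialModule.monomial_smul_single, PolynomialModule.coeff_single,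
      Finsupp.single_eq_same, add_comm s] at h2
    exact h2
  refine ⟨n₁ + s, fun n hn => ?_⟩
  obtain ⟨k, rfl⟩ := Nat.exists_eq_add_of_le hn
  rw [show n₁ + s + k = n₁ + (k + s) by lia, hn₁, pow_add, mul_smul]
  refine (Submodule.smul_mono le_rfl hle).trans ?_
  rw [smul_smul, ← pow_add]
  exact Submodule.smul_mono_left (pow_le_pow_right (by lia))

theorem exists_superficial [IsNoetherianRing A] [IsLocalRing A] [Infinite (A ⧸ maximalIdeal A)]
    [Module.Finite A M] (hc : ∀ p ∈ associatedPrimes A M, ¬ c ≤ p) :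
    ∃ x ∈ c, IsSMulRegular M x ∧ ∃ n₀, ∀ n ≥ n₀, ∀ z : M,
      x • z ∈ c ^ (n + 1) • (⊤ : Submodule A M) → z ∈ c ^ n • (⊤ : Submodule A M) := by
  classical
  have hfg : (c.stableFiltration (⊤ : Submodule A M)).submodule.FG :=
    (Filtration.submodule_fg_iff_stable _
      fun i => IsNoetherian.noetherian _).2 (stableFiltration_stable _ _)
  have : IsNoetherian (reesAlgebra c)
      ((c.stableFiltration ⊤).submodule.map (c.shiftFiltration M).submodule.mkQ) :=
    isNoetherian_of_fg_of_noetherian _ (hfg.map _)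
  have hfin := associatedPrimes.finite (reesAlgebra c) 
      ((c.stableFiltration ⊤).submodule.map (c.shiftFiltration M).submodule.mkQ)
  have hfin' := associatedPrimes.finite A M
  let V : Ideal (reesAlgebra c) → Submodule A c := fun P =>
    (Submodule.restrictScalars A P).comap (reesAlgebraOne c)
  -- The first family makes `x` superficial and the second makes it regular. Primes containing the
  -- whole degree one part impose nothing and are filtered out.
  obtain ⟨x, hx⟩ := exists_forall_notMem_of_ne_top
    ((hfin.toFinset.image V).filter (· ≠ ⊤) ∪
      hfin'.toFinset.image fun p => Submodule.comap c.subtype p) (by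
    intro p hp
    rcases Finset.mem_union.1 hp with hp | hp
    · exact (Finset.mem_filter.1 hp).2
    · obtain ⟨q, hq, rfl⟩ := Finset.mem_image.1 hp
      intro h
      refine hc q (hfin'.mem_toFinset.1 hq) fun y hy => ?_
      have : (⟨y, hy⟩ : c) ∈ Submodule.comap c.subtype q := h ▸ trivial
      exact this)
  have hreg : IsSMulRegular M (x : A) := by
    by_contra h
    have h' : (x : A) ∈ ⋃ p ∈ associatedPrimes A M, (p : Set A) := by
      rw [biUnion_associatedPrimes_eq_compl_regular]; exact h
    simp only [Set.mem_iUnion] at h'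
    obtain ⟨p, hp, hxp⟩ := h'
    exact hx _ (Finset.mem_union_right _ (Finset.mem_image_of_mem _ (hfin'.mem_toFinset.2 hp))) hxp
  refine ⟨x, x.2, hreg, ?_⟩
  obtain ⟨n₂, hn₂⟩ := c.exists_superficialFiltration_le (M := M) x (by
    intro P hP hxP y
    have : V P = ⊤ := by
      by_contra h
      exact hx _ (Finset.mem_union_left _ (Finset.mem_filter.2
        ⟨Finset.mem_image_of_mem _ (hfin.mem_toFinset.2 hP), h⟩)) hxP
    have hy : y ∈ V P := this ▸ trivial
    exact hy)
  -- Artin-Rees for `xM`, after cancelling `x`, places `z` in `c ^ (n + 1 - k) M`, inside `c ^ n₂ M`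
  -- since `n ≥ n₂ + k`.
  obtain ⟨k, hk⟩ := c.exists_pow_inf_eq_pow_smul (LinearMap.range (LinearMap.lsmul A M (x : A)))
  refine ⟨n₂ + k, fun n hn z hz => ?_⟩
  have h1 : z ∈ c ^ (n + 1 - k) • (⊤ : Submodule A M) := by
    have h2 : (x : A) • z ∈ c ^ (n + 1) • ⊤ ⊓ LinearMap.range (LinearMap.lsmul A M (x : A)) :=
      ⟨hz, z, rfl⟩
    rw [hk _ (by lia)] at h2
    have h3 : (x : A) • z ∈ c ^ (n + 1 - k) • LinearMap.range (LinearMap.lsmul A M (x : A)) :=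
      Submodule.smul_mono le_rfl inf_le_right h2
    rw [← Submodule.map_top, ← Submodule.map_smul''] at h3
    obtain ⟨w, hw, hwz⟩ := h3
    rwa [← hreg hwz]
  -- From there the filtration bound raises the exponent one at a time up to `n`.
  have key : ∀ j, n₂ + j ≤ n → z ∈ c ^ (n₂ + j) • (⊤ : Submodule A M) := by
    intro j
    induction j with
    | zero => exact fun _ => Submodule.smul_mono_left (pow_le_pow_right (by lia)) h1
    | succ j ih =>
      intro hj
      exact hn₂ (n₂ + j) (by lia) ⟨ih (by lia),
        Submodule.smul_mono_left (pow_le_pow_right (by lia)) hz⟩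
  have := key (n - n₂) (by lia)
  rwa [show n₂ + (n - n₂) = n by lia] at this

end Ideal

/-! ### Hilbert-Samuel functions and reduction by superficial sequences. -/

namespace IsLocalRing

open RingTheory.Sequence Pointwise Filter

lemma isFiniteLength_of_pow_smul_eq_zero {A : Type*} [CommRing A] [IsLocalRing A]
    [IsNoetherianRing A] {M : Type*} [AddCommGroup M] [Module A M] [Module.Finite A M] {k : ℕ}
    (h : ∀ a ∈ maximalIdeal A ^ k, ∀ x : M, a • x = 0) : IsFiniteLength A M := by
  have hT : Module.IsTorsionBySet A M (maximalIdeal A ^ k : Ideal A) := fun x a => h a a.2 x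
  let _ := hT.module
  have : IsScalarTower A (A ⧸ maximalIdeal A ^ k) M := hT.isScalarTower
  have hart : IsArtinianRing (A ⧸ maximalIdeal A ^ k) := by
    rcases subsingleton_or_nontrivial (A ⧸ maximalIdeal A ^ k) with h | h
    · infer_instance
    have hl : IsLocalRing (A ⧸ maximalIdeal A ^ k) :=
      .of_surjective' (Ideal.Quotient.mk _) Ideal.Quotient.mk_surjective
    rw [isArtinianRing_iff_isNilpotent_maximalIdeal]
    refine ⟨k, ?_⟩
    have hmap : maximalIdeal (A ⧸ maximalIdeal A ^ k) ≤
        (maximalIdeal A).map (Ideal.Quotient.mk (maximalIdeal A ^ k)) := by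
      intro x hx
      obtain ⟨x, rfl⟩ := Ideal.Quotient.mk_surjective x
      exact Ideal.mem_map_of_mem _ fun h => hx (h.map _)
    refine le_bot_iff.1 ((Ideal.pow_right_mono hmap k).trans ?_)
    rw [← Ideal.map_pow, Ideal.map_quotient_self]
  have : Module.Finite (A ⧸ maximalIdeal A ^ k) M := .of_restrictScalars_finite A _ M
  rw [← Module.length_ne_top_iff, Module.length_eq_of_surjective (R := A ⧸ maximalIdeal A ^ k)
    Ideal.Quotient.mk_surjective]
  exact Module.length_ne_top

end IsLocalRing

/-- Discrete differences inherit an asymptotic bound along a subsequence. -/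
lemma frequently_difference_le {d : ℕ} {e : ℝ} {h h' : ℕ → ℝ} {n₀ : ℕ}
    (hh : ∀ n ≥ n₀, h' (n + 1) = h (n + 1) - h n)
    (hb : ∀ ε > 0, ∃ᶠ n : ℕ in atTop, ((d + 1).factorial : ℝ) * h n ≤ (e + ε) * (n : ℝ) ^ (d + 1))
    (he : 0 ≤ e) :
    ∀ ε > 0, ∃ᶠ n : ℕ in atTop, (d.factorial : ℝ) * h' n ≤ (e + ε) * (n : ℝ) ^ d := by
  intro ε hε
  by_contra hcon
  rw [not_frequently] at hcon
  obtain ⟨N, hN⟩ := eventually_atTop.1 hcon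
  push Not at hN
  have hpow : ∀ n : ℕ, ((n + 1 : ℕ) : ℝ) ^ (d + 1) - (n : ℝ) ^ (d + 1) ≤
      (d + 1) * ((n + 1 : ℕ) : ℝ) ^ d := by
    intro n
    have hx : (0 : ℝ) < (n + 1 : ℕ) := by positivity
    have hB := one_add_mul_le_pow (a := -1 / ((n + 1 : ℕ) : ℝ)) (by
      rw [le_div_iff₀ hx]; push_cast; nlinarith [(Nat.cast_nonneg n : (0 : ℝ) ≤ n)]) (d + 1)
    have h1 : 1 + -1 / ((n + 1 : ℕ) : ℝ) = n / ((n + 1 : ℕ) : ℝ) := by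
      field_simp; push_cast; ring
    rw [h1, div_pow, le_div_iff₀ (by positivity)] at hB
    have h2 : (1 + ((d + 1 : ℕ) : ℝ) * (-1 / ((n + 1 : ℕ) : ℝ))) * ((n + 1 : ℕ) : ℝ) ^ (d + 1) =
        ((n + 1 : ℕ) : ℝ) ^ (d + 1) - (d + 1) * ((n + 1 : ℕ) : ℝ) ^ d := by
      rw [pow_succ]; field_simp; push_cast; ring
    linarith
  let N' := max N n₀
  let C : ℝ := ((d + 1).factorial : ℝ) * h N' - (e + ε) * (N' : ℝ) ^ (d + 1)
  -- If the difference eventually exceeds `(e + ε) n ^ d / d!`, summation with the Bernoulli bound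
  -- `hpow` makes `h` grow at rate `e + ε`, against the bound with `ε / 2`. The constant `C` gives
  -- equality at `k = 0`.
  have key : ∀ k : ℕ, (e + ε) * ((N' + k : ℕ) : ℝ) ^ (d + 1) + C ≤
      ((d + 1).factorial : ℝ) * h (N' + k) := by
    intro k
    induction k with
    | zero => simp [C]
    | succ k ih =>
      have h1 := hN (N' + k + 1) (by lia)
      rw [hh (N' + k) (by lia)] at h1
      have h2 := hpow (N' + k)
      have h3 : ((d + 1).factorial : ℝ) = (d + 1) * d.factorial := by
        rw [Nat.factorial_succ]; push_cast; ring
      rw [h3] at ih ⊢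
      have h4 := mul_le_mul_of_nonneg_left h2 (by positivity : 0 ≤ e + ε)
      have h5 := mul_le_mul_of_nonneg_left h1.le (by positivity : (0 : ℝ) ≤ d + 1)
      rw [← add_assoc]
      linarith
  have hlim : Tendsto (fun n : ℕ => ε / 2 * (n : ℝ) ^ (d + 1)) atTop atTop :=
    ((tendsto_pow_atTop (by lia)).comp tendsto_natCast_atTop_atTop).const_mul_atTop (by positivity)
  obtain ⟨n, hn, hn1, hn2⟩ := ((hb (ε / 2) (by positivity)).and_eventually
    ((hlim.eventually_gt_atTop (-C)).and (eventually_ge_atTop N'))).exists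
  obtain ⟨k, rfl⟩ := Nat.exists_eq_add_of_le hn2
  have := key k
  linarith

namespace Ideal

open IsLocalRing RingTheory.Sequence Pointwise Filter

variable {A : Type u} [CommRing A]

/-- The Hilbert-Samuel function of `M` with respect to `c`. -/
def hilbertSamuel (c : Ideal A) (M : Type*) [AddCommGroup M] [Module A M] (n : ℕ) : ℕ :=
  (Module.length A (M ⧸ (c ^ n • ⊤ : Submodule A M))).toNat

lemma length_ne_top [IsLocalRing A] [IsNoetherianRing A] {c : Ideal A} {s : ℕ}
    (hs : maximalIdeal A ^ s ≤ c) (M : Type*) [AddCommGroup M] [Module A M] [Module.Finite A M]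
    (n : ℕ) : Module.length A (M ⧸ (c ^ n • ⊤ : Submodule A M)) ≠ ⊤ := by
  rw [Module.length_ne_top_iff]
  refine isFiniteLength_of_pow_smul_eq_zero (k := s * n) fun a ha x => ?_
  obtain ⟨x, rfl⟩ := Submodule.Quotient.mk_surjective _ x
  rw [← Submodule.Quotient.mk_smul, Submodule.Quotient.mk_eq_zero]
  rw [pow_mul] at ha
  exact Submodule.smul_mem_smul (pow_right_mono hs n ha) trivial

lemma coe_hilbertSamuel [IsLocalRing A] [IsNoetherianRing A] {c : Ideal A} {s : ℕ}
    (hs : maximalIdeal A ^ s ≤ c) (M : Type*) [AddCommGroup M] [Module A M] [Module.Finite A M]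
    (n : ℕ) : (c.hilbertSamuel M n : ℕ∞) = Module.length A (M ⧸ (c ^ n • ⊤ : Submodule A M)) :=
  ENat.natCast_toNat (length_ne_top hs M n)

/-- Multiplication by `x` from `M / c ^ n M` to `M / c ^ (n + 1) M` is injective by `h`, and its
cokernel is the corresponding quotient of `M / xM`. -/
lemma hilbertSamuel_quotSMulTop [IsLocalRing A] [IsNoetherianRing A] {c : Ideal A} {s : ℕ}
    (hs : maximalIdeal A ^ s ≤ c) (M : Type*) [AddCommGroup M] [Module A M] [Module.Finite A M]
    {x : A} (hx : x ∈ c) (n : ℕ)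
    (h : ∀ z : M, x • z ∈ c ^ (n + 1) • (⊤ : Submodule A M) → z ∈ c ^ n • (⊤ : Submodule A M)) :
    c.hilbertSamuel M (n + 1) = c.hilbertSamuel M n + c.hilbertSamuel (QuotSMulTop x M) (n + 1) := by
  let f : (M ⧸ (c ^ n • ⊤ : Submodule A M)) →ₗ[A] (M ⧸ (c ^ (n + 1) • ⊤ : Submodule A M)) :=
    Submodule.mapQ _ _ (LinearMap.lsmul A M x) (by
      rw [Submodule.smul_le]
      intro a ha z _
      change x • a • z ∈ c ^ (n + 1) • (⊤ : Submodule A M)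
      rw [smul_smul, pow_succ']
      exact Submodule.smul_mem_smul (mul_mem_mul hx ha) trivial)
  let g : (M ⧸ (c ^ (n + 1) • ⊤ : Submodule A M)) →ₗ[A]
      (QuotSMulTop x M ⧸ (c ^ (n + 1) • ⊤ : Submodule A (QuotSMulTop x M))) :=
    Submodule.mapQ _ _ (Submodule.mkQ _) (by
      rw [← Submodule.map_le_iff_le_comap, Submodule.map_smul'', Submodule.map_top]
      exact Submodule.smul_mono le_rfl le_top)
  have hf : Function.Injective f := by
    rw [← LinearMap.ker_eq_bot, eq_bot_iff]
    intro z hz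
    obtain ⟨z, rfl⟩ := Submodule.Quotient.mk_surjective _ z
    exact (Submodule.Quotient.mk_eq_zero _).2 (h z ((Submodule.Quotient.mk_eq_zero _).1 hz))
  have hg : Function.Surjective g := fun y => by
    obtain ⟨y, rfl⟩ := Submodule.Quotient.mk_surjective _ y
    obtain ⟨y, rfl⟩ := Submodule.Quotient.mk_surjective _ y
    exact ⟨Submodule.Quotient.mk y, rfl⟩
  have hfg : Function.Exact f g := by
    intro y
    obtain ⟨y, rfl⟩ := Submodule.Quotient.mk_surjective _ y
    constructor
    · intro hy
      have h1 : (Submodule.Quotient.mk y : QuotSMulTop x M) ∈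
          c ^ (n + 1) • (⊤ : Submodule A (QuotSMulTop x M)) :=
        (Submodule.Quotient.mk_eq_zero _).1 hy
      have h2 : (⊤ : Submodule A (QuotSMulTop x M)) =
          (⊤ : Submodule A M).map (x • (⊤ : Submodule A M)).mkQ := by
        rw [Submodule.map_top, Submodule.range_mkQ]
      rw [h2, ← Submodule.map_smul''] at h1
      obtain ⟨w, hw, hwy⟩ := h1
      have h3 : y - w ∈ x • (⊤ : Submodule A M) := (Submodule.Quotient.eq _).1 hwy.symm
      obtain ⟨z, -, hz⟩ := (Submodule.mem_smul_pointwise_iff_exists _ _ _).1 h3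
      refine ⟨Submodule.Quotient.mk z, (Submodule.Quotient.eq _).2 ?_⟩
      change x • z - y ∈ _
      rw [hz, sub_sub_cancel_left]
      exact neg_mem hw
    · rintro ⟨z, hz⟩
      obtain ⟨z, rfl⟩ := Submodule.Quotient.mk_surjective _ z
      rw [← hz]
      change Submodule.Quotient.mk (Submodule.Quotient.mk (x • z)) = _
      have h0 : (Submodule.Quotient.mk (x • z) : QuotSMulTop x M) = 0 :=
        (Submodule.Quotient.mk_eq_zero _).2 (Submodule.smul_mem_pointwise_smul z x ⊤ trivial)
      rw [h0]
      rfl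
  have := Module.length_eq_add_of_exact f g hf hg hfg
  rw [← coe_hilbertSamuel hs, ← coe_hilbertSamuel hs, ← coe_hilbertSamuel hs] at this
  exact_mod_cast this

/-- A module over a local ring whose Hilbert-Samuel function is bounded by `e` has length at
most `e`. -/
lemma length_le_of_hilbertSamuel_le [IsLocalRing A] [IsNoetherianRing A] {c : Ideal A} {s : ℕ}
    (hs : maximalIdeal A ^ s ≤ c) (hc : c ≤ maximalIdeal A) (M : Type*) [AddCommGroup M]
    [Module A M] [Module.Finite A M] {e : ℕ} (he : ∀ n, c.hilbertSamuel M n ≤ e) :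
    Module.length A M ≤ e := by
  have hanti : ∀ n, c ^ (n + 1) • (⊤ : Submodule A M) ≤ c ^ n • ⊤ := fun n =>
    Submodule.smul_mono_left (pow_le_pow_right (by lia))
  -- A strictly decreasing chain would make the Hilbert-Samuel function exceed `e`. Once two terms
  -- agree, Nakayama makes them zero.
  obtain ⟨n, hn⟩ : ∃ n, c ^ (n + 1) • (⊤ : Submodule A M) = c ^ n • ⊤ := by
    by_contra! hne
    have hlt : ∀ n, c.hilbertSamuel M n < c.hilbertSamuel M (n + 1) := by
      intro n
      have h1 : Module.length A (M ⧸ (c ^ n • ⊤ : Submodule A M)) <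
          Module.length A (M ⧸ (c ^ (n + 1) • ⊤ : Submodule A M)) := by
        rw [Module.length_quotient, Module.length_quotient]
        refine Order.coheight_strictAnti (lt_of_le_of_ne (hanti n) (hne n)) ?_
        rw [← Module.length_quotient]
        exact (length_ne_top hs M n).lt_top
      rw [← coe_hilbertSamuel hs, ← coe_hilbertSamuel hs] at h1
      exact_mod_cast h1
    have := (strictMono_nat_of_lt_succ hlt).id_le (e + 1)
    have h2 := he (e + 1)
    simp only [id] at this
    lia
  have h0 : c ^ n • (⊤ : Submodule A M) = ⊥ := by
    refine Submodule.eq_bot_of_le_smul_of_le_jacobson_bot c _ (IsNoetherian.noetherian _) ?_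
      (hc.trans (maximalIdeal_le_jacobson _))
    rw [smul_smul, ← pow_succ', hn]
  have h1 := he n
  rw [← ENat.natCast_le_natCast, coe_hilbertSamuel hs] at h1
  rwa [(Submodule.quotEquivOfEqBot _ h0).length_eq] at h1

/-- A module of depth at least `d` whose multiplicity with respect to `c` is at most `e` has, over
an infinite residue field, a weakly regular sequence of length `d` in `c` that reduces it to a
module of length at most `e`. -/
theorem exists_isWeaklyRegular_length_le [IsLocalRing A] [IsNoetherianRing A]
    [Infinite (A ⧸ maximalIdeal A)] {c : Ideal A} {s : ℕ} (hs : maximalIdeal A ^ s ≤ c)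
    (hc : c ≤ maximalIdeal A) {d e : ℕ} (M : ModuleCat.{u} A) [Module.Finite A M]
    (hM : DepthGE d M)
    (hb : ∀ ε > 0, ∃ᶠ n : ℕ in atTop,
      (d.factorial : ℝ) * (c.hilbertSamuel M n : ℝ) ≤ (e + ε) * (n : ℝ) ^ d) :
    ∃ rs : List A, rs.length = d ∧ (∀ r ∈ rs, r ∈ c) ∧ IsWeaklyRegular M rs ∧
      Module.length A (M ⧸ (ofList rs • ⊤ : Submodule A M)) ≤ e := by
  induction d generalizing M with
  | zero =>
    refine ⟨[], rfl, by simp, .nil _ _, ?_⟩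
    have hmono : Monotone (c.hilbertSamuel M) := monotone_nat_of_le_succ fun n => by
      rw [← ENat.natCast_le_natCast, coe_hilbertSamuel hs, coe_hilbertSamuel hs]
      exact Module.length_le_of_surjective (Submodule.factor (Submodule.smul_mono_left
        (pow_le_pow_right (by lia)))) (Submodule.factor_surjective _)
    have hle : Module.length A M ≤ e := by
      refine length_le_of_hilbertSamuel_le hs hc M fun n => ?_
      -- With `ε = 1 / 2` the integer value at some `m ≥ n` is at most `e`, and monotonicity gives
      -- the same at `n`.
      obtain ⟨m, hm, hnm⟩ := ((hb (1 / 2) (by norm_num)).and_eventually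
        (eventually_ge_atTop n)).exists
      have : (c.hilbertSamuel M m : ℝ) < ((e + 1 : ℕ) : ℝ) := by
        push_cast
        simp at hm
        linarith
      have h2 : c.hilbertSamuel M m < e + 1 := by exact_mod_cast this
      have := hmono hnm
      lia
    refine (Module.length_le_of_surjective (Submodule.mkQ _) (Submodule.mkQ_surjective _)).trans hle
  | succ d ih =>
    obtain ⟨y, hym, hy⟩ := hM.exists_isSMulRegular
    -- No associated prime contains `c`: it would contain the maximal ideal and so the regular
    -- element `y`.
    obtain ⟨x, hxc, hx, n₀, hn₀⟩ := c.exists_superficial (M := M) (by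
      intro p hp hcp
      have hpp := hp.isPrime
      have h1 : maximalIdeal A ≤ p := hpp.le_of_pow_le (hs.trans hcp)
      have : y ∈ ⋃ p ∈ associatedPrimes A M, (p : Set A) := Set.mem_biUnion hp (h1 hym)
      rw [biUnion_associatedPrimes_eq_compl_regular] at this
      exact this hy)
    obtain ⟨rs, rfl, hrc, hr, hl⟩ := ih (ModuleCat.of A (QuotSMulTop x M)) (hM.quotSMulTop hx)
      (frequently_difference_le (n₀ := n₀) (h := fun n => (c.hilbertSamuel M n : ℝ))
        (fun n hn => by
          change (c.hilbertSamuel (QuotSMulTop x M) (n + 1) : ℝ) = _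
          rw [hilbertSamuel_quotSMulTop hs M hxc n (hn₀ n hn)]
          push_cast
          ring) hb (by positivity))
    refine ⟨x :: rs, rfl, by simpa only [List.mem_cons, forall_eq_or_imp] using ⟨hxc, hrc⟩,
      .cons hx hr, ?_⟩
    rwa [(Submodule.quotOfListConsSMulTopEquivQuotSMulTopInner M x rs).length_eq]

end Ideal

/-! ### Duality by length counting over a module with simple socle. -/

section Length

open IsLocalRing

variable {A : Type*} [CommRing A]

lemma Module.length_le_add_of_exact {M N P : Type*} [AddCommGroup M] [AddCommGroup N]
    [AddCommGroup P] [Module A M] [Module A N] [Module A P] (f : M →ₗ[A] N) (g : N →ₗ[A] P)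
    (hf : Function.Injective f) (h : Function.Exact f g) :
    Module.length A N ≤ Module.length A M + Module.length A P := by
  rw [Module.length_eq_add_of_exact f g.rangeRestrict hf g.surjective_rangeRestrict (fun y => by
    rw [← h y, Subtype.ext_iff]; rfl)]
  gcongr
  exact Module.length_le_of_injective (LinearMap.range g).subtype (Submodule.subtype_injective _)

/-- If the socle of `T` has length at most one, then `Hom(-, T)` does not increase the length. -/
lemma Module.length_linearMap_le [IsLocalRing A] {T : Type*} [AddCommGroup T] [Module A T]
    (hT : Module.length A ((A ⧸ maximalIdeal A) →ₗ[A] T) ≤ 1) {N : Type*} [AddCommGroup N]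
    [Module A N] (hN : IsFiniteLength A N) :
    Module.length A (N →ₗ[A] T) ≤ Module.length A N := by
  induction hN with
  | of_subsingleton => simp
  | @of_simple_quotient M _ _ N hs hN ih =>
    have h1 := Module.length_le_add_of_exact (LinearMap.lcomp A T N.mkQ)
      (LinearMap.lcomp A T N.subtype) (fun f g h => by
        ext x
        exact LinearMap.congr_fun h x) (fun f => by
        constructor
        · intro hf
          exact ⟨N.liftQ f fun x hx => LinearMap.congr_fun hf ⟨x, hx⟩, by ext; rfl⟩
        · rintro ⟨g, rfl⟩
          ext x
          change g (N.mkQ x) = 0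
          rw [(Submodule.Quotient.mk_eq_zero N).2 x.2 |> fun h => (h : N.mkQ x = 0), map_zero])
    obtain ⟨I, hI, ⟨e⟩⟩ := isSimpleModule_iff_quot_maximal.1 hs
    rw [eq_maximalIdeal hI] at e
    have h2 : Module.length A ((M ⧸ N) →ₗ[A] T) ≤ 1 := by
      rwa [(e.congrLeft T A).length_eq]
    rw [Module.length_eq_add_of_exact N.subtype N.mkQ N.subtype_injective N.mkQ_surjective
      (LinearMap.exact_subtype_mkQ N), Module.length_eq_one (R := A) (M := M ⧸ N), add_comm]
    exact h1.trans (add_le_add h2 ih)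

/-- A module of finite length with simple socle has the length of the ring modulo its
annihilator. -/
lemma Module.length_eq_length_quotient_annihilator [IsLocalRing A] [IsNoetherianRing A] {T : Type*}
    [AddCommGroup T] [Module A T]
    (hT : Module.length A ((A ⧸ maximalIdeal A) →ₗ[A] T) ≤ 1) (hTf : IsFiniteLength A T) :
    Module.length A T = Module.length A (A ⧸ Module.annihilator A T) := by
  -- `A / ann T` embeds into End(T), and conversely `T` embeds into Hom(A / ann T, T); both Hom
  -- modules are bounded by `Module.length_linearMap_le`.
  have hinj : Function.Injective ((Module.annihilator A T).liftQ (LinearMap.lsmul A T)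
      fun a ha => LinearMap.ext fun t => Module.mem_annihilator.1 ha t) := by
    rw [← LinearMap.ker_eq_bot]
    refine Submodule.ker_liftQ_eq_bot _ _ _ fun a ha => Module.mem_annihilator.2 fun t => ?_
    exact LinearMap.congr_fun (LinearMap.mem_ker.1 ha) t
  have h1 : Module.length A (A ⧸ Module.annihilator A T) ≤ Module.length A T :=
    (Module.length_le_of_injective _ hinj).trans (Module.length_linearMap_le hT hTf)
  have hfin : IsFiniteLength A (A ⧸ Module.annihilator A T) := by
    rw [← Module.length_ne_top_iff] at hTf ⊢
    exact (h1.trans_lt hTf.lt_top).ne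
  refine le_antisymm (le_trans ?_ (Module.length_linearMap_le hT hfin)) h1
  let f : T →ₗ[A] ((A ⧸ Module.annihilator A T) →ₗ[A] T) :=
    { toFun := fun t => (Module.annihilator A T).liftQ (LinearMap.toSpanSingleton A T t)
        fun a ha => Module.mem_annihilator.1 ha t
      map_add' := fun x y => Submodule.linearMap_qext _ (LinearMap.ext_ring (by
        change (1 : A) • (x + y) = (1 : A) • x + (1 : A) • y
        rw [smul_add]))
      map_smul' := fun a x => Submodule.linearMap_qext _ (LinearMap.ext_ring (by
        change (1 : A) • a • x = a • (1 : A) • x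
        rw [smul_comm])) }
  refine Module.length_le_of_injective f fun x y h => ?_
  have : (1 : A) • x = (1 : A) • y :=
    LinearMap.congr_fun h (Submodule.Quotient.mk (1 : A))
  simpa using this

/-- A finite algebra `V` with a nondegenerate trace form into a module with simple socle is
self-injective. -/
theorem Module.baer_of_nondegenerate [IsLocalRing A] {T : Type*} [AddCommGroup T] [Module A T]
    (hT : Module.length A ((A ⧸ maximalIdeal A) →ₗ[A] T) ≤ 1) {V : Type*} [CommRing V]
    [Algebra A V] (hV : IsFiniteLength A V) (π : V →ₗ[A] T)
    (hπ : ∀ v, (∀ w, π (v * w) = 0) → v = 0) : Module.Baer V V := by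
  intro J φ
  have hlen : ∀ N : Submodule A V, Module.length A N ≠ ⊤ := fun N =>
    ((Module.length_le_of_injective N.subtype N.subtype_injective).trans_lt
      (Module.length_ne_top_iff.2 hV).lt_top).ne
  let J' : Submodule A V := J.restrictScalars A
  let K : Submodule A V := (Submodule.annihilator J).restrictScalars A
  -- The form embeds Hom_V(J, V) into Hom_A(J, T) and ann J into Hom_A(V/J, T), so their lengths are
  -- at most ℓ(J) and ℓ(V/J). The map V → Hom_V(J, V) has kernel ann J, hence image of length at
  -- least ℓ(J): it is onto.
  have hJ : Module.length A (J →ₗ[V] V) ≤ Module.length A J' := by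
    refine le_trans ?_ (Module.length_linearMap_le hT (Module.length_ne_top_iff.1 (hlen J')))
    let f : (J →ₗ[V] V) →ₗ[A] (J' →ₗ[A] T) :=
      { toFun := fun g => π ∘ₗ (g.restrictScalars A : J →ₗ[A] V)
        map_add' := fun g h => LinearMap.ext fun x => map_add π _ _
        map_smul' := fun a g => LinearMap.ext fun x => map_smul π _ _ }
    refine Module.length_le_of_injective f ((injective_iff_map_eq_zero f).2 fun g hg => ?_)
    ext x
    refine hπ _ fun w => ?_
    have := LinearMap.congr_fun hg (w • x : J)
    change π (g (w • x)) = 0 at this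
    rwa [map_smul, smul_eq_mul, mul_comm] at this
  have hK : Module.length A K ≤ Module.length A (V ⧸ J') := by
    have hq : IsFiniteLength A (V ⧸ J') := hV.of_surjective J'.mkQ_surjective
    refine le_trans ?_ (Module.length_linearMap_le hT hq)
    let f : K →ₗ[A] ((V ⧸ J') →ₗ[A] T) :=
      { toFun := fun k => J'.liftQ (π ∘ₗ LinearMap.mulLeft A (k : V)) fun x hx => by
          change π ((k : V) * x) = 0
          rw [show (k : V) * x = 0 from Submodule.mem_annihilator.1 k.2 x hx, map_zero]
        map_add' := fun g h => by ext; simp [add_mul]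
        map_smul' := fun a g => by ext; simp }
    refine Module.length_le_of_injective f ((injective_iff_map_eq_zero f).2 fun k hk => ?_)
    exact Subtype.ext (hπ _ fun w => LinearMap.congr_fun hk (Submodule.Quotient.mk w))
  let ρ : V →ₗ[A] (J →ₗ[V] V) :=
    { toFun := fun v => LinearMap.lsmul V V v ∘ₗ J.subtype
      map_add' := fun g h => by ext; simp
      map_smul' := fun a g => by ext; simp }
  have hker : LinearMap.ker ρ = K := by
    ext v
    constructor
    · exact fun h => Submodule.mem_annihilator.2 fun x hx => LinearMap.congr_fun h ⟨x, hx⟩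
    · exact fun h => LinearMap.ext fun x => Submodule.mem_annihilator.1 h x x.2
  have hrange : LinearMap.range ρ = ⊤ := by
    by_contra hne
    have hfl : IsFiniteLength A (J →ₗ[V] V) :=
      Module.length_ne_top_iff.1 (hJ.trans_lt (hlen J').lt_top).ne
    obtain ⟨_, _⟩ := isFiniteLength_iff_isNoetherian_isArtinian.1 hfl
    have h1 := Submodule.length_lt hne
    have h2 : Module.length A V =
        Module.length A (LinearMap.ker ρ) + Module.length A (LinearMap.range ρ) := by
      refine Module.length_eq_add_of_exact (LinearMap.ker ρ).subtype ρ.rangeRestrict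
        (Submodule.subtype_injective _) ρ.surjective_rangeRestrict fun y => ?_
      change (⟨ρ y, _⟩ : LinearMap.range ρ) = 0 ↔ _
      rw [Submodule.mk_eq_zero]
      simp
    have h3 := Module.length_eq_add_of_exact J'.subtype J'.mkQ J'.subtype_injective
      J'.mkQ_surjective (LinearMap.exact_subtype_mkQ J')
    rw [hker] at h2
    have h4 := hlen K
    have h5 : Module.length A (V ⧸ J') ≠ ⊤ := ((Module.length_le_of_surjective J'.mkQ
      J'.mkQ_surjective).trans_lt (Module.length_ne_top_iff.2 hV).lt_top).ne
    have h6 := hlen J'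
    have h7 : Module.length A (LinearMap.range ρ) ≠ ⊤ := h1.ne_top
    have h8 := h1.trans_le hJ
    rw [h2] at h3
    generalize Module.length A K = x1 at *
    generalize Module.length A (V ⧸ J') = x2 at *
    generalize Module.length A J' = x3 at *
    generalize Module.length A (LinearMap.range ρ) = x4 at *
    lift x1 to ℕ using h4
    lift x2 to ℕ using h5
    lift x3 to ℕ using h6
    lift x4 to ℕ using h7
    norm_cast at *
    lia
  obtain ⟨v, rfl⟩ := LinearMap.range_eq_top.1 hrange φ
  exact ⟨LinearMap.lsmul V V v, fun x hx => rfl⟩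

end Length

/-! ### Exactness of matrices with coefficients in varying modules. -/

namespace Matrix

set_option linter.unusedSectionVars false

open RingTheory.Sequence Pointwise TensorProduct

variable {R : Type*} [CommRing R] {k l m n : Type*} [Fintype k] [Fintype l] [Fintype m] [Fintype n]

/-- The action of a matrix on vectors with entries in a module. -/
def act (f : Matrix m n R) (M : Type*) [AddCommGroup M] [Module R M] : (n → M) →ₗ[R] (m → M) where
  toFun v i := ∑ j, f i j • v j
  map_add' v w := by ext i; simp [Finset.sum_add_distrib]
  map_smul' r v := by ext i; simp [Finset.smul_sum, smul_comm r]

variable (M : Type*) [AddCommGroup M] [Module R M]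

lemma act_apply (f : Matrix m n R) (v : n → M) (i : m) : f.act M v i = ∑ j, f i j • v j := rfl

lemma act_act (f : Matrix l m R) (g : Matrix m n R) (v : n → M) :
    f.act M (g.act M v) = (f * g).act M v := by
  ext i
  simp only [act_apply, Finset.smul_sum, mul_apply, Finset.sum_smul, smul_smul]
  exact Finset.sum_comm

lemma act_zero (v : n → M) : (0 : Matrix m n R).act M v = 0 := by
  ext i
  simp [act_apply]

lemma act_map {M N : Type*} [AddCommGroup M] [Module R M] [AddCommGroup N] [Module R N]
    (φ : M →ₗ[R] N) (f : Matrix m n R) (v : n → M) :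
    f.act N (fun j => φ (v j)) = fun i => φ (f.act M v i) := by
  ext i
  simp [act_apply]

/-- Exactness of a pair of composable matrices, acting on vectors with entries in a module. -/
def ExactOn (f : Matrix l m R) (g : Matrix m n R) (M : Type*) [AddCommGroup M] [Module R M] : Prop :=
  ∀ v : m → M, f.act M v = 0 → ∃ w, g.act M w = v

variable {M}

lemma ExactOn.of_linearEquiv {N : Type*} [AddCommGroup N] [Module R N] (e : M ≃ₗ[R] N)
    {f : Matrix l m R} {g : Matrix m n R} (h : f.ExactOn g M) : f.ExactOn g N := by
  intro v hv
  obtain ⟨w, hw⟩ := h (fun i => e.symm (v i)) (by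
    refine (act_map e.symm.toLinearMap f v).trans ?_
    rw [hv]
    ext i
    exact map_zero e.symm)
  refine ⟨fun j => e (w j), ?_⟩
  refine (act_map e.toLinearMap g w).trans ?_
  rw [hw]
  ext i
  exact e.apply_symm_apply _

/-- `ExactOn` is only the inclusion of the kernel in the image; the product relation supplies the
other one. -/
lemma exactOn_iff {f : Matrix l m R} {g : Matrix m n R} (h : f * g = 0) :
    f.ExactOn g M ↔ Function.Exact (g.act M) (f.act M) := by
  constructor
  · intro H v
    refine ⟨H v, ?_⟩
    rintro ⟨w, rfl⟩
    rw [act_act, h, act_zero]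
  · exact fun H v hv => (H v).1 hv

lemma exactOn_map_iff {R' : Type*} [CommRing R'] [Algebra R R'] [Module R' M]
    [IsScalarTower R R' M] {f : Matrix l m R} {g : Matrix m n R} :
    (f.map (algebraMap R R')).ExactOn (g.map (algebraMap R R')) M ↔ f.ExactOn g M := by
  simp only [ExactOn, funext_iff, act_apply, map_apply, algebraMap_smul]

lemma lTensor_act [DecidableEq m] [DecidableEq n] (P : Type*) [AddCommGroup P] [Module R P]
    (f : Matrix m n R) (x : P ⊗[R] (n → M)) :
    piRight R R P (fun _ : m => M) ((f.act M).lTensor P x) =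
      f.act (P ⊗[R] M) (piRight R R P (fun _ : n => M) x) := by
  induction x with
  | zero => simp
  | add x y hx hy => simp only [map_add, hx, hy]
  | tmul p v =>
    ext i
    simp [act_apply, tmul_sum]

lemma exact_lTensor_act_iff (P : Type*) [AddCommGroup P] [Module R P]
    {f : Matrix l m R} {g : Matrix m n R} (h : f * g = 0) :
    Function.Exact ((g.act M).lTensor P) ((f.act M).lTensor P) ↔ f.ExactOn g (P ⊗[R] M) := by
  classical
  rw [exactOn_iff h]
  symm
  refine Function.Exact.iff_of_ladder_linearEquiv
    (e₁ := piRight R R P (fun _ : n => M)) (e₂ := piRight R R P (fun _ : m => M))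
    (e₃ := piRight R R P (fun _ : l => M)) ?_ ?_
  · exact LinearMap.ext fun x => (lTensor_act P g x).symm
  · exact LinearMap.ext fun x => (lTensor_act P f x).symm

lemma ExactOn.tensor (P : Type*) [AddCommGroup P] [Module R P] [Module.Flat R P]
    {f : Matrix l m R} {g : Matrix m n R} (h : f * g = 0) (H : f.ExactOn g M) :
    f.ExactOn g (P ⊗[R] M) :=
  (exact_lTensor_act_iff P h).1 (Module.Flat.lTensor_exact P ((exactOn_iff h).1 H))

lemma exactOn_tensor_iff (P : Type*) [AddCommGroup P] [Module R P] [Module.FaithfullyFlat R P]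
    {f : Matrix l m R} {g : Matrix m n R} (h : f * g = 0) :
    f.ExactOn g (P ⊗[R] M) ↔ f.ExactOn g M := by
  rw [← exact_lTensor_act_iff P h, Module.FaithfullyFlat.lTensor_exact_iff_exact, exactOn_iff h]

/-- Over a self-injective ring, dualizing preserves exactness. -/
lemma ExactOn.transpose {R : Type*} [CommRing R] [Module.Injective R R]
    {f : Matrix l m R} {g : Matrix m n R} (H : f.ExactOn g R) : gᵀ.ExactOn fᵀ R := by
  classical
  intro v hv
  -- The hypothesis on `v` says that this functional vanishes on the image of `g`, which contains
  -- the kernel of `f`. It thus descends to the image of `f`, and its extension to the whole space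
  -- has the required coordinates.
  let φ : (m → R) →ₗ[R] R := Fintype.linearCombination R v
  let fbar := (LinearMap.ker (f.act R)).liftQ (f.act R) le_rfl
  have hinj : Function.Injective fbar :=
    LinearMap.ker_eq_bot.1 (Submodule.ker_liftQ_eq_bot _ _ _ le_rfl)
  obtain ⟨ψ, hψ⟩ := (Module.Baer.of_injective ‹_›).extension_property fbar hinj
    ((LinearMap.ker (f.act R)).liftQ φ (by
      intro x hx
      obtain ⟨w, rfl⟩ := H x hx
      change ∑ i, (∑ j, g i j • w j) • v i = 0
      simp only [Finset.sum_smul]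
      rw [Finset.sum_comm]
      refine Finset.sum_eq_zero fun j _ => ?_
      have : ∑ i, g i j • v i = 0 := congrFun hv j
      calc _ = w j * ∑ i, g i j • v i := by
            rw [Finset.mul_sum]
            exact Finset.sum_congr rfl fun i _ => by simp only [smul_eq_mul]; ring
        _ = 0 := by rw [this, mul_zero]))
  refine ⟨fun i => ψ (Pi.single i 1), ?_⟩
  ext i
  have h1 := LinearMap.congr_fun hψ (Submodule.Quotient.mk (Pi.single i 1))
  have h2 : ψ (f.act R (Pi.single i 1)) = φ (Pi.single i 1) := h1
  have h3 : φ (Pi.single i 1) = v i := by simp [φ, Fintype.linearCombination_apply_single]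
  have h4 : f.act R (Pi.single i 1) = fun a => f a i := by
    ext a
    simp [act_apply, Pi.single_apply]
  rw [h3, h4] at h2
  rw [← h2]
  simp only [act_apply, transpose_apply]
  conv_rhs => rw [pi_eq_sum_univ (fun a => f a i)]
  rw [map_sum]
  refine Finset.sum_congr rfl fun a _ => ?_
  rw [map_smul]
  congr 2
  ext b
  simp [Pi.single_apply, eq_comm]

section Regular

variable {R' : Type*} [CommRing R'] [Algebra R R'] [Module R' M] [IsScalarTower R R' M]

lemma act_smul_algebra (f : Matrix m n R) (x : R') (v : n → M) :
    f.act M (x • v) = x • f.act M v := by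
  ext i
  simp only [act_apply, Pi.smul_apply, Finset.smul_sum]
  exact Finset.sum_congr rfl fun j _ => smul_comm _ _ _

lemma act_mk (f : Matrix m n R) (N : Submodule R' M) (v : n → M) :
    f.act (M ⧸ N) (fun j => Submodule.Quotient.mk (v j)) =
      fun i => Submodule.Quotient.mk (f.act M v i) :=
  act_map (N.mkQ.restrictScalars R) f v

lemma exists_smul_eq_of_mk_eq_zero (x : R') (v : m → M)
    (h : (fun i => (Submodule.Quotient.mk (v i) : QuotSMulTop x M)) = 0) : ∃ u, v = x • u := by
  have h1 : ∀ i, ∃ u, x • u = v i := fun i => by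
    obtain ⟨u, -, hu⟩ := (Submodule.mem_smul_pointwise_iff_exists _ _ _).1
      ((Submodule.Quotient.mk_eq_zero _).1 (congrFun h i))
    exact ⟨u, hu⟩
  choose u hu using h1
  exact ⟨u, funext fun i => (hu i).symm⟩

/-- Lift `v`; then `f v = x u` with `e u = 0`, so `u = f u'` and `v - x u'` is a cycle over `M`.
Exactness at two consecutive places is used up to obtain it at one. -/
lemma ExactOn.quotSMulTop {e : Matrix k l R} {f : Matrix l m R} {g : Matrix m n R}
    (hef : e * f = 0) {x : R'} (hx : IsSMulRegular M x) (h1 : e.ExactOn f M)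
    (h2 : f.ExactOn g M) : f.ExactOn g (QuotSMulTop x M) := by
  intro v hv
  obtain ⟨v, rfl⟩ : ∃ w : m → M, v = fun i => Submodule.Quotient.mk (w i) := by
    choose w hw using fun i => Submodule.Quotient.mk_surjective _ (v i)
    exact ⟨w, funext fun i => (hw i).symm⟩
  rw [act_mk] at hv
  obtain ⟨u, hu⟩ := exists_smul_eq_of_mk_eq_zero x _ hv
  have hxr : ∀ {ι : Type _} {v w : ι → M}, x • v = x • w → v = w := fun h =>
    funext fun i => hx (congrFun h i)
  have heu : e.act M u = 0 := by
    apply hxr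
    rw [← act_smul_algebra, ← hu, act_act, hef, act_zero, smul_zero]
  obtain ⟨u', rfl⟩ := h1 u heu
  obtain ⟨w, hw⟩ := h2 (v - x • u') (by
    rw [map_sub, act_smul_algebra]
    exact sub_eq_zero.2 hu)
  refine ⟨fun j => Submodule.Quotient.mk (w j), ?_⟩
  rw [act_mk, hw]
  ext i
  refine (Submodule.Quotient.eq _).2 ?_
  rw [Pi.sub_apply, sub_sub_cancel_left]
  exact neg_mem (Submodule.smul_mem_pointwise_smul _ _ _ trivial)

/-- With `K` the kernel of `f` and `I` the image of `g`, exactness modulo `x` and regularity of `x`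
give `K ≤ I + xK`; Nakayama concludes. -/
lemma ExactOn.of_quotSMulTop [IsNoetherianRing R'] [Module.Finite R' M] {f : Matrix l m R}
    {g : Matrix m n R} (hfg : f * g = 0) {x : R'} (hx : IsSMulRegular M x)
    (hxj : x ∈ Ideal.jacobson (⊥ : Ideal R')) (h : f.ExactOn g (QuotSMulTop x M)) :
    f.ExactOn g M := by
  let K : Submodule R' (m → M) :=
    { carrier := {v | f.act M v = 0}
      add_mem' := fun {a b} ha hb => by
        change f.act M (a + b) = 0
        rw [map_add, ha, hb, add_zero]
      zero_mem' := map_zero _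
      smul_mem' := fun r v hv => by
        change f.act M (r • v) = 0
        rw [act_smul_algebra, hv, smul_zero] }
  let I : Submodule R' (m → M) :=
    { carrier := {v | ∃ w, g.act M w = v}
      add_mem' := by
        rintro _ _ ⟨a, rfl⟩ ⟨b, rfl⟩
        exact ⟨a + b, map_add _ _ _⟩
      zero_mem' := ⟨0, map_zero _⟩
      smul_mem' := by
        rintro r _ ⟨w, rfl⟩
        exact ⟨r • w, act_smul_algebra _ _ _⟩ }
  have key : K ≤ I := by
    refine Submodule.le_of_le_smul_of_le_jacobson_bot (I := Ideal.span {x})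
      (IsNoetherian.noetherian K) ((Ideal.span_singleton_le_iff_mem _).2 hxj) ?_
    intro v hv
    obtain ⟨w, hw⟩ := h (fun i => Submodule.Quotient.mk (v i)) (by
      rw [act_mk, show f.act M v = 0 from hv]
      rfl)
    obtain ⟨w, rfl⟩ : ∃ w' : n → M, w = fun i => Submodule.Quotient.mk (w' i) := by
      choose w' hw' using fun i => Submodule.Quotient.mk_surjective _ (w i)
      exact ⟨w', funext fun i => (hw' i).symm⟩
    rw [act_mk] at hw
    obtain ⟨u, hu⟩ := exists_smul_eq_of_mk_eq_zero x (v - g.act M w) (by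
      ext i
      exact (Submodule.Quotient.mk_eq_zero _).2 ((Submodule.Quotient.eq _).1 (congrFun hw i).symm))
    have hfu : f.act M u = 0 := funext fun i => hx (by
      have : f.act M (x • u) = 0 := by
        rw [← hu, map_sub, act_act, hfg, act_zero, sub_zero]
        exact hv
      rw [act_smul_algebra] at this
      exact (congrFun this i).trans (smul_zero x).symm)
    rw [← sub_add_cancel v (g.act M w), hu, add_comm]
    exact Submodule.add_mem_sup ⟨w, rfl⟩
      (Submodule.smul_mem_smul (Ideal.mem_span_singleton_self x) hfu)
  exact fun v hv => key hv

end Regular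

lemma ExactOn.of_quotient_ofList {R' : Type*} [CommRing R'] [Algebra R R']
    [IsNoetherianRing R'] {f : Matrix l m R} {g : Matrix m n R} (hfg : f * g = 0)
    (xs : List R') {M : Type*} [AddCommGroup M] [Module R M] [Module R' M] [IsScalarTower R R' M]
    [Module.Finite R' M] (hxs : IsWeaklyRegular M xs)
    (hxj : ∀ x ∈ xs, x ∈ Ideal.jacobson (⊥ : Ideal R'))
    (h : f.ExactOn g (M ⧸ (Ideal.ofList xs • ⊤ : Submodule R' M))) : f.ExactOn g M := by
  induction xs generalizing M with
  | nil =>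
    exact h.of_linearEquiv ((Submodule.quotEquivOfEqBot _ (by simp)).restrictScalars R)
  | cons x xs ih =>
    rw [isWeaklyRegular_cons_iff] at hxs
    refine .of_quotSMulTop hfg hxs.1 (hxj x (by simp)) (ih hxs.2 (fun y hy => hxj y (by simp [hy])) ?_)
    exact h.of_linearEquiv
      ((Submodule.quotOfListConsSMulTopEquivQuotSMulTopInner M x xs).restrictScalars R)

end Matrix

/-! ### Ext of quotients of projectives, and a test for injective dimension. -/

namespace Submodule

open Abelian

variable {R : Type u} [CommRing R] {M : Type u} [AddCommGroup M] [Module R M] (K : Submodule R M)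

/-- The short complex `K ⟶ M ⟶ M / K`. -/
abbrev quotientShortComplex : ShortComplex (ModuleCat.{u} R) :=
  ModuleCat.shortComplexOfCompEqZero K.subtype K.mkQ (by ext; simp)

lemma quotientShortComplex_shortExact : K.quotientShortComplex.ShortExact :=
  ModuleCat.shortComplex_shortExact _ (LinearMap.exact_subtype_mkQ K) K.subtype_injective
    K.mkQ_surjective

lemma subsingleton_ext_one_quotient [Module.Projective R M] {Y : Type u} [AddCommGroup Y]
    [Module R Y] (h : ∀ φ : K →ₗ[R] Y, ∃ ψ : M →ₗ[R] Y, ψ ∘ₗ K.subtype = φ) :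
    Subsingleton (Abelian.Ext.{u} (ModuleCat.of R (M ⧸ K)) (ModuleCat.of R Y) 1) := by
  have hp : Projective (ModuleCat.of R M) :=
    ModuleCat.projective_of_categoryTheory_projective (ModuleCat.of R M)
  refine subsingleton_of_forall_eq 0 fun e => ?_
  obtain ⟨x, rfl⟩ := Ext.contravariant_sequence_exact₃ K.quotientShortComplex_shortExact _ e
    (Ext.eq_zero_of_projective (P := ModuleCat.of R M) _) (add_zero 1)
  obtain ⟨f, rfl⟩ := (Ext.mk₀_bijective _ _).2 x
  obtain ⟨ψ, hψ⟩ := h f.hom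
  have hf : f = K.quotientShortComplex.f ≫ ModuleCat.ofHom ψ := by
    ext x
    exact (LinearMap.congr_fun hψ x).symm
  rw [hf, ← Ext.mk₀_comp_mk₀, ShortComplex.ShortExact.extClass_comp_assoc]

lemma exists_extension_of_subsingleton_ext_one {Y : Type u} [AddCommGroup Y] [Module R Y]
    [h : Subsingleton (Abelian.Ext.{u} (ModuleCat.of R (M ⧸ K)) (ModuleCat.of R Y) 1)]
    (φ : K →ₗ[R] Y) : ∃ ψ : M →ₗ[R] Y, ψ ∘ₗ K.subtype = φ := by
  obtain ⟨x, hx⟩ := Ext.contravariant_sequence_exact₁ K.quotientShortComplex_shortExact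
    (ModuleCat.of R Y) (Ext.mk₀ (ModuleCat.ofHom φ)) (n₁ := 1) rfl (Subsingleton.elim (h := h) _ _)
  obtain ⟨f, rfl⟩ := (Ext.mk₀_bijective _ _).2 x
  rw [Ext.mk₀_comp_mk₀] at hx
  have := (Ext.mk₀_bijective _ _).1 hx
  exact ⟨f.hom, LinearMap.ext fun x => congrArg (fun g => ModuleCat.Hom.hom g x) this⟩

lemma subsingleton_ext_quotient_succ [Module.Projective R M] {Y : ModuleCat.{u} R} {j : ℕ}
    [h : Subsingleton (Abelian.Ext.{u} (ModuleCat.of R K) Y (j + 1))] :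
    Subsingleton (Abelian.Ext.{u} (ModuleCat.of R (M ⧸ K)) Y (j + 2)) := by
  have hp : Projective (ModuleCat.of R M) :=
    ModuleCat.projective_of_categoryTheory_projective (ModuleCat.of R M)
  refine subsingleton_of_forall_eq 0 fun e => ?_
  obtain ⟨x, rfl⟩ := Ext.contravariant_sequence_exact₃ K.quotientShortComplex_shortExact _ e
    (Ext.eq_zero_of_projective (P := ModuleCat.of R M) _) (show 1 + (j + 1) = j + 2 by lia)
  rw [Subsingleton.elim (h := h) x 0, Ext.comp_zero]

end Submodule

lemma CategoryTheory.Abelian.Ext.subsingleton_of_iso {R : Type u} [CommRing R]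
    {X X' Y : ModuleCat.{u} R} (e : X ≅ X') {j : ℕ} [h : Subsingleton (Abelian.Ext.{u} X Y j)] :
    Subsingleton (Abelian.Ext.{u} X' Y j) := by
  refine subsingleton_of_forall_eq 0 fun x => ?_
  rw [← Ext.mk₀_id_comp x, ← e.inv_hom_id, ← Ext.mk₀_comp_mk₀_assoc,
    Subsingleton.elim (h := h) ((Ext.mk₀ e.hom).comp x (zero_add j)) 0, Ext.comp_zero]

section InjectiveDimension

open Abelian

/-- A module has injective dimension at most `n` if the `Ext^(n+1)` of the cyclic modules into it
vanish. -/
theorem ModuleCat.hasInjectiveDimensionLE_of_subsingleton_ext {R : Type u} [CommRing R] (n : ℕ)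
    (M : ModuleCat.{u} R)
    (h : ∀ I : Ideal R, Subsingleton (Abelian.Ext.{u} (ModuleCat.of R (R ⧸ I)) M (n + 1))) :
    HasInjectiveDimensionLE M n := by
  induction n generalizing M with
  | zero =>
    have hB : Module.Baer R M := fun I φ => by
      have := h I
      obtain ⟨ψ, hψ⟩ := Submodule.exists_extension_of_subsingleton_ext_one (Y := M) I φ
      exact ⟨ψ, fun x hx => LinearMap.congr_fun hψ ⟨x, hx⟩⟩
    have := hB.injective
    rw [HasInjectiveDimensionLE, zero_add, ← injective_iff_hasInjectiveDimensionLT_one]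
    exact Module.injective_object_of_injective_module R M
  | succ n ih =>
    obtain ⟨I, inj, f, monof⟩ := (inferInstance : EnoughInjectives (ModuleCat.{u} R)).1 M
    let T := ShortComplex.mk f (cokernel.π f) (cokernel.condition f)
    have hT : T.ShortExact := { exact := ShortComplex.exact_cokernel f }
    refine (hT.hasInjectiveDimensionLT_X₃_iff n ‹_›).1 (ih T.X₃ fun J => ?_)
    refine subsingleton_of_forall_eq 0 fun e => ?_
    obtain ⟨e', rfl⟩ := Ext.covariant_sequence_exact₃ _ hT e rfl
      (Subsingleton.elim (h := h J) _ _)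
    rw [Ext.eq_zero_of_injective e', Ext.zero_comp]

end InjectiveDimension

/-! ### Free resolutions by matrices and the descent of injective dimension. -/

section Syzygy

open RingTheory.Sequence Pointwise TensorProduct

variable (R : Type u) [CommRing R]

/-- A submodule of a free module of finite rank. -/
structure FreeSub : Type u where
  /-- The rank of the ambient free module. -/
  ambient : ℕ
  /-- The submodule. -/
  sub : Submodule R (Fin ambient → R)

variable {R} [IsNoetherianRing R]

lemma exists_matrix_range_act_eq {n : ℕ} (K : Submodule R (Fin n → R)) :
    ∃ (m : ℕ) (f : Matrix (Fin n) (Fin m) R), LinearMap.range (f.act R) = K := by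
  obtain ⟨m, v, hv⟩ := Submodule.fg_iff_exists_fin_generating_family.1 (IsNoetherian.noetherian K)
  refine ⟨m, .of fun i j => v j i, ?_⟩
  rw [← hv]
  ext x
  rw [Submodule.mem_span_range_iff_exists_fun]
  refine exists_congr fun c => ?_
  have : Matrix.act (.of fun i j => v j i : Matrix (Fin n) (Fin m) R) R c = ∑ i, c i • v i := by
    ext i
    simp [Matrix.act_apply, mul_comm]
  rw [this]

namespace FreeSub

/-- The number of generators in a chosen finite generating family. -/
def rank (s : FreeSub R) : ℕ := (exists_matrix_range_act_eq s.2).choose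

/-- The matrix of a chosen finite generating family. -/
def mat (s : FreeSub R) : Matrix (Fin s.1) (Fin s.rank) R :=
  (exists_matrix_range_act_eq s.2).choose_spec.choose

lemma range_mat (s : FreeSub R) : LinearMap.range (s.mat.act R) = s.2 :=
  (exists_matrix_range_act_eq s.2).choose_spec.choose_spec

/-- The module of relations between the chosen generators. -/
def next (s : FreeSub R) : FreeSub R := ⟨s.rank, LinearMap.ker (s.mat.act R)⟩

/-- The matrix `s.next.mat` of relations, composable with `s.mat`. -/
def nextMat (s : FreeSub R) : Matrix (Fin s.rank) (Fin s.next.rank) R := s.next.mat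

lemma exactOn_self (s : FreeSub R) : s.mat.ExactOn s.nextMat R := fun v hv => by
  have : v ∈ LinearMap.range (s.next.mat.act R) := by
    rw [s.next.range_mat]
    exact hv
  exact this

lemma mat_mul_nextMat (s : FreeSub R) : s.mat * s.nextMat = 0 := by
  have h : ∀ w, s.mat.act R (s.nextMat.act R w) = 0 := fun w => by
    have : s.nextMat.act R w ∈ LinearMap.range (s.next.mat.act R) := ⟨w, rfl⟩
    rw [s.next.range_mat] at this
    exact this
  ext i j
  have h1 := congrFun (h (Pi.single j 1)) i
  rw [Matrix.act_act] at h1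
  simpa [Matrix.act_apply, Pi.single_apply] using h1

/-- Each element of the sequence costs one step of the resolution, hence the shift by `xs.length`.
-/
lemma exactOn_quotient_ofList {R' : Type*} [CommRing R'] [Algebra R R'] (xs : List R')
    (s : FreeSub R) (M : Type*) [AddCommGroup M] [Module R M] [Module R' M] [IsScalarTower R R' M]
    (hxs : IsWeaklyRegular M xs) (h : ∀ k, (next^[k] s).mat.ExactOn (next^[k] s).nextMat M) :
    ∀ k, (next^[xs.length + k] s).mat.ExactOn (next^[xs.length + k] s).nextMat
      (M ⧸ (Ideal.ofList xs • ⊤ : Submodule R' M)) := by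
  induction xs generalizing s M with
  | nil =>
    intro k
    rw [List.length_nil, zero_add]
    exact (h k).of_linearEquiv ((Submodule.quotEquivOfEqBot _ (by simp)).symm.restrictScalars R)
  | cons x xs ih =>
    intro k
    rw [isWeaklyRegular_cons_iff] at hxs
    have h1 := ih s.next (QuotSMulTop x M) hxs.2 (fun j => by
      have h2 := h (j + 1)
      rw [← Function.iterate_succ_apply, Function.iterate_succ_apply']
      rw [Function.iterate_succ_apply'] at h2
      exact .quotSMulTop (mat_mul_nextMat (next^[j] s)) hxs.1 (h j) h2) k
    rw [List.length_cons, show xs.length + 1 + k = xs.length + k + 1 by lia,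
      Function.iterate_succ_apply]
    exact h1.of_linearEquiv
      ((Submodule.quotOfListConsSMulTopEquivQuotSMulTopInner M x xs).symm.restrictScalars R)

open Abelian in
/-- Vanishing of `Ext` from exactness of the dual of a free resolution. -/
theorem subsingleton_ext (j : ℕ) (s : FreeSub R)
    (h : (next^[j] s).nextMat.transpose.ExactOn (next^[j] s).mat.transpose R) :
    Subsingleton (Abelian.Ext.{u} (ModuleCat.of R ((Fin s.1 → R) ⧸ s.2)) (ModuleCat.of R R)
      (j + 1)) := by
  induction j generalizing s with
  | zero =>
    refine s.2.subsingleton_ext_one_quotient fun φ => ?_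
    have hmem : ∀ w, s.mat.act R w ∈ s.2 := fun w => by
      have : s.mat.act R w ∈ LinearMap.range (s.mat.act R) := ⟨w, rfl⟩
      rwa [s.range_mat] at this
    let χ : (Fin s.rank → R) →ₗ[R] R := φ ∘ₗ (s.mat.act R).codRestrict s.2 hmem
    change s.nextMat.transpose.ExactOn s.mat.transpose R at h
    -- The values of `φ` on the generators form a vector killed by the transposed relations. Writing
    -- it as the transpose of `s.mat` applied to `u` gives a functional on the ambient module
    -- extending `φ`.
    obtain ⟨u, hu⟩ := h (fun i => χ (fun j => if i = j then 1 else 0)) (by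
      ext j
      have h0 : (s.mat.act R).codRestrict s.2 hmem (fun i => s.nextMat i j) = 0 := by
        ext1
        have : s.mat.act R (fun i => s.nextMat i j) = fun i => (s.mat * s.nextMat) i j := by
          ext i
          simp only [Matrix.act_apply, Matrix.mul_apply, smul_eq_mul]
        change s.mat.act R (fun i => s.nextMat i j) = 0
        rw [this, mat_mul_nextMat]
        rfl
      have h1 := χ.pi_apply_eq_sum_univ (fun i => s.nextMat i j)
      rw [show χ (fun i => s.nextMat i j) = φ 0 from congrArg φ h0, map_zero] at h1
      exact h1.symm)
    refine ⟨Fintype.linearCombination R u, ?_⟩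
    ext ⟨y, hy⟩
    have hy' := hy
    rw [← s.range_mat] at hy'
    obtain ⟨w, rfl⟩ := hy'
    change ∑ i, (∑ j, s.mat i j • w j) • u i = χ w
    rw [χ.pi_apply_eq_sum_univ]
    simp only [Finset.sum_smul]
    rw [Finset.sum_comm]
    refine Finset.sum_congr rfl fun i _ => ?_
    rw [← congrFun hu i, Matrix.act_apply, smul_eq_mul, Finset.mul_sum]
    refine Finset.sum_congr rfl fun k _ => ?_
    simp only [smul_eq_mul, Matrix.transpose_apply]
    ring
  | succ j ih =>
    have h1 := ih s.next h
    let e : ((Fin s.rank → R) ⧸ s.next.2) ≃ₗ[R] s.2 :=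
      (s.mat.act R).quotKerEquivRange.trans (LinearEquiv.ofEq _ _ s.range_mat)
    have h2 : Subsingleton (Abelian.Ext.{u} (ModuleCat.of R s.2) (ModuleCat.of R R) (j + 1)) :=
      Ext.subsingleton_of_iso (h := h1) e.toModuleIso
    exact s.2.subsingleton_ext_quotient_succ

end FreeSub

open FreeSub

/-- If exactness of a pair of matrices survives modulo a regular sequence of a faithfully flat
extension that generates an ideal `I` with `S / I` self-injective, then the transposed pair is
exact. -/
theorem Matrix.ExactOn.transpose_of_quotient {l m n : Type*} [Fintype l] [Fintype m] [Fintype n]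
    {S : Type*} [CommRing S] (I : Ideal S) [Module.Injective (S ⧸ I) (S ⧸ I)] {S' : Type*}
    [CommRing S'] [IsNoetherianRing S'] [Algebra S S'] [Module.FaithfullyFlat S S'] (xs : List S')
    (hxs : IsWeaklyRegular S' xs) (hxj : ∀ x ∈ xs, x ∈ Ideal.jacobson (⊥ : Ideal S'))
    (hI : Ideal.ofList xs = I.map (algebraMap S S')) {f : Matrix l m S} {g : Matrix m n S}
    (hfg : f * g = 0) (h : f.ExactOn g (S' ⧸ (Ideal.ofList xs • ⊤ : Submodule S' S'))) :
    g.transpose.ExactOn f.transpose S := by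
  have hgf : g.transpose * f.transpose = 0 := by
    rw [← Matrix.transpose_mul, hfg, Matrix.transpose_zero]
  have hIe : (I • (⊤ : Submodule S S')) =
      (Ideal.ofList xs • ⊤ : Submodule S' S').restrictScalars S := by
    rw [Ideal.smul_top_eq_map, hI, smul_eq_mul, Ideal.mul_top]
  let ε : (S' ⊗[S] (S ⧸ I)) ≃ₗ[S] (S' ⧸ (Ideal.ofList xs • ⊤ : Submodule S' S')) :=
    (TensorProduct.tensorQuotEquivQuotSMul S' I).trans (Submodule.quotEquivOfEq (I • (⊤ : Submodule S S')) ((Ideal.ofList xs • ⊤ : Submodule S' S').restrictScalars S) hIe)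
  -- Descend to `S / I` and dualize there; ascend to `S' / (xs)`, lift over the regular sequence to
  -- `S'`, and descend to `S`.
  have h3 : f.ExactOn g (S ⧸ I) := (Matrix.exactOn_tensor_iff S' hfg).1 (h.of_linearEquiv ε.symm)
  rw [← Matrix.exactOn_map_iff (R' := S ⧸ I)] at h3
  have h4 : g.transpose.ExactOn f.transpose (S ⧸ I) := Matrix.exactOn_map_iff.1 h3.transpose
  have h5 : g.transpose.ExactOn f.transpose (S' ⧸ (Ideal.ofList xs • ⊤ : Submodule S' S')) :=
    (h4.tensor S' hgf).of_linearEquiv ε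
  exact (Matrix.exactOn_tensor_iff S' hgf).1
    ((h5.of_quotient_ofList hgf xs hxs hxj).of_linearEquiv (TensorProduct.rid S S').symm)

/-- Let `S` be a Noetherian ring with an ideal `I` such that `S / I` is self-injective. If over a
faithfully flat extension `I` is generated by a regular sequence in the Jacobson radical, then the
injective dimension of `S` is at most the length of the sequence. -/
theorem hasInjectiveDimensionLE_of_faithfullyFlat (S : Type u) [CommRing S] [IsNoetherianRing S]
    (I : Ideal S) [Module.Injective (S ⧸ I) (S ⧸ I)] (S' : Type*) [CommRing S']
    [IsNoetherianRing S'] [Algebra S S'] [Module.FaithfullyFlat S S'] (xs : List S')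
    (hxs : IsWeaklyRegular S' xs) (hxj : ∀ x ∈ xs, x ∈ Ideal.jacobson (⊥ : Ideal S'))
    (hI : Ideal.ofList xs = I.map (algebraMap S S')) :
    HasInjectiveDimensionLE (ModuleCat.of S S) xs.length := by
  refine ModuleCat.hasInjectiveDimensionLE_of_subsingleton_ext _ _ fun J => ?_
  let σ : S ≃ₗ[S] (Fin 1 → S) := (LinearEquiv.funUnique (Fin 1) S S).symm
  let s : FreeSub S := ⟨1, Submodule.map σ.toLinearMap J⟩
  let e : ((Fin 1 → S) ⧸ s.2) ≃ₗ[S] (S ⧸ J) := (Submodule.Quotient.equiv J s.2 σ rfl).symm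
  have key : Subsingleton (Abelian.Ext.{u} (ModuleCat.of S ((Fin 1 → S) ⧸ s.2)) (ModuleCat.of S S)
      (xs.length + 1)) := by
    apply s.subsingleton_ext xs.length
    have h1 : ∀ k, (next^[k] s).mat.ExactOn (next^[k] s).nextMat S' := fun k =>
      ((exactOn_self _).tensor S' (mat_mul_nextMat _)).of_linearEquiv (TensorProduct.rid S S')
    have h2 := s.exactOn_quotient_ofList xs S' hxs h1 0
    rw [add_zero] at h2
    exact Matrix.ExactOn.transpose_of_quotient I xs hxs hxj hI (mat_mul_nextMat _) h2
  exact Abelian.Ext.subsingleton_of_iso e.toModuleIso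

end Syzygy

/-! ### Infinite residue field, and the multiplicity criterion for injective dimension. -/

namespace IsLocalRing

open Polynomial

/-- Every Noetherian local ring has a flat local extension with the same maximal ideal and with
infinite residue field. -/
theorem exists_flat_infinite_residueField (A : Type u) [CommRing A] [IsLocalRing A]
    [IsNoetherianRing A] : ∃ (A' : Type u) (_ : CommRing A') (_ : IsLocalRing A')
      (_ : IsNoetherianRing A') (_ : Algebra A A'), Module.FaithfullyFlat A A' ∧
      (maximalIdeal A).map (algebraMap A A') = maximalIdeal A' ∧
      Infinite (A' ⧸ maximalIdeal A') := by
  -- A' is A[X] localized at mA[X]; the powers of X stay distinct in its residue field.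
  let P : Ideal A[X] := (maximalIdeal A).map C
  have hP : P.IsPrime := Ideal.isPrime_map_C_of_isPrime
  let A' := Localization.AtPrime P
  have hmax : (maximalIdeal A).map (algebraMap A A') = maximalIdeal A' := by
    rw [← Localization.AtPrime.map_eq_maximalIdeal, Ideal.map_map]
    rfl
  have hflat : Module.Flat A A' := Module.Flat.trans A A[X] A'
  have hloc : IsLocalHom (algebraMap A A') := ⟨fun a ha => by
    by_contra h
    have : algebraMap A A' a ∈ maximalIdeal A' := hmax ▸ Ideal.mem_map_of_mem _ h
    exact this ha⟩
  refine ⟨A', inferInstance, inferInstance, IsLocalization.isNoetherianRing P.primeCompl _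
    inferInstance, inferInstance, Module.FaithfullyFlat.of_flat_of_isLocalHom, hmax, ?_⟩
  refine Infinite.of_injective
    (fun n : ℕ => Ideal.Quotient.mk (maximalIdeal A') (algebraMap A[X] A' (X ^ n))) fun i j h => ?_
  have h1 : algebraMap A[X] A' (X ^ i - X ^ j) ∈ maximalIdeal A' := by
    rw [map_sub]
    exact Ideal.Quotient.eq.1 h
  rw [IsLocalization.AtPrime.to_map_mem_maximal_iff A' P] at h1
  by_contra hij
  have h2 := Ideal.mem_map_C_iff.1 h1 i
  simp only [coeff_sub, coeff_X_pow, if_neg hij, if_true, sub_zero] at h2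
  exact (Ideal.ne_top_iff_one _).1 (maximalIdeal.isMaximal A).ne_top h2

lemma length_baseChange_eq {A A' : Type*} [CommRing A] [IsLocalRing A] [CommRing A']
    [IsLocalRing A'] [Algebra A A'] [Module.Flat A A']
    (h : (maximalIdeal A).map (algebraMap A A') = maximalIdeal A') (M : Type*) [AddCommGroup M]
    [Module A M] : Module.length A' (TensorProduct A A' M) = Module.length A M := by
  have hloc : IsLocalHom (algebraMap A A') := ⟨fun a ha => by
    by_contra h'
    have : algebraMap A A' a ∈ maximalIdeal A' := h ▸ Ideal.mem_map_of_mem _ h'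
    exact this ha⟩
  rw [IsLocalRing.length_baseChange, h]
  have : IsSimpleModule A' (A' ⧸ maximalIdeal A') :=
    isSimpleModule_iff_quot_maximal.2 ⟨_, maximalIdeal.isMaximal A', ⟨.refl _ _⟩⟩
  rw [Module.length_eq_one A' (A' ⧸ maximalIdeal A'), mul_one]

lemma hilbertSamuel_baseChange {A A' : Type*} [CommRing A] [IsLocalRing A] [CommRing A']
    [IsLocalRing A'] [Algebra A A'] [Module.Flat A A']
    (h : (maximalIdeal A).map (algebraMap A A') = maximalIdeal A') (c : Ideal A) (M : Type*)
    [AddCommGroup M] [Module A M] (n : ℕ) :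
    (c.map (algebraMap A A')).hilbertSamuel (TensorProduct A A' M) n = c.hilbertSamuel M n := by
  rw [Ideal.hilbertSamuel, Ideal.hilbertSamuel, ← Ideal.map_pow,
    (TensorProduct.tensorQuotMapSMulEquivTensorQuot M A' (c ^ n)).length_eq,
    length_baseChange_eq h]

lemma map_mem_jacobson_of_isIntegral {R T : Type*} [CommRing R] [IsLocalRing R] [CommRing T]
    (f : R →+* T) (hf : f.IsIntegral) {x : R} (hx : x ∈ maximalIdeal R) :
    f x ∈ Ideal.jacobson (⊥ : Ideal T) := by
  rw [Ideal.jacobson, Ideal.mem_sInf]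
  rintro N ⟨-, hN⟩
  have := Ideal.isMaximal_comap_of_isIntegral_of_isMaximal' f hf N
  have h : x ∈ N.comap f := eq_maximalIdeal this ▸ hx
  exact h

open RingTheory.Sequence TensorProduct in
/-- Let `S` be a finite algebra over a Noetherian local ring with an `S`-regular sequence of length
`d`. If `S / c S` is self-injective and the multiplicity of `S` with respect to `c` is at most the
length of `S / c S`, then `S` has injective dimension at most `d`. -/
theorem hasInjectiveDimensionLE_of_multiplicity {A : Type u} [CommRing A] [IsLocalRing A]
    [IsNoetherianRing A] (S : Type u) [CommRing S] [Algebra A S] [Module.Finite A S]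
    {c : Ideal A} {s : ℕ} (hs : maximalIdeal A ^ s ≤ c) (hc : c ≤ maximalIdeal A)
    [Module.Injective (S ⧸ c.map (algebraMap A S)) (S ⧸ c.map (algebraMap A S))]
    (rs : List A) (hrm : ∀ r ∈ rs, r ∈ maximalIdeal A) (hrr : IsWeaklyRegular S rs) {e : ℕ}
    (he : Module.length A (S ⧸ c.map (algebraMap A S)) = e)
    (hb : ∀ ε > 0, ∃ᶠ n : ℕ in atTop,
      (rs.length.factorial : ℝ) * (c.hilbertSamuel S n : ℝ) ≤ (e + ε) * (n : ℝ) ^ rs.length) :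
    HasInjectiveDimensionLE (ModuleCat.of S S) rs.length := by
  obtain ⟨A', _, _, _, _, hff, hmax, hinf⟩ := exists_flat_infinite_residueField A
  have hSN : IsNoetherianRing S := IsNoetherianRing.of_finite A S
  let c' := c.map (algebraMap A A')
  have hreg' : IsWeaklyRegular (A' ⊗[A] S) (rs.map (algebraMap A A')) :=
    hrr.of_flat_of_isBaseChange (TensorProduct.isBaseChange A S A')
  have hdepth : DepthGE rs.length (ModuleCat.of A' (A' ⊗[A] S)) := by
    have := depthGE_of_isWeaklyRegular (M := ModuleCat.of A' (A' ⊗[A] S))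
      (rs := rs.map (algebraMap A A')) (by
        intro r hr
        obtain ⟨r', hr', rfl⟩ := List.mem_map.1 hr
        exact hmax ▸ Ideal.mem_map_of_mem _ (hrm r' hr')) hreg'
    rwa [List.length_map] at this
  obtain ⟨xs, hxl, hxc, hxr, hxe⟩ := Ideal.exists_isWeaklyRegular_length_le (c := c') (s := s)
    (by rw [← hmax, ← Ideal.map_pow]; exact Ideal.map_mono hs)
    (by rw [← hmax]; exact Ideal.map_mono hc) (ModuleCat.of A' (A' ⊗[A] S)) hdepth (e := e)
    (fun ε hε => by
      refine (hb ε hε).mono fun n hn => ?_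
      change _ * ((c'.hilbertSamuel (A' ⊗[A] S) n : ℕ) : ℝ) ≤ _
      rwa [hilbertSamuel_baseChange hmax])
  have hlen : Module.length A' ((A' ⊗[A] S) ⧸ (c' • ⊤ : Submodule A' (A' ⊗[A] S))) = e := by
    rw [(TensorProduct.tensorQuotMapSMulEquivTensorQuot S A' c).length_eq,
      length_baseChange_eq hmax, ← he]
    exact (Submodule.quotEquivOfEq (c • (⊤ : Submodule A S))
      ((c.map (algebraMap A S)).restrictScalars A) (Ideal.smul_top_eq_map c)).length_eq
  -- One submodule lies in the other, and its colength is at most the finite colength `e` of the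
  -- larger one.
  have heq : (Ideal.ofList xs • ⊤ : Submodule A' (A' ⊗[A] S)) = c' • ⊤ := by
    have hle : (Ideal.ofList xs • ⊤ : Submodule A' (A' ⊗[A] S)) ≤ c' • ⊤ :=
      Submodule.smul_mono_left (Ideal.span_le.2 fun x hx => hxc x hx)
    by_contra hne
    have h1 := Order.coheight_strictAnti (lt_of_le_of_ne hle hne)
      (by rw [← Module.length_quotient, hlen]; exact ENat.natCast_lt_top e)
    rw [← Module.length_quotient, ← Module.length_quotient, hlen] at h1
    exact absurd hxe (not_le.2 h1)
  rw [Ideal.smul_top_eq_map, Ideal.smul_top_eq_map] at heq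
  have heq' := Submodule.restrictScalars_injective A' _ _ heq
  -- The descent needs an extension of `S`, while the sequence lives over `A'`; swapping the factors
  -- reconciles the two.
  let ψ := (Algebra.TensorProduct.comm A A' S)
  let j : A' →+* S ⊗[A] A' := (ψ : A' ⊗[A] S →+* S ⊗[A] A').comp (algebraMap A' (A' ⊗[A] S))
  have hj : ∀ (J : Ideal A'), J.map j =
      (J.map (algebraMap A' (A' ⊗[A] S))).map (ψ : A' ⊗[A] S →+* S ⊗[A] A') :=
    fun J => (Ideal.map_map _ _).symm
  have hNoeth : IsNoetherianRing (S ⊗[A] A') := by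
    have : IsNoetherianRing (A' ⊗[A] S) := IsNoetherianRing.of_finite A' _
    exact isNoetherianRing_of_ringEquiv _ ψ.toRingEquiv
  have hint : j.IsIntegral := by
    have h1 : (algebraMap A' (A' ⊗[A] S)).IsIntegral :=
      algebraMap_isIntegral_iff.2 inferInstance
    exact h1.trans _ _ (RingHom.isIntegral_of_surjective _ ψ.surjective)
  have hfin : HasInjectiveDimensionLE (ModuleCat.of S S) (xs.map j).length := by
    refine hasInjectiveDimensionLE_of_faithfullyFlat S (c.map (algebraMap A S)) (S ⊗[A] A')
      (xs.map j) ?_ ?_ ?_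
    · refine (ψ.toAddEquiv.isWeaklyRegular_congr (List.forall₂_map_right_iff.2
        (List.forall₂_same.2 fun x _ y => ?_))).1 hxr
      rw [Algebra.smul_def]
      exact map_mul ψ _ _
    · intro y hy
      obtain ⟨x, hx, rfl⟩ := List.mem_map.1 hy
      exact map_mem_jacobson_of_isIntegral j hint
        ((by rw [← hmax]; exact Ideal.map_mono hc : c' ≤ maximalIdeal A') (hxc x hx))
    · rw [← Ideal.map_ofList, hj, heq', ← hj, Ideal.map_map, Ideal.map_map]
      congr 1
      ext a
      change ψ ((algebraMap A A' a) ⊗ₜ 1) = (algebraMap A S a) ⊗ₜ 1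
      rw [Algebra.TensorProduct.comm_tmul, Algebra.algebraMap_eq_smul_one,
        Algebra.algebraMap_eq_smul_one, TensorProduct.tmul_smul, TensorProduct.smul_tmul']
  rwa [List.length_map, hxl] at hfin

end IsLocalRing

/-! ### The ideal transform B and its local cohomology. -/

lemma exists_pow_smul_eq_zero {A : Type*} [CommRing A] {J : Ideal A} {E : Type*} [AddCommGroup E]
    [Module A E] [hE : Module.Finite A E] (h : powTorsion J E = ⊤) :
    ∃ s : ℕ, ∀ a ∈ J ^ s, ∀ x : E, a • x = 0 := by
  obtain ⟨S, hS⟩ := hE.fg_top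
  have h' : ∀ x : E, ∃ n : ℕ, ∀ a ∈ J ^ n, a • x = 0 := fun x => by
    have : x ∈ powTorsion J E := h ▸ Submodule.mem_top
    exact this
  choose n hn using h'
  refine ⟨S.sup n, fun a ha x => ?_⟩
  have hx : x ∈ Submodule.span A (S : Set E) := hS ▸ Submodule.mem_top
  induction hx using Submodule.span_induction with
  | mem x hx => exact hn x a (Ideal.pow_le_pow_right (Finset.le_sup hx) ha)
  | zero => exact smul_zero a
  | add x y _ _ hx hy => rw [smul_add, hx, hy, add_zero]
  | smul b x _ hx => rw [smul_comm, hx, smul_zero]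

lemma powTorsion_eq_bot_of_isSMulRegular {A : Type*} [CommRing A] {J : Ideal A} {E : Type*}
    [AddCommGroup E] [Module A E] {r : A} (hrJ : r ∈ J) (hr : IsSMulRegular E r) :
    powTorsion J E = ⊥ := by
  rw [eq_bot_iff]
  rintro x ⟨n, hn⟩
  exact (hr.pow n) ((hn _ (Ideal.pow_mem_pow hrJ n)).trans (smul_zero _).symm)

section IdealTransform

variable {A : Type u} [CommRing A] (J : Ideal A) (Q : Type u) [CommRing Q] [Algebra A Q]

/-- The elements `q` of the `A`-algebra `Q` with `J ^ n q ⊆ A` for some `n`. -/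
def idealTransform : Subalgebra A Q where
  carrier := {q | ∃ n : ℕ, ∀ a ∈ J ^ n, a • q ∈ LinearMap.range (Algebra.linearMap A Q)}
  mul_mem' := by
    rintro x y ⟨n, hn⟩ ⟨m, hm⟩
    refine ⟨n + m, fun a ha => ?_⟩
    rw [pow_add] at ha
    induction ha using Submodule.mul_induction_on' with
    | mem_mul_mem a ha b hb =>
      obtain ⟨u, hu⟩ := hn a ha
      obtain ⟨v, hv⟩ := hm b hb
      refine ⟨u * v, ?_⟩
      rw [← smul_mul_smul_comm, ← hu, ← hv]
      exact map_mul (algebraMap A Q) u v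
    | add a _ b _ ha hb =>
      rw [add_smul]
      exact add_mem ha hb
  add_mem' := by
    rintro x y ⟨n, hn⟩ ⟨m, hm⟩
    exact ⟨n + m, fun a ha => by
      rw [smul_add]
      exact add_mem (hn a (Ideal.pow_le_pow_right (by lia) ha))
        (hm a (Ideal.pow_le_pow_right (by lia) ha))⟩
  algebraMap_mem' a := ⟨0, fun b _ => ⟨b * a, by
    rw [Algebra.linearMap_apply, map_mul, Algebra.smul_def]⟩⟩

variable {J Q}

variable (J Q) in
/-- The `J`-power torsion of `Q / A`. -/
abbrev transformTorsion : Submodule A (Q ⧸ LinearMap.range (Algebra.linearMap A Q)) :=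
  powTorsion J (Q ⧸ LinearMap.range (Algebra.linearMap A Q))

lemma mkQ_mem_transformTorsion {q : Q} :
    (LinearMap.range (Algebra.linearMap A Q)).mkQ q ∈ transformTorsion J Q ↔
      q ∈ idealTransform J Q := by
  refine exists_congr fun n => forall₂_congr fun a ha => ?_
  rw [← map_smul, Submodule.mkQ_apply, Submodule.Quotient.mk_eq_zero]

variable (J Q) in
/-- The quotient map of the ideal transform by `A`. -/
def idealTransformMk : idealTransform J Q →ₗ[A] transformTorsion J Q :=
  ((LinearMap.range (Algebra.linearMap A Q)).mkQ ∘ₗ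
    (idealTransform J Q).val.toLinearMap).codRestrict _ fun b => mkQ_mem_transformTorsion.2 b.2

lemma idealTransformMk_surjective : Function.Surjective (idealTransformMk J Q) := by
  rintro ⟨t, ht⟩
  obtain ⟨q, rfl⟩ := Submodule.mkQ_surjective _ t
  exact ⟨⟨q, mkQ_mem_transformTorsion.1 ht⟩, rfl⟩

lemma idealTransformMk_eq_zero {b : idealTransform J Q} :
    idealTransformMk J Q b = 0 ↔ ∃ a, algebraMap A (idealTransform J Q) a = b := by
  rw [Subtype.ext_iff]
  change Submodule.Quotient.mk (b : Q) = (0 : Q ⧸ LinearMap.range (Algebra.linearMap A Q)) ↔ _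
  rw [Submodule.Quotient.mk_eq_zero]
  exact exists_congr fun a => ⟨fun h => Subtype.ext h, fun h => congrArg Subtype.val h⟩

variable (hinj : Function.Injective (algebraMap A Q))

variable (A Q) in
/-- The short complex `A ⟶ Q ⟶ Q / A`. -/
abbrev algebraShortComplex : ShortComplex (ModuleCat.{u} A) :=
  ModuleCat.shortComplexOfCompEqZero (Algebra.linearMap A Q)
    (LinearMap.range (Algebra.linearMap A Q)).mkQ (LinearMap.range_mkQ_comp _)

include hinj in
lemma algebraShortComplex_shortExact : (algebraShortComplex A Q).ShortExact :=
  ModuleCat.shortComplex_shortExact _ (LinearMap.exact_map_mkQ_range _) hinj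
    (Submodule.mkQ_surjective _)

lemma exact_idealTransformMk :
    Function.Exact (Algebra.linearMap A (idealTransform J Q)) (idealTransformMk J Q) :=
  fun _ => idealTransformMk_eq_zero

variable (J Q) in
/-- The short complex `A ⟶ B ⟶ B / A` for the ideal transform `B`. -/
abbrev transformShortComplex : ShortComplex (ModuleCat.{u} A) :=
  ModuleCat.shortComplexOfCompEqZero (Algebra.linearMap A (idealTransform J Q))
    (idealTransformMk J Q) (LinearMap.ext fun a => idealTransformMk_eq_zero.2 ⟨a, rfl⟩)

include hinj in
lemma algebraMap_idealTransform_injective :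
    Function.Injective (Algebra.linearMap A (idealTransform J Q)) := fun _ _ h =>
  hinj (congrArg Subtype.val h)

include hinj in
lemma transformShortComplex_shortExact : (transformShortComplex J Q).ShortExact :=
  ModuleCat.shortComplex_shortExact _ exact_idealTransformMk
    (algebraMap_idealTransform_injective hinj) idealTransformMk_surjective

variable {r : A} (hrJ : r ∈ J) (hr : Function.Bijective (fun y : Q => r • y))

include hinj hrJ hr in
lemma nonempty_transformTorsion_linearEquiv :
    Nonempty (transformTorsion J Q ≃ₗ[A] (localCohomology J 1).obj (ModuleCat.of A A)) :=
  localCohomology.exists_linearEquiv_powTorsion (algebraShortComplex_shortExact hinj) hrJ hr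

lemma finite_idealTransform [IsNoetherianRing A] [Module.Finite A (transformTorsion J Q)] :
    Module.Finite A (idealTransform J Q) := by
  have := isNoetherian_of_range_eq_ker (Algebra.linearMap A (idealTransform J Q))
    (idealTransformMk J Q) ?_
  · infer_instance
  exact exact_idealTransformMk.linearMap_ker_eq.symm

lemma powTorsion_transformTorsion : powTorsion J (transformTorsion J Q) = ⊤ := by
  rw [eq_top_iff]
  rintro ⟨t, n, hn⟩ -
  exact ⟨n, fun a ha => Subtype.ext (hn a ha)⟩

/-- Transforming twice gives nothing new: finiteness of B/A yields one `s` with J^s B ⊆ A, so J^n q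
⊆ B implies J^(s+n) q ⊆ A. -/
lemma powTorsion_quotient_idealTransform [Module.Finite A (transformTorsion J Q)] :
    powTorsion J (Q ⧸ Subalgebra.toSubmodule (idealTransform J Q)) = ⊥ := by
  obtain ⟨s, hs⟩ := exists_pow_smul_eq_zero (powTorsion_transformTorsion (J := J) (Q := Q))
  rw [eq_bot_iff]
  intro t ht
  obtain ⟨q, rfl⟩ := Submodule.mkQ_surjective _ t
  obtain ⟨n, hn⟩ := ht
  rw [Submodule.mem_bot, Submodule.mkQ_apply, Submodule.Quotient.mk_eq_zero]
  refine ⟨s + n, fun a ha => ?_⟩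
  rw [pow_add] at ha
  induction ha using Submodule.mul_induction_on' with
  | mem_mul_mem a ha b hb =>
    have h := hn b hb
    rw [← map_smul, Submodule.mkQ_apply, Submodule.Quotient.mk_eq_zero] at h
    have h2 := hs a ha (idealTransformMk J Q ⟨b • q, h⟩)
    rw [← map_smul, idealTransformMk_eq_zero] at h2
    obtain ⟨u, hu⟩ := h2
    refine ⟨u, ?_⟩
    rw [mul_smul]
    exact congrArg Subtype.val hu
  | add a _ b _ ha hb =>
    rw [add_smul]
    exact add_mem ha hb

-- Degree 0 holds because `r` is regular on B, and degree 1 because Q/B has no power torsion. In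
-- degrees from 2 to d - 1, B sits between A, where vanishing is assumed, and the torsion module
-- B/A.
open localCohomology in
include hinj hrJ hr in
lemma vanishes_idealTransform [IsNoetherianRing A] [Module.Finite A (transformTorsion J Q)] {d : ℕ}
    (h : ∀ i : ℕ, i ≠ 1 → i ≠ d → Subsingleton ((localCohomology J i).obj (ModuleCat.of A A)))
    (i : ℕ) (hi : i < d) : Vanishes J i (ModuleCat.of A (idealTransform J Q)) := by
  obtain rfl | rfl | ⟨j, rfl⟩ : i = 0 ∨ i = 1 ∨ ∃ j, i = j + 2 := by
    rcases i with - | - | j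
    exacts [.inl rfl, .inr (.inl rfl), .inr (.inr ⟨j, rfl⟩)]
  · refine vanishes_zero_of_powTorsion_eq_bot
      (powTorsion_eq_bot_of_isSMulRegular hrJ fun x y hxy => ?_)
    exact Subtype.ext (hr.1 (congrArg Subtype.val hxy))
  · exact vanishes_one_of_powTorsion_eq_bot
      (Subalgebra.toSubmodule (idealTransform J Q)).quotientShortComplex_shortExact hrJ hr
      powTorsion_quotient_idealTransform
  · have : Subsingleton ((localCohomology J (j + 1 + 1)).obj (ModuleCat.of A A)) :=
      h _ (by lia) (by lia)
    exact Vanishes.middle (transformShortComplex_shortExact hinj)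
      (vanishes_of_subsingleton (i := j + 1)) (vanishes_of_torsion _ _ powTorsion_transformTorsion)

end IdealTransform

/-! ### The conductor of B over A and the socle of B/A. -/

section Transform

open IsLocalRing Abelian

variable {A : Type u} [CommRing A] {J : Ideal A} {Q : Type u} [CommRing Q] [Algebra A Q]

/-- The socle of `B / A` embeds into `Ext^1(k, A)`. -/
lemma length_linearMap_transformTorsion_le (hinj : Function.Injective (algebraMap A Q)) {r : A}
    (hr : Function.Bijective (fun y : Q => r • y)) (I : Ideal A) (hrI : r ∈ I) :
    Module.length A ((A ⧸ I) →ₗ[A] transformTorsion J Q) ≤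
      Module.length A (Abelian.Ext.{u} (ModuleCat.of A (A ⧸ I)) (ModuleCat.of A A) 1) := by
  have hS := transformShortComplex_shortExact (J := J) hinj
  let f : ((A ⧸ I) →ₗ[A] transformTorsion J Q) →ₗ[A]
      Abelian.Ext.{u} (ModuleCat.of A (A ⧸ I)) (ModuleCat.of A A) 1 :=
    { toFun := fun g => (Ext.mk₀ (ModuleCat.ofHom g)).comp hS.extClass (zero_add 1)
      map_add' := fun g h => by
        rw [← Ext.add_comp, ← Ext.mk₀_add]
        rfl
      map_smul' := fun a g => by
        rw [RingHom.id_apply, ← Ext.smul_comp, ← Ext.mk₀_smul]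
        rfl }
  -- A homomorphism with zero connecting class lifts to B, and Hom(A/I, B) = 0 because `r` kills A/I
  -- and is regular on B.
  have hker (g : (A ⧸ I) →ₗ[A] transformTorsion J Q)
      (hg : (Ext.mk₀ (ModuleCat.ofHom g)).comp hS.extClass (zero_add 1) = 0) : g = 0 := by
    obtain ⟨x, hx⟩ := Ext.covariant_sequence_exact₃ _ hS _ rfl hg
    obtain ⟨x, rfl⟩ := (Ext.mk₀_bijective _ _).2 x
    have hx0 : x = 0 := by
      refine ModuleCat.hom_ext (LinearMap.ext fun y => ?_)
      have h1 : r • x.hom y = 0 := by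
        obtain ⟨y, rfl⟩ := Ideal.Quotient.mk_surjective y
        rw [← map_smul]
        have : r • (Ideal.Quotient.mk I y) = 0 :=
          Ideal.Quotient.eq_zero_iff_mem.2 (Ideal.mul_mem_right y _ hrI)
        rw [this, map_zero]
      exact Subtype.ext (hr.1 ((congrArg Subtype.val h1).trans (smul_zero r).symm))
    rw [hx0, Ext.mk₀_comp_mk₀, zero_comp] at hx
    exact congrArg ModuleCat.Hom.hom ((Ext.mk₀_bijective _ _).1 hx).symm
  refine Module.length_le_of_injective f fun g h hgh => sub_eq_zero.1 (hker _ ?_)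
  have h1 : f (g - h) + f h = f g :=
    (f.map_add _ _).symm.trans (congrArg f (sub_add_cancel g h))
  rw [hgh] at h1
  exact add_eq_right.1 h1

/-- The annihilator of B/A is the conductor, so it is an ideal of B as well. -/
lemma smul_mem_range_of_mem_annihilator {a : A}
    (ha : a ∈ Module.annihilator A (transformTorsion J Q)) (b : idealTransform J Q) :
    ∃ z ∈ Module.annihilator A (transformTorsion J Q),
      algebraMap A (idealTransform J Q) z = a • b := by
  have h (w : idealTransform J Q) : ∃ z, algebraMap A (idealTransform J Q) z = a • w := by
    rw [← idealTransformMk_eq_zero, map_smul, Module.mem_annihilator.1 ha]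
  obtain ⟨z, hz⟩ := h b
  refine ⟨z, Module.mem_annihilator.2 fun t => ?_, hz⟩
  obtain ⟨w, rfl⟩ := idealTransformMk_surjective t
  rw [← map_smul, idealTransformMk_eq_zero, Algebra.smul_def, hz, smul_mul_assoc]
  exact h _

/-- One factor of the conductor absorbs B. The exponent must be positive, since power 0 would give B
on one side and A on the other. -/
lemma annihilator_pow_smul_top (n : ℕ) :
    (Module.annihilator A (transformTorsion J Q) ^ (n + 1) •
      (⊤ : Submodule A (idealTransform J Q))) =
      Submodule.map (Algebra.linearMap A (idealTransform J Q))
        (Module.annihilator A (transformTorsion J Q) ^ (n + 1)) := by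
  refine le_antisymm (Submodule.smul_le.2 fun a ha b _ => ?_) ?_
  · rw [pow_succ] at ha
    induction ha using Submodule.mul_induction_on' with
    | mem_mul_mem x hx y hy =>
      obtain ⟨z, hz, h⟩ := smul_mem_range_of_mem_annihilator hy b
      refine ⟨x * z, by rw [pow_succ]; exact Ideal.mul_mem_mul hx hz, ?_⟩
      rw [mul_smul, ← h, Algebra.linearMap_apply, map_mul, ← Algebra.smul_def]
    | add x _ y _ hx hy =>
      rw [add_smul]
      exact add_mem hx hy
  · rintro _ ⟨a, ha, rfl⟩
    rw [Algebra.linearMap_apply, Algebra.algebraMap_eq_smul_one]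
    exact Submodule.smul_mem_smul ha trivial

/-- If `c` is the annihilator of `B / A`, then `c ^ (n + 1) B = c ^ (n + 1)`. -/
lemma length_quotient_annihilator_pow_smul_top (hinj : Function.Injective (algebraMap A Q)) (n : ℕ) :
    Module.length A (idealTransform J Q ⧸ (Module.annihilator A (transformTorsion J Q) ^ (n + 1) •
      (⊤ : Submodule A (idealTransform J Q)))) =
      Module.length A (A ⧸ Module.annihilator A (transformTorsion J Q) ^ (n + 1)) +
        Module.length A (transformTorsion J Q) := by
  set I := Module.annihilator A (transformTorsion J Q) ^ (n + 1) with hI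
  have hc := annihilator_pow_smul_top (J := J) (Q := Q) n
  rw [← hI] at hc
  have hker : (I • (⊤ : Submodule A (idealTransform J Q))) ≤ LinearMap.ker (idealTransformMk J Q) := by
    rw [hc]
    rintro _ ⟨a, -, rfl⟩
    exact idealTransformMk_eq_zero.2 ⟨a, rfl⟩
  have hcomap : I = (I • (⊤ : Submodule A (idealTransform J Q))).comap (Algebra.linearMap A _) := by
    rw [hc, Submodule.comap_map_eq_of_injective (algebraMap_idealTransform_injective hinj)]
  refine Module.length_eq_add_of_exact (Submodule.mapQ I _ (Algebra.linearMap A _) hcomap.le)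
    (Submodule.liftQ _ (idealTransformMk J Q) hker) ?_ ?_ ?_
  · rw [← LinearMap.ker_eq_bot]
    exact Submodule.ker_liftQ_eq_bot _ _ _ (by rw [LinearMap.ker_comp, Submodule.ker_mkQ, ← hcomap])
  · intro t
    obtain ⟨b, rfl⟩ := idealTransformMk_surjective t
    exact ⟨Submodule.Quotient.mk b, rfl⟩
  · intro v
    obtain ⟨b, rfl⟩ := Submodule.Quotient.mk_surjective _ v
    refine (idealTransformMk_eq_zero (b := b)).trans ⟨?_, ?_⟩
    · rintro ⟨a, rfl⟩
      exact ⟨Submodule.Quotient.mk a, rfl⟩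
    · rintro ⟨a, ha⟩
      obtain ⟨a, rfl⟩ := Submodule.Quotient.mk_surjective _ a
      have h1 : Algebra.linearMap A _ a - b ∈ I • (⊤ : Submodule A (idealTransform J Q)) :=
        (Submodule.Quotient.eq _).1 ha
      rw [hc] at h1
      obtain ⟨x, -, hx⟩ := h1
      exact ⟨a - x, by rw [map_sub, sub_eq_iff_eq_add', ← sub_eq_iff_eq_add]; exact hx.symm⟩

variable [IsLocalRing A] [IsNoetherianRing A]

/-- If the socle of `B / A` is simple, then `B / c B` is self-injective for the annihilator `c` of
`B / A`. -/
theorem injective_quotient_annihilator_map [Module.Finite A (idealTransform J Q)]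
    (hT : Module.length A ((A ⧸ maximalIdeal A) →ₗ[A] transformTorsion J Q) ≤ 1) {c : Ideal A}
    (hc : c = Module.annihilator A (transformTorsion J Q)) {s : ℕ} (hs : maximalIdeal A ^ s ≤ c) :
    Module.Injective (idealTransform J Q ⧸ c.map (algebraMap A (idealTransform J Q)))
      (idealTransform J Q ⧸ c.map (algebraMap A (idealTransform J Q))) := by
  set I := c.map (algebraMap A (idealTransform J Q)) with hI
  have hker : I.restrictScalars A ≤ LinearMap.ker (idealTransformMk J Q) := by
    rw [hI, ← Ideal.smul_top_eq_map, Submodule.smul_le]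
    intro a ha b _
    rw [LinearMap.mem_ker, map_smul]
    rw [hc] at ha
    exact Module.mem_annihilator.1 ha _
  let π : (idealTransform J Q ⧸ I) →ₗ[A] transformTorsion J Q :=
    Submodule.liftQ (I.restrictScalars A) (idealTransformMk J Q) hker ∘ₗ
      (Submodule.Quotient.restrictScalarsEquiv A I).symm.toLinearMap
  have hπ (b : idealTransform J Q) : π (Ideal.Quotient.mk I b) = idealTransformMk J Q b := rfl
  refine (Module.baer_of_nondegenerate hT (V := idealTransform J Q ⧸ I) ?_ π ?_).injective
  · refine isFiniteLength_of_pow_smul_eq_zero (k := s) fun a ha x => ?_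
    obtain ⟨x, rfl⟩ := Ideal.Quotient.mk_surjective x
    change Ideal.Quotient.mk I (a • x) = 0
    rw [Ideal.Quotient.eq_zero_iff_mem, Algebra.smul_def]
    exact Ideal.mul_mem_right _ _ (Ideal.mem_map_of_mem _ (hs ha))
  -- If b w lies in A for all w in B, then b is in A by taking w = 1, and b annihilates B/A, so b is
  -- in `c`.
  · intro v hv
    obtain ⟨b, rfl⟩ := Ideal.Quotient.mk_surjective v
    have hb (w : idealTransform J Q) : idealTransformMk J Q (b * w) = 0 := by
      rw [← hπ, map_mul]
      exact hv _
    obtain ⟨a, rfl⟩ := idealTransformMk_eq_zero.1 ((congrArg _ (mul_one b).symm).trans (hb 1))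
    rw [Ideal.Quotient.eq_zero_iff_mem]
    refine Ideal.mem_map_of_mem _ (hc ▸ Module.mem_annihilator.2 fun t => ?_)
    obtain ⟨w, rfl⟩ := idealTransformMk_surjective t
    rw [← map_smul, Algebra.smul_def]
    exact hb w

end Transform

/-! ### Gorenstein rings, and the multiplicity of B. -/

theorem isGorensteinRing_of_hasInjectiveDimensionLE (R : Type u) [CommRing R] [IsNoetherianRing R]
    (n : ℕ) [HasInjectiveDimensionLE (ModuleCat.of R R) n] : IsGorensteinRing R := by
  refine ⟨inferInstance, fun p _ => ⟨n, ?_⟩⟩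
  have h := (ModuleCat.of R R).localizedModule_hasInjectiveDimensionLE n p.primeCompl
  let e : LocalizedModule p.primeCompl R ≃ₗ[Localization.AtPrime p] Localization.AtPrime p :=
    (IsLocalizedModule.linearEquiv p.primeCompl (LocalizedModule.mkLinearMap p.primeCompl R)
      (Algebra.linearMap R (Localization.AtPrime p))).extendScalarsOfIsLocalization p.primeCompl _
  exact (ModuleCat.hasInjectiveDimensionLE_iff_of_linearEquiv
    (N := ModuleCat.of (Localization.AtPrime p) (Localization.AtPrime p))
    ((Shrink.linearEquiv.{u} (Localization.AtPrime p) (LocalizedModule p.primeCompl R)).trans e)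
    n).1 h

section Multiplicity

open IsLocalRing Abelian localCohomology

variable {A : Type u} [CommRing A]

lemma bijective_smul_fractionRing {r : A} (hr : r ∈ nonZeroDivisors A) :
    Function.Bijective (fun y : FractionRing A => r • y) := by
  have h : IsUnit (algebraMap A (FractionRing A) r) := IsLocalization.map_units _ ⟨r, hr⟩
  simp only [Algebra.smul_def]
  exact IsUnit.isUnit_iff_mulLeft_bijective.1 h

lemma exists_mem_nonZeroDivisors_of_localDepth_ne_zero [IsLocalRing A] (h : localDepth A A ≠ 0) :
    ∃ r ∈ maximalIdeal A, r ∈ nonZeroDivisors A := by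
  obtain ⟨rs, hl, hm, hr⟩ := exists_isRegular_of_le_localDepth (R := A) (M := A) (t := 0)
    (by simpa [Order.one_le_iff_pos, pos_iff_ne_zero] using h)
  obtain _ | ⟨r, rs⟩ := rs
  · simp at hl
  · refine ⟨r, hm r (by simp), ?_⟩
    have h1 := ((RingTheory.Sequence.isWeaklyRegular_cons_iff A r rs).1 hr.1).1
    exact isRegular_iff_mem_nonZeroDivisors.1 ((Commute.isRegular_iff (Commute.all r)).2 h1)

/-- A constant difference is negligible against `n ^ d` for positive `d`. It is required at positive
indices only, as the Hilbert-Samuel functions of A and B differ by ℓ(B/A) there. -/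
lemma frequently_le_of_tendsto {d : ℕ} (hd : d ≠ 0) {f g : ℕ → ℝ} {e l : ℝ}
    (h : Tendsto (fun n : ℕ => (d.factorial : ℝ) * f n / (n : ℝ) ^ d) atTop (𝓝 e))
    (hg : ∀ n, g (n + 1) = f (n + 1) + l) :
    ∀ ε > 0, ∃ᶠ n : ℕ in atTop, (d.factorial : ℝ) * g n ≤ (e + ε) * (n : ℝ) ^ d := by
  intro ε hε
  have h0 : Tendsto (fun n : ℕ => (d.factorial : ℝ) * l / (n : ℝ) ^ d) atTop (𝓝 0) :=
    tendsto_const_nhds.div_atTop ((tendsto_pow_atTop hd).comp tendsto_natCast_atTop_atTop)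
  have h1 := h.add h0
  rw [add_zero] at h1
  refine Eventually.frequently ?_
  filter_upwards [h1.eventually_lt_const (lt_add_of_pos_right e hε), eventually_ge_atTop 1]
    with n hn hn1
  obtain ⟨n, rfl⟩ := Nat.exists_eq_add_of_le' hn1
  rw [← add_div, div_lt_iff₀ (by positivity)] at hn
  rw [hg, mul_add]
  exact hn.le

variable [IsLocalRing A] [IsNoetherianRing A] {Q : Type u} [CommRing Q] [Algebra A Q]

/-- If the ideal transform `B` of `A` has an `A`-regular sequence of length `dim A`, the module
`B / A` has simple socle, and its annihilator `c` is a proper ideal of multiplicity `2 ℓ(A / c)`,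
then `B` has finite injective dimension. -/
theorem hasInjectiveDimensionLE_idealTransform (hinj : Function.Injective (algebraMap A Q))
    [Module.Finite A (transformTorsion (maximalIdeal A) Q)]
    (hT : Module.length A ((A ⧸ maximalIdeal A) →ₗ[A] transformTorsion (maximalIdeal A) Q) ≤ 1)
    {c : Ideal A} (hc : c = Module.annihilator A (transformTorsion (maximalIdeal A) Q))
    (hcm : c ≤ maximalIdeal A) {rs : List A} (hrs : rs ≠ []) (hrm : ∀ r ∈ rs, r ∈ maximalIdeal A)
    (hrr : RingTheory.Sequence.IsWeaklyRegular (idealTransform (maximalIdeal A) Q) rs)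
    (hmult : Tendsto (fun n : ℕ => (rs.length.factorial : ℝ) *
      ((Module.length A (A ⧸ c ^ n)).toNat : ℝ) / (n : ℝ) ^ rs.length) atTop
      (𝓝 (2 * ((Module.length A (A ⧸ c)).toNat : ℝ)))) :
    HasInjectiveDimensionLE (ModuleCat.of (idealTransform (maximalIdeal A) Q)
      (idealTransform (maximalIdeal A) Q)) rs.length := by
  have hB : Module.Finite A (idealTransform (maximalIdeal A) Q) := finite_idealTransform
  obtain ⟨s, hs⟩ := exists_pow_smul_eq_zero
    (powTorsion_transformTorsion (J := maximalIdeal A) (Q := Q))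
  have hTf : IsFiniteLength A (transformTorsion (maximalIdeal A) Q) :=
    isFiniteLength_of_pow_smul_eq_zero hs
  have hsc : maximalIdeal A ^ s ≤ c := fun a ha => hc ▸ Module.mem_annihilator.2 (hs a ha)
  have hlT := Module.length_eq_length_quotient_annihilator hT hTf
  rw [← hc] at hlT
  have hlen (n : ℕ) := length_quotient_annihilator_pow_smul_top (J := maximalIdeal A) hinj n
  rw [← hc, hlT] at hlen
  have hfin (n : ℕ) : Module.length A (A ⧸ c ^ n) ≠ ⊤ := by
    have := Ideal.length_ne_top hsc A n
    rwa [smul_eq_mul, Ideal.mul_top] at this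
  have hfin1 : Module.length A (A ⧸ c) ≠ ⊤ := by
    have := hfin 1
    rwa [pow_one] at this
  have := injective_quotient_annihilator_map hT hc hsc
  -- The value `e` is both the multiplicity of B and ℓ(B/cB) = ℓ(A/c) + ℓ(B/A), as ℓ(B/A) = ℓ(A/c).
  refine hasInjectiveDimensionLE_of_multiplicity _ hsc hcm rs hrm hrr
    (e := 2 * (Module.length A (A ⧸ c)).toNat) ?_ ?_
  · have h1 := hlen 0
    rw [zero_add, pow_one] at h1
    push_cast
    rw [ENat.natCast_toNat hfin1, two_mul, ← h1]
    exact (Submodule.quotEquivOfEq (c • (⊤ : Submodule A (idealTransform (maximalIdeal A) Q)))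
      ((c.map (algebraMap A _)).restrictScalars A) (Ideal.smul_top_eq_map c)).length_eq.symm
  · push_cast
    refine frequently_le_of_tendsto (by simpa using hrs) hmult
      (l := (Module.length A (A ⧸ c)).toNat) fun n => ?_
    rw [Ideal.hilbertSamuel, hlen, ENat.toNat_add (hfin _) hfin1, Nat.cast_add]

end Multiplicity

/-! ### Maximal Cohen-Macaulay modules and Serre's condition. -/

section Serre

open IsLocalRing RingTheory.Sequence

lemma exists_mem_isSMulRegular_or_le_associatedPrime {A : Type*} [CommRing A] [IsNoetherianRing A]
    (M : Type*) [AddCommGroup M] [Module A M] [Module.Finite A M] (I : Ideal A) :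
    (∃ x ∈ I, IsSMulRegular M x) ∨ ∃ q ∈ associatedPrimes A M, I ≤ q := by
  by_contra! h
  have h1 : (I : Set A) ⊆ ⋃ p ∈ associatedPrimes A M, (p : Set A) := by
    rw [biUnion_associatedPrimes_eq_compl_regular]
    exact fun x hx => h.1 x hx
  obtain ⟨q, hq, hI⟩ := (Ideal.subset_union_prime_finite (f := id) (associatedPrimes.finite A M)
    ⊥ ⊥ (fun q hq _ _ => hq.isPrime)).1 h1
  exact h.2 q hq hI

/-- Combines t ≤ coheight q ≤ coheight p with height p + coheight p ≤ dim A. -/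
lemma height_add_le_of_le_associatedPrime {A : Type u} [CommRing A] [IsLocalRing A]
    [IsNoetherianRing A] {t d : ℕ} (hd : ringKrullDim A ≤ d) {M : ModuleCat.{u} A}
    [Module.Finite A M] (h : DepthGE t M) {p q : Ideal A} [hp : p.IsPrime]
    (hq : q ∈ associatedPrimes A M) (hpq : p ≤ q) : p.height + t ≤ d := by
  have h1 := h.le_coheight ⟨q, hq.isPrime⟩ hq
  have h2 : Order.coheight (⟨q, hq.isPrime⟩ : PrimeSpectrum A) ≤
      Order.coheight (⟨p, hp⟩ : PrimeSpectrum A) := Order.coheight_anti hpq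
  have h3 : ((Order.height (⟨p, hp⟩ : PrimeSpectrum A) +
      Order.coheight (⟨p, hp⟩ : PrimeSpectrum A) : ℕ∞) : WithBot ℕ∞) ≤ d := by
    refine le_trans ?_ hd
    rw [ringKrullDim, Order.krullDim_eq_iSup_height_add_coheight_of_nonempty]
    exact_mod_cast le_iSup (fun a : PrimeSpectrum A => Order.height a + Order.coheight a) ⟨p, hp⟩
  rw [show p.height = _ from PrimeSpectrum.height_eq_orderHeight ⟨p, hp⟩]
  refine le_trans ?_ (by exact_mod_cast h3)
  exact add_le_add le_rfl (h1.trans h2)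

lemma length_le_localDepth_localization {A : Type*} [CommRing A] {M : Type*} [AddCommGroup M]
    [Module A M] [Module.Finite A M] {p : PrimeSpectrum A} (hp : p ∈ Module.support A M)
    {rs : List A} (hr : IsWeaklyRegular M rs) (hrp : ∀ r ∈ rs, r ∈ p.asIdeal) :
    (rs.length : ℕ∞) ≤ localDepth (Localization.AtPrime p.asIdeal)
      (LocalizedModule p.asIdeal.primeCompl M) := by
  have : Nontrivial (LocalizedModule p.asIdeal.primeCompl M) := hp
  have h := hr.isRegular_of_isLocalizedModule_of_mem (Localization.AtPrime p.asIdeal) p.asIdeal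
    (LocalizedModule.mkLinearMap p.asIdeal.primeCompl M) hrp
  rw [← List.length_map (algebraMap A (Localization.AtPrime p.asIdeal))]
  refine le_iSup (fun rs : {rs : List (Localization.AtPrime p.asIdeal) // (∀ r ∈ rs, r ∈
    maximalIdeal _) ∧ IsRegular (LocalizedModule p.asIdeal.primeCompl M) rs} =>
    (rs.1.length : ℕ∞)) ⟨_, fun r hr => ?_, h⟩
  obtain ⟨r', hr', rfl⟩ := List.mem_map.1 hr
  exact (IsLocalization.AtPrime.to_map_mem_maximal_iff _ p.asIdeal r').2 (hrp r' hr')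

lemma supportDim_localization_le {A : Type*} [CommRing A] {M : Type*} [AddCommGroup M]
    [Module A M] (p : Ideal A) [p.IsPrime] :
    Module.supportDim (Localization.AtPrime p) (LocalizedModule p.primeCompl M) ≤ p.height := by
  rw [← IsLocalization.AtPrime.ringKrullDim_eq_height p (Localization.AtPrime p)]
  exact Module.supportDim_le_ringKrullDim _ _

/-- A maximal Cohen-Macaulay module satisfies Serre's condition `(S_2)`. -/
theorem satisfiesSerre_two_of_depthGE {A : Type u} [CommRing A] [IsLocalRing A]
    [IsNoetherianRing A] {d : ℕ} (hd : ringKrullDim A ≤ d) {M : ModuleCat.{u} A}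
    [Module.Finite A M] (h : DepthGE d M) : SatisfiesSerre A M 2 := by
  intro p hp
  have hs := supportDim_localization_le (M := M) p.asIdeal
  -- Regular elements are sought inside `p` itself. If the search stops after 0 or 1 elements, `p`
  -- lies in an associated prime of the quotient reached, and its height is at most that number.
  rcases exists_mem_isSMulRegular_or_le_associatedPrime M p.asIdeal with ⟨x, hxp, hx⟩ | ⟨q, hq, hpq⟩
  · have h1 : DepthGE (d - 1) (ModuleCat.of A (QuotSMulTop x M)) := by
      obtain _ | d := d
      · intro i hi
        lia
      · exact h.quotSMulTop hx
    rcases exists_mem_isSMulRegular_or_le_associatedPrime (QuotSMulTop x M) p.asIdeal with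
      ⟨y, hyp, hy⟩ | ⟨q, hq, hpq⟩
    · refine (min_le_left _ _).trans (WithBot.coe_le_coe.2 ?_)
      exact length_le_localDepth_localization hp (rs := [x, y])
        (.cons hx (.cons hy (.nil _ _))) (by simp [hxp, hyp])
    · refine (min_le_right _ _).trans (hs.trans ?_)
      have h2 := length_le_localDepth_localization hp (rs := [x]) (.cons hx (.nil _ _))
        (by simp [hxp])
      have h3 := height_add_le_of_le_associatedPrime hd h1 hq hpq
      have h4 : p.asIdeal.height ≤ (1 : ℕ) := by
        obtain ⟨n, hn⟩ := ENat.ne_top_iff_exists.1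
          (ne_top_of_le_ne_top (ENat.natCast_ne_top d) (le_self_add.trans h3))
        rw [← hn] at h3 ⊢
        norm_cast at h3 ⊢
        lia
      exact_mod_cast h4.trans h2
  · have h3 := height_add_le_of_le_associatedPrime hd h hq hpq
    have h4 : p.asIdeal.height ≤ (0 : ℕ) := by
      obtain ⟨n, hn⟩ := ENat.ne_top_iff_exists.1
        (ne_top_of_le_ne_top (ENat.natCast_ne_top d) (le_self_add.trans h3))
      rw [← hn] at h3 ⊢
      norm_cast at h3 ⊢
      lia
    exact (min_le_right _ _).trans (hs.trans (by exact_mod_cast h4.trans (zero_le (a := localDepth _ _))))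

end Serre

/-! ### Minimality of the ideal transform among (S_2) extensions. -/

section Minimality

open IsLocalRing RingTheory.Sequence

/-- Serre's condition speaks of localizations even at the maximal ideal, where localizing changes
neither ring nor module; the sequence is carried back. -/
lemma exists_isWeaklyRegular_of_le_localDepth_localization {A : Type*} [CommRing A] [IsLocalRing A]
    {M : Type*} [AddCommGroup M] [Module A M] {t : ℕ}
    (h : ((t + 1 : ℕ) : ℕ∞) ≤ localDepth (Localization.AtPrime (maximalIdeal A))
      (LocalizedModule (maximalIdeal A).primeCompl M)) :
    ∃ rs : List A, t + 1 ≤ rs.length ∧ (∀ r ∈ rs, r ∈ maximalIdeal A) ∧ IsWeaklyRegular M rs := by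
  obtain ⟨ss, hl, hm, hr⟩ := exists_isRegular_of_le_localDepth h
  have hu : (maximalIdeal A).primeCompl ≤ IsUnit.submonoid A := fun x hx => by
    by_contra h
    exact hx h
  have hA : IsLocalization (maximalIdeal A).primeCompl A :=
    IsLocalization.self hu
  have hid : IsLocalizedModule (maximalIdeal A).primeCompl (LinearMap.id : M →ₗ[A] M) :=
    isLocalizedModule_id _ M A
  let e : LocalizedModule (maximalIdeal A).primeCompl M ≃ₗ[A] M :=
    IsLocalizedModule.linearEquiv (maximalIdeal A).primeCompl
      (LocalizedModule.mkLinearMap (maximalIdeal A).primeCompl M) LinearMap.id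
  let φ := IsLocalization.atUnits A (S := Localization.AtPrime (maximalIdeal A))
    (maximalIdeal A).primeCompl hu
  obtain ⟨rs, rfl⟩ : ∃ rs : List A, rs.map (algebraMap A _) = ss :=
    ⟨ss.map φ.symm, by
      rw [List.map_map]
      refine List.map_id'' (fun x => ?_) ss
      exact (φ.commutes (φ.symm x)).symm.trans (φ.apply_symm_apply x)⟩
  rw [List.length_map] at hl
  refine ⟨rs, hl, fun r hr => ?_, ?_⟩
  · exact (IsLocalization.AtPrime.to_map_mem_maximal_iff _ (maximalIdeal A) r).1
      (hm _ (List.mem_map_of_mem hr))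
  · rw [← e.isWeaklyRegular_congr]
    exact (isWeaklyRegular_map_algebraMap_iff _ _ rs).1 hr.1

lemma height_le_supportDim_localization {A : Type*} [CommRing A] {M : Type*} [AddCommGroup M]
    [Module A M] (p : Ideal A) [p.IsPrime] (f : A →ₗ[A] M) (hf : Function.Injective f) :
    (p.height : WithBot ℕ∞) ≤
      Module.supportDim (Localization.AtPrime p) (LocalizedModule p.primeCompl M) := by
  rw [← IsLocalization.AtPrime.ringKrullDim_eq_height p (Localization.AtPrime p),
    ← Module.supportDim_self_eq_ringKrullDim]
  exact Module.supportDim_le_of_injective (IsLocalizedModule.mapExtendScalars p.primeCompl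
    (Algebra.linearMap A (Localization.AtPrime p)) (LocalizedModule.mkLinearMap p.primeCompl M)
    (Localization.AtPrime p) f) (IsLocalizedModule.map_injective _ _ _ f hf)

lemma exists_isSMulRegular_pair_of_satisfiesSerre {A : Type*} [CommRing A] [IsLocalRing A]
    {M : Type*} [AddCommGroup M] [Module A M] (hd : 2 ≤ ringKrullDim A)
    (f : A →ₗ[A] M) (hf : Function.Injective f) (h : SatisfiesSerre A M 2) :
    ∃ x ∈ maximalIdeal A, ∃ y ∈ maximalIdeal A, IsSMulRegular M x ∧
      IsSMulRegular (QuotSMulTop x M) y := by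
  have hdim : 2 ≤ Module.supportDim (Localization.AtPrime (maximalIdeal A))
      (LocalizedModule (maximalIdeal A).primeCompl M) :=
    (hd.trans (maximalIdeal_height_eq_ringKrullDim (R := A)).ge).trans
      (height_le_supportDim_localization _ f hf)
  have hmem : closedPoint A ∈ Module.support A M := by
    rw [Module.mem_support_iff]
    change Nontrivial (LocalizedModule (maximalIdeal A).primeCompl M)
    refine (Module.supportDim_ne_bot_iff_nontrivial (Localization.AtPrime (maximalIdeal A)) _).1
      fun h0 => ?_
    rw [h0] at hdim
    exact absurd hdim (by decide)
  have h2 := h _ hmem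
  obtain ⟨rs, hl, hm, hr⟩ := exists_isWeaklyRegular_of_le_localDepth_localization (t := 1)
    (WithBot.coe_le_coe.1 ((le_min le_rfl hdim).trans h2))
  match rs, hl, hm, hr with
  | x :: y :: rs, _, hm, hr =>
    rw [isWeaklyRegular_cons_iff, isWeaklyRegular_cons_iff] at hr
    exact ⟨x, hm x (by simp), y, hm y (by simp), hr.1, hr.2.1⟩

/-- Since y^n x^(k+1) b = x (x^k y^n b) lies in xC, regularity of `y` on C/xC puts x^(k+1) b in xC.
Cancelling `x` in `Q` lowers the exponent. -/
lemma mem_of_isSMulRegular_pair {A Q : Type*} [CommRing A] [AddCommGroup Q] [Module A Q]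
    (C : Submodule A Q) {x y : A} (hxQ : IsSMulRegular Q x)
    (hy : IsSMulRegular (QuotSMulTop x C) y) {b : Q} {n k : ℕ} (hn : y ^ n • b ∈ C)
    (hk : x ^ k • b ∈ C) : b ∈ C := by
  induction k with
  | zero => simpa using hk
  | succ k ih =>
    refine ih ?_
    have h1 : (Submodule.Quotient.mk ⟨x ^ (k + 1) • b, hk⟩ : QuotSMulTop x C) = 0 := by
      refine hy.pow n ?_
      change y ^ n • Submodule.Quotient.mk (⟨x ^ (k + 1) • b, hk⟩ : C) =
        y ^ n • (0 : QuotSMulTop x C)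
      rw [smul_zero, ← Submodule.Quotient.mk_smul, Submodule.Quotient.mk_eq_zero,
        Submodule.mem_smul_pointwise_iff_exists]
      refine ⟨⟨x ^ k • y ^ n • b, C.smul_mem _ hn⟩, trivial, Subtype.ext ?_⟩
      change x • x ^ k • y ^ n • b = y ^ n • x ^ (k + 1) • b
      simp only [smul_smul]
      congr 1
      ring
    rw [Submodule.Quotient.mk_eq_zero, Submodule.mem_smul_pointwise_iff_exists] at h1
    obtain ⟨w, -, hw⟩ := h1
    have h2 : x • (w : Q) = x • x ^ k • b := by
      rw [smul_smul, ← pow_succ']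
      exact congrArg Subtype.val hw
    rw [← hxQ h2]
    exact w.2

/-- The ideal transform with respect to the maximal ideal is contained in every extension of `A` in
the total ring of fractions that satisfies Serre's condition `(S_2)`. -/
theorem idealTransform_le_of_satisfiesSerre {A : Type u} [CommRing A] [IsLocalRing A]
    (hd : 2 ≤ ringKrullDim A) {C : Subalgebra A (FractionRing A)} (hC : SatisfiesSerre A C 2) :
    idealTransform (maximalIdeal A) (FractionRing A) ≤ C := by
  have hinj : Function.Injective (Algebra.linearMap A C) := fun a b h =>
    IsFractionRing.injective A (FractionRing A) (congrArg Subtype.val h)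
  obtain ⟨x, hx, y, hy, hxr, hyr⟩ := exists_isSMulRegular_pair_of_satisfiesSerre hd _ hinj hC
  have hxA : x ∈ nonZeroDivisors A := by
    refine isRegular_iff_mem_nonZeroDivisors.1 ((Commute.isRegular_iff (Commute.all x)).2 ?_)
    intro a b hab
    refine hinj (hxr ?_)
    change x • Algebra.linearMap A C a = x • Algebra.linearMap A C b
    rw [← map_smul, ← map_smul]
    exact congrArg _ hab
  rintro b ⟨n, hn⟩
  have h (a : A) (ha : a ∈ maximalIdeal A) : a ^ n • b ∈ Subalgebra.toSubmodule C := by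
    obtain ⟨u, hu⟩ := hn _ (Ideal.pow_mem_pow ha n)
    rw [← hu]
    exact C.algebraMap_mem u
  exact mem_of_isSMulRegular_pair (Subalgebra.toSubmodule C) (bijective_smul_fractionRing hxA).1
    hyr (h y hy) (h x hx)

end Minimality

end

/-! ### The main theorem. -/

section Main

open IsLocalRing

theorem mainTheorem4 (A : Type u) [CommRing A] [IsLocalRing A] [IsNoetherianRing A]
    (d : ℕ) (hd : ringKrullDim A = d) (hd2 : 2 ≤ d)
    (hvanish : ∀ i : ℕ, i ≠ 1 → i ≠ d → Subsingleton (localCohomologySelf A i))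
    (hfin : IsFiniteLength A (localCohomologySelf A 1))
    (hdepth : localDepth A A = 1)
    (htype : moduleType A A = 1)
    (c : Ideal A) (hc : c = Module.annihilator A (localCohomologySelf A 1))
    (hmult : HasMultiplicity c (2 * ((Module.length A (A ⧸ c)).toNat : ℝ))) :
    ∃ B : Subalgebra A (FractionRing A), IsS2ification A B ∧ IsGorensteinRing B := by
  obtain ⟨r, hrm, hr⟩ := exists_mem_nonZeroDivisors_of_localDepth_ne_zero (A := A)
    (by rw [hdepth]; exact one_ne_zero)
  have hinj := IsFractionRing.injective A (FractionRing A)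
  have hbij := bijective_smul_fractionRing hr
  obtain ⟨e⟩ := nonempty_transformTorsion_linearEquiv hinj hrm hbij
  have hfinT : Module.Finite A (transformTorsion (maximalIdeal A) (FractionRing A)) := by
    have := (isFiniteLength_iff_isNoetherian_isArtinian.1 hfin).1
    exact Module.Finite.equiv e.symm
  rw [← e.annihilator_eq] at hc
  have hB : Module.Finite A (idealTransform (maximalIdeal A) (FractionRing A)) :=
    finite_idealTransform
  -- A regular sequence of length `d` on B; from here on `d` is `rs.length`.
  obtain ⟨rs, rfl, hrsm, hrs⟩ := exists_isWeaklyRegular_of_vanishes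
    (M := ModuleCat.of A (idealTransform (maximalIdeal A) (FractionRing A)))
    (vanishes_idealTransform hinj hrm hbij hvanish)
  have hT : Module.length A ((A ⧸ maximalIdeal A) →ₗ[A]
      transformTorsion (maximalIdeal A) (FractionRing A)) ≤ 1 := by
    refine (length_linearMap_transformTorsion_le hinj hbij _ hrm).trans ?_
    rw [moduleType, hdepth] at htype
    exact htype.le
  -- If `c` were the unit ideal, B would equal A, and A would have depth d ≥ 2 instead of 1.
  have hcm : c ≤ maximalIdeal A := by
    refine le_maximalIdeal fun htop => ?_
    have hbijB : Function.Bijective (Algebra.linearMap A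
        (idealTransform (maximalIdeal A) (FractionRing A))) := by
      refine ⟨algebraMap_idealTransform_injective hinj, fun b => idealTransformMk_eq_zero.1 ?_⟩
      have h1 : (1 : A) ∈ c := htop ▸ Submodule.mem_top
      rw [hc, Module.mem_annihilator] at h1
      rw [← one_smul A (idealTransformMk _ _ b), h1]
    have hrsA : RingTheory.Sequence.IsWeaklyRegular A rs :=
      ((LinearEquiv.ofBijective _ hbijB).isWeaklyRegular_congr rs).2 hrs
    have h := (depthGE_of_isWeaklyRegular (M := ModuleCat.of A A) hrsm hrsA).le_localDepth
    rw [show localDepth A (ModuleCat.of A A) = 1 from hdepth] at h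
    have : rs.length ≤ 1 := by exact_mod_cast h
    lia
  obtain ⟨d', hd', hmult⟩ := hmult
  obtain rfl : rs.length = d' := by exact_mod_cast hd.symm.trans hd'
  have hN : IsNoetherianRing (idealTransform (maximalIdeal A) (FractionRing A)) :=
    IsNoetherianRing.of_finite A _
  have := hasInjectiveDimensionLE_idealTransform hinj hT hc hcm
    (fun h => by simp [h] at hd2) hrsm hrs hmult
  refine ⟨idealTransform (maximalIdeal A) (FractionRing A), ⟨⟨hB, ?_⟩, fun C hC => ?_⟩,
    isGorensteinRing_of_hasInjectiveDimensionLE _ rs.length⟩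
  · exact satisfiesSerre_two_of_depthGE hd.le (depthGE_of_isWeaklyRegular hrsm hrs)
  · exact idealTransform_le_of_satisfiesSerre (by rw [hd]; exact_mod_cast hd2) hC.2

end Main
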